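/- Let $m>0$, $\mathcal P=\{p\in\mathbb Z^3: p_1+p_2+p_3=0\}$ and $C_0(p)=(p_1^2+p_2^2+p_3^2+m^2)^{-1}$. *Model.* Let $\mu_C$ be the Gaussian measure under which the $T_p$, $p\in\mathcal P$, are independent centred circular complex Gaussian variables with $\mathbb E|T_p|^2=C_0(p)$ (the Fourier components of the $U(1)$-$T^4_3$ field with closure constraint). For $i=1,2,3$ and $a,b\in\mathbb Z$ let $\mathbb M^i_{ab}=\sum T_p\overline{T_q}$, the sum being over $p,q\in\mathcal P$ with $p_j=q_j$ for $j\ne i$, $p_i=b$, $q_i=a$, and let $S=\sum_{i=1}^3\mathrm{tr}(\mathbb M^i)^2$, so that the interaction is $\lambda S$. Let the $\tau_i(q)$, $i=1,2,3$, $q\in\mathbb Z$, be independent standard real Gaussian variables, with law $\nu$, and let $\Gamma(p)=\sum_i\tau_i(p_i)$. In the intermediate field representation the partition function is $$Z(\lambda)=\int d\nu(\tau)\,e^{-W(\tau)},\qquad W=\sum_{p\in\mathcal P}\ln\bigl(1-i\sqrt{2\lambda}\,C_0(p)\Gamma(p)\bigr),$$ understood as the limit $N\to\infty$ of the integrals $Z_N(\lambda)$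 in which the sum is restricted to $|p_i|\le N$; the free energy is $F=\ln Z$ (principal branch). The perturbative series $\sum_n f_n\lambda^n$ of $F$ is the formal logarithm of $\sum_k\frac{(-\lambda)^k}{k!}\int S^k\,d\mu_C$, and for $r\ge0$ we put $R_rF(\lambda)=F(\lambda)-\sum_{k<r}f_k\lambda^k$. *Theorem.* All powers $S^k$ are $\mu_C$-integrable, and there are constants $\kappa,A,B'>0$, depending only on $m$, such that on the cardioid domain $$\mathcal C_\kappa=\{\lambda=|\lambda|e^{i\phi}:\ -\pi<\phi\le\pi,\ 0<|\lambda|<\kappa\cos^2(\phi/2)\}$$ the following hold. 1. For $\lambda\in\mathcal C_\kappa$ the limit $Z(\lambda)=\lim_N Z_N(\lambda)$ exists and is not zero, and if moreover $\mathrm{Re}\,\lambda\ge0$, then $Z(\lambda)=\int e^{-\lambda S}\,d\mu_C$. 2. $F$ is analytic on $\mathcal C_\kappa$. 3. For all $r\ge0$ and all $\lambda\in\mathcal C_\kappa$: $|R_rF(\lambda)|\le A\,(B')^r\,|\lambda|^r\,r!$. Moreover, the perturbative series of the free energy is Borel summable, with Borel sum $F$: there are $R,\delta,K>0$ and a function $\mathcal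 B$, analytic on $\{t\in\mathbb C:\mathrm{dist}(t,[0,\infty))<\delta\}$, such that $\mathcal B(t)=\sum_n\frac{f_n}{n!}t^n$ for $|t|<\delta$, $|\mathcal B(t)|\le Ke^{|t|/R}$ on that neighbourhood, and, for all $\lambda$ with $\mathrm{Re}(1/\lambda)>1/R$, $$F(\lambda)=\frac1\lambda\int_0^\infty \mathcal B(t)\,e^{-t/\lambda}\,dt$$ with an absolutely convergent integral. -/

import Mathlib

open MeasureTheory ProbabilityTheory Filter Topology
open scoped ComplexConjugate

noncomputable section

namespace TGFT

/-! ### Momenta and propagator -/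

/-- Momenta allowed by the closure constraint: `p ∈ ℤ³` with `p₁ + p₂ + p₃ = 0`. -/
abbrev Mode : Type := {p : Fin 3 → ℤ // ∑ i, p i = 0}

/-- The propagator `C₀(p) = 1 / (p² + m²)`. -/
def C₀ (m : ℝ) (p : Fin 3 → ℤ) : ℝ := (∑ i, (p i : ℝ) ^ 2 + m ^ 2)⁻¹

/-! ### The field theory: Gaussian measure and quartic interaction -/

/-- The law of a centred circular complex Gaussian variable `z` with `E |z|² = c` (`0 ≤ c`). -/
def complexGaussian (c : ℝ) : Measure ℂ :=
  ((gaussianReal 0 (c / 2).toNNReal).prod (gaussianReal 0 (c / 2).toNNReal)).map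
    (fun q : ℝ × ℝ => (q.1 : ℂ) + (q.2 : ℂ) * Complex.I)

instance (c : ℝ) : IsProbabilityMeasure (complexGaussian c) :=
  Measure.isProbabilityMeasure_map (by fun_prop)

/-- The Gaussian measure `dμ_C` of the field, in Fourier components: the `T_p` with
`p₁ + p₂ + p₃ = 0` are independent, with covariance `E (conj T_p · T_p) = C₀(p)`. The components
that violate the closure constraint vanish, so they are not listed. -/
def fieldMeasure (m : ℝ) : Measure (Mode → ℂ) :=
  Measure.infinitePi (fun p : Mode => complexGaussian (C₀ m p.1))

/-- The matrix `𝕄ⁱ`: its entry `(a, b)` is the sum of `T_p conj(T_q)` over the momenta `p`, `q` with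
`p_j = q_j` for `j ≠ i`, `p_i = b` and `q_i = a`. -/
def traceMatrix (T : Mode → ℂ) (i : Fin 3) (a b : ℤ) : ℂ :=
  open Classical in
  ∑' pq : Mode × Mode,
    if (∀ j, j ≠ i → pq.1.1 j = pq.2.1 j) ∧ pq.1.1 i = b ∧ pq.2.1 i = a then
      T pq.1 * conj (T pq.2) else 0

/-- The quartic interaction without its coupling constant: `S = ∑ᵢ tr (𝕄ⁱ)²`. -/
def interaction (T : Mode → ℂ) : ℂ :=
  ∑ i : Fin 3, ∑' ab : ℤ × ℤ, traceMatrix T i ab.1 ab.2 * traceMatrix T i ab.2 ab.1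

/-! ### Perturbative series -/

/-- The perturbative series of the partition function, the formal power series
`∑ₖ (-lam)ᵏ / k! ∫ Sᵏ dμ_C`. -/
def partitionSeries (m : ℝ) : PowerSeries ℂ :=
  PowerSeries.mk fun k =>
    (-1) ^ k / (k.factorial : ℂ) * ∫ T, interaction T ^ k ∂(fieldMeasure m)

/-- The coefficients of the perturbative series of the free energy, the formal logarithm
`∑_{j ≥ 1} (-1)^(j+1) / j (Z - 1)^j` of the series `Z` of the partition function. The series `Z - 1`
has no constant term, so only `j ≤ n` contributes to the coefficient of order `n`. -/
def freeEnergyCoeff (m : ℝ) (n : ℕ) : ℂ :=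
  ∑ j ∈ Finset.Icc 1 n,
    (-1) ^ (j + 1) / (j : ℂ) * PowerSeries.coeff n ((partitionSeries m - 1) ^ j)

/-! ### Intermediate field representation -/

/-- The Gaussian measure `dν_𝕀` of the three real vector fields `τ_i(p)`, `p ∈ ℤ`: independent
standard Gaussian variables. -/
def auxMeasure : Measure (Fin 3 × ℤ → ℝ) :=
  Measure.infinitePi (fun _ : Fin 3 × ℤ => gaussianReal 0 1)

/-- `Γ(p) = τ₁(p₁) + τ₂(p₂) + τ₃(p₃)`. -/
def Γ (τ : Fin 3 × ℤ → ℝ) (p : Fin 3 → ℤ) : ℝ := ∑ i, τ (i, p i)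

/-- The momenta of the closure constraint with `|p_i| ≤ N` for all `i`. -/
def cutoffModes (N : ℕ) : Finset (Fin 3 → ℤ) :=
  (Finset.Icc (fun _ => -(N : ℤ)) (fun _ => (N : ℤ))).filter (fun p => ∑ i, p i = 0)

/-- The loop vertex `W = ∑_p ln (1 - i √(2 lam) C₀(p) Γ(p))` with momentum cutoff `N`, with
principal branches of the square root and of the logarithm. -/
def loopVertex (m : ℝ) (N : ℕ) (lam : ℂ) (τ : Fin 3 × ℤ → ℝ) : ℂ :=
  ∑ p ∈ cutoffModes N,
    Complex.log (1 - Complex.I * (2 * lam) ^ (1 / 2 : ℂ) * ((C₀ m p * Γ τ p : ℝ) : ℂ))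

/-- The partition function with momentum cutoff `N`. -/
def cutoffPartitionFunction (m : ℝ) (N : ℕ) (lam : ℂ) : ℂ :=
  ∫ τ, Complex.exp (-loopVertex m N lam τ) ∂auxMeasure

/-- The partition function `Z(lam) = ∫ dν_𝕀(τ) exp (-W(τ))`. The sum over momenta in `W` does not
converge absolutely, so the integral is the limit in which the cutoff is removed. -/
def partitionFunction (m : ℝ) (lam : ℂ) : ℂ :=
  limUnder atTop fun N : ℕ => cutoffPartitionFunction m N lam

/-- The free energy `F = ln Z`. -/
def freeEnergy (m : ℝ) (lam : ℂ) : ℂ := Complex.log (partitionFunction m lam)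

/-- The remainder of order `r` of the perturbative expansion of the free energy. -/
def remainder (m : ℝ) (r : ℕ) (lam : ℂ) : ℂ :=
  freeEnergy m lam - ∑ k ∈ Finset.range r, freeEnergyCoeff m k * lam ^ k

/-- The interior of the cardioid `|lam| = κ cos² (φ/2)`, where `φ = arg lam`, `-π < φ ≤ π`. -/
def cardioid (κ : ℝ) : Set ℂ :=
  {lam | lam ≠ 0 ∧ ‖lam‖ < κ * Real.cos (lam.arg / 2) ^ 2}

end TGFT

/-- The series `∑ aₙ lamⁿ` is Borel summable, with Borel sum `f`: its Borel transform
`∑ aₙ tⁿ / n!` converges near zero to a function `B` which continues analytically to a neighbourhood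
`{t | dist (t, [0, ∞)) < δ}` of the half line, grows there at most like `exp (|t| / R)`, and whose
Laplace transform converges absolutely and represents `f` in the disk `Re (1 / lam) > 1 / R`. -/
def IsBorelSummable (a : ℕ → ℂ) (f : ℂ → ℂ) : Prop :=
  ∃ (R δ K : ℝ) (B : ℂ → ℂ), 0 < R ∧ 0 < δ ∧
    AnalyticOnNhd ℂ B (Metric.thickening δ (Complex.ofReal '' Set.Ici 0)) ∧
    (∀ t : ℂ, ‖t‖ < δ → HasSum (fun n : ℕ => a n / (n.factorial : ℂ) * t ^ n) (B t)) ∧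
    (∀ t ∈ Metric.thickening δ (Complex.ofReal '' Set.Ici 0), ‖B t‖ ≤ K * Real.exp (‖t‖ / R)) ∧
    ∀ lam : ℂ, 1 / R < (lam⁻¹).re →
      IntegrableOn (fun t : ℝ => B t * Complex.exp (-(t : ℂ) / lam)) (Set.Ioi 0) ∧
      f lam = lam⁻¹ * ∫ t in Set.Ioi (0 : ℝ), B t * Complex.exp (-(t : ℂ) / lam)

end

noncomputable section

/-! ### Tools from complex analysis -/

/-! The closure constraint makes a mode determined by any two of its components, so the matrices
`𝕄ⁱ` are diagonal and the interaction is a sum, over pairs (colour, component), of squares of fibre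
sums of `|T_p|²`. For real `z = √(2 lam)` the Hubbard–Stratonovich identity and Fubini turn the
field integral into the Gaussian average of `∏ (1 - i z C₀(p) Γ(p))⁻¹`.

Everything rests on a bound of this product that is uniform in the cutoff. The terms of first order
in `z` add up to the linear form `linSum`, a Gaussian variable whose variance is the sum of the
squared fibre sums of the propagator; that sum is bounded uniformly because the propagator decays
fast enough (`sum_fiberC_sq_le`). All other terms are controlled by `quadSum`. On the disc `|z|² < k
Re z`, which `z ↦ z² / 2` maps to the cardioid, the product is at most `exp (k |linSum| + 3 k²
quadSum)` (`norm_integrand_le`), and a small multiple of `linSum² + quadSum` has a uniform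
exponential moment (`lintegral_exp_rate_le`). The cutoff partition functions are therefore uniformly
bounded and analytic on the disc; they converge where `Re z² > 0` by dominated convergence in the
field representation, hence everywhere on the disc by Vitali's argument.

For the remainders, the integrand is compared with its Taylor polynomial in `z` for each
configuration of `τ`. The coefficient of `zⁿ` is `O((2 size)ⁿ)`, and `size²` has an exponential
moment, so order `2r` in `z` costs only `r!`. The coefficients are identified with the moments of
the interaction by uniqueness of asymptotic expansions. Expansions with remainders `A Bʳ r! |lam|ʳ`
are stable under products with the same `B` (`HasGevreyExpansion.mul`), so the logarithm series
converges once `Z - 1` is small.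

Borel summability is obtained from an explicit Borel transform. That of `exp (-lam S)` is `J₀(2 √(t
S))`, which on a parabola around the half line grows at most like `exp (2 √(δ S))`; this is
integrable since the moments of `S` grow like `(2k)!`. So the Borel transform of `Z` is bounded and
analytic on the parabola. Its derivative `b` satisfies `Z = 1 + L b`, with `L` the Laplace transform
at `1 / lam`, and `log (1 + L b)` is the Laplace transform of the convolution logarithm of `b`, an
everywhere convergent series with exponential growth. Watson's lemma identifies its Taylor
coefficients with the perturbative ones. -/

/-- An integral of analytic functions that are dominated by an integrable function is analytic. -/
theorem differentiableOn_integral_of_dominated {α : Type*} [MeasurableSpace α] {μ : Measure α}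
    {U : Set ℂ} (hU : IsOpen U) {f : α → ℂ → ℂ} {g : α → ℝ}
    (hf : ∀ z ∈ U, AEStronglyMeasurable (fun a => f a z) μ)
    (hd : ∀ᵐ a ∂μ, DifferentiableOn ℂ (f a) U) (hg : Integrable g μ)
    (hb : ∀ᵐ a ∂μ, ∀ z ∈ U, ‖f a z‖ ≤ g a) :
    DifferentiableOn ℂ (fun z => ∫ a, f a z ∂μ) U := by
  intro z hz
  obtain ⟨r, hr, hrU⟩ := Metric.isOpen_iff.1 hU z hz
  have hr2 : 0 < r / 2 := by positivity
  have hsub : ∀ w ∈ Metric.ball z (r / 2), Metric.closedBall w (r / 4) ⊆ U := by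
    intro w hw x hx
    refine hrU ?_
    rw [Metric.mem_ball] at hw ⊢
    rw [Metric.mem_closedBall] at hx
    linarith [dist_triangle x w z]
  -- The derivative is measurable as a limit of difference quotients along a real sequence tending
  -- to `0`.
  have hmeas : AEStronglyMeasurable (fun a => deriv (f a) z) μ := by
    obtain ⟨u, hu0, hu1, hu2⟩ := exists_seq_strictAnti_tendsto' (show (0 : ℝ) < r from hr)
    have hmem : ∀ n, z + (u n : ℂ) ∈ U := fun n => hrU (by
      have := hu1 n
      simp [abs_of_pos this.1, this.2])
    refine aestronglyMeasurable_of_tendsto_ae atTop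
      (f := fun n a => (u n : ℂ)⁻¹ • (f a (z + u n) - f a z))
      (fun n => ((hf _ (hmem n)).fun_sub (hf z hz)).fun_const_smul _) ?_
    filter_upwards [hd] with a ha
    have h1 := (ha.differentiableAt (hU.mem_nhds hz)).hasDerivAt.tendsto_slope_zero
    refine h1.comp ?_
    refine tendsto_nhdsWithin_iff.2 ⟨?_, Eventually.of_forall fun n => ?_⟩
    · simpa [Function.comp_def] using (Complex.continuous_ofReal.tendsto 0).comp hu2
    · simpa using (hu1 n).1.ne'
  -- Cauchy's estimate on circles of radius `r / 4` centred in the half-size ball turns the bound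
  -- `g` into the bound `g / (r / 4)` of the derivatives.
  have key := hasDerivAt_integral_of_dominated_loc_of_deriv_le (μ := μ) (F := fun w a => f a w)
    (F' := fun w a => deriv (f a) w) (x₀ := z) (bound := fun a => g a / (r / 4))
    (Metric.ball_mem_nhds z hr2)
    (by filter_upwards [hU.mem_nhds hz] with w hw using hf w hw)
    (hg.mono' (hf z hz) (by filter_upwards [hb] with a ha using ha z hz)) hmeas
    (by
      filter_upwards [hb, hd] with a ha hda w hw
      refine Complex.norm_deriv_le_of_forall_mem_sphere_norm_le (by positivity) ?_ ?_
      · refine DifferentiableOn.diffContOnCl ?_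
        rw [closure_ball _ (by positivity)]
        exact hda.mono (hsub w hw)
      · intro x hx
        exact ha x (hsub w hw (Metric.sphere_subset_closedBall hx)))
    (hg.div_const _)
    (by
      filter_upwards [hd] with a ha w hw
      exact (ha.differentiableAt (hU.mem_nhds
        (hsub w hw (Metric.mem_closedBall_self (by positivity))))).hasDerivAt)
  exact key.2.differentiableAt.differentiableWithinAt

/-- Cauchy's formula for the Taylor coefficients at a point. -/
theorem iteratedDeriv_eq_smul_circleIntegral {f : ℂ → ℂ} {c : ℂ} {R : ℝ} (hR : 0 < R)
    (hf : DiffContOnCl ℂ f (Metric.ball c R)) (n : ℕ) :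
    iteratedDeriv n f c = n.factorial • (2 * Real.pi * Complex.I : ℂ)⁻¹ •
      ∮ z in C(c, R), (z - c)⁻¹ ^ (n + 1) • f z := by
  have h := DiffContOnCl.circleIntegral_one_div_sub_center_pow_smul hR n hf
  simp only [one_div, ← inv_pow] at h
  have h2 : (n.factorial : ℂ) ≠ 0 := by exact_mod_cast n.factorial_ne_zero
  have h3 := Complex.two_pi_I_ne_zero
  rw [h, nsmul_eq_mul, smul_eq_mul, smul_eq_mul]
  field_simp

/-- A uniformly bounded sequence of analytic functions on a disc that converges on a concentric
disc converges on the whole disc, to an analytic function. -/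
theorem exists_tendsto_of_bounded_of_tendsto_ball {f : ℕ → ℂ → ℂ} {z₀ : ℂ} {R r M : ℝ}
    (hr : 0 < r) (hrR : r ≤ R) (hf : ∀ n, DifferentiableOn ℂ (f n) (Metric.ball z₀ R))
    (hM : ∀ n, ∀ z ∈ Metric.ball z₀ R, ‖f n z‖ ≤ M) (l : ℂ → ℂ)
    (hl : ∀ z ∈ Metric.ball z₀ r, Tendsto (fun n => f n z) atTop (𝓝 (l z))) :
    ∃ g : ℂ → ℂ, DifferentiableOn ℂ g (Metric.ball z₀ R) ∧
      ∀ z ∈ Metric.ball z₀ R, Tendsto (fun n => f n z) atTop (𝓝 (g z)) := by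
  have hdc : ∀ n, ∀ ρ < R, 0 < ρ → DiffContOnCl ℂ (f n) (Metric.ball z₀ ρ) := by
    intro n ρ hρ hρ0
    refine DifferentiableOn.diffContOnCl ?_
    rw [closure_ball _ hρ0.ne']
    exact (hf n).mono (Metric.closedBall_subset_ball hρ)
  -- Each Taylor coefficient at the centre is a Cauchy integral over a circle inside the small disc,
  -- where pointwise convergence and the bound `M` allow dominated convergence.
  have hconv : ∀ k, ∃ A : ℂ, Tendsto (fun n => iteratedDeriv k (f n) z₀) atTop (𝓝 A) := by
    intro k
    have h2 : 0 < r / 2 := by positivity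
    have hcm : ∀ θ, circleMap z₀ (r / 2) θ ∈ Metric.ball z₀ r := fun θ => by
      simp [circleMap, abs_of_pos hr]; linarith
    refine ⟨k.factorial • (2 * Real.pi * Complex.I : ℂ)⁻¹ •
      ∮ z in C(z₀, r / 2), (z - z₀)⁻¹ ^ (k + 1) • l z, ?_⟩
    simp_rw [fun n => iteratedDeriv_eq_smul_circleIntegral h2
      (hdc n (r / 2) (by linarith) h2) k]
    refine Tendsto.const_smul (Tendsto.const_smul ?_ _) _
    simp only [circleIntegral]
    refine intervalIntegral.tendsto_integral_filter_of_dominated_convergence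
      (fun _ => (r / 2) * ((r / 2)⁻¹ ^ (k + 1) * M)) ?_ ?_ ?_ ?_
    · refine Eventually.of_forall fun n => Continuous.aestronglyMeasurable ?_
      have hc : Continuous fun θ => f n (circleMap z₀ (r / 2) θ) :=
        (hf n).continuousOn.comp_continuous (continuous_circleMap _ _)
          fun θ => Metric.ball_subset_ball hrR (hcm θ)
      have hi : Continuous fun θ => (circleMap z₀ (r / 2) θ - z₀)⁻¹ :=
        ((continuous_circleMap _ _).sub continuous_const).inv₀
          (fun θ => sub_ne_zero.2 (circleMap_ne_center h2.ne'))
      simp only [deriv_circleMap]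
      exact ((continuous_circleMap _ _).mul continuous_const).smul ((hi.pow _).smul hc)
    · refine Eventually.of_forall fun n => ae_of_all _ fun θ _ => ?_
      simp only [deriv_circleMap, norm_smul, norm_mul, norm_pow, norm_inv, circleMap_sub_center,
        norm_circleMap_zero, Complex.norm_I, mul_one, abs_of_pos h2]
      have := hM n _ (Metric.ball_subset_ball hrR (hcm θ))
      gcongr
    · exact intervalIntegrable_const
    · refine ae_of_all _ fun θ _ => ?_
      exact ((hl _ (hcm θ)).const_smul _).const_smul _
  choose A hA using hconv
  have hbd : ∀ ρ, 0 < ρ → ρ < R → ∀ n k,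
      ‖iteratedDeriv k (f n) z₀‖ ≤ k.factorial * M / ρ ^ k := by
    intro ρ h0 h1 n k
    exact Complex.norm_iteratedDeriv_le_of_forall_mem_sphere_norm_le k h0 (hdc n ρ h1 h0)
      fun z hz => hM n z (Metric.closedBall_subset_ball h1 (Metric.sphere_subset_closedBall hz))
  -- The limits inherit Cauchy's estimates on every circle of radius less than `R`, so the limiting
  -- Taylor series converges on the whole disc and the passage to the limit is dominated there.
  have hAb : ∀ ρ, 0 < ρ → ρ < R → ∀ k, ‖A k‖ ≤ k.factorial * M / ρ ^ k := fun ρ h0 h1 k =>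
    le_of_tendsto (hA k).norm (Eventually.of_forall fun n => hbd ρ h0 h1 n k)
  have hM0 : 0 ≤ M := (norm_nonneg _).trans
    (hM 0 z₀ (Metric.mem_ball_self (hr.trans_le hrR)))
  have hterm : ∀ (ρ : ℝ), 0 < ρ → ∀ (a z : ℂ) (k : ℕ) (q : ℝ), ‖a‖ ≤ k.factorial * M / ρ ^ k →
      ‖z - z₀‖ ≤ q → ‖((k.factorial : ℂ)⁻¹ • (z - z₀) ^ k • a)‖ ≤ M * (q / ρ) ^ k := by
    intro ρ hρ a z k q ha hz
    have hk : (0 : ℝ) < k.factorial := by positivity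
    have hq := (norm_nonneg _).trans hz
    rw [norm_smul, norm_smul, norm_inv, norm_pow, Complex.norm_natCast]
    calc (k.factorial : ℝ)⁻¹ * (‖z - z₀‖ ^ k * ‖a‖)
        ≤ (k.factorial : ℝ)⁻¹ * (q ^ k * (k.factorial * M / ρ ^ k)) := by gcongr
      _ = M * (q / ρ) ^ k := by rw [div_pow]; field_simp
  have hmid : ∀ z ∈ Metric.ball z₀ R, ∃ q ρ, ‖z - z₀‖ < q ∧ q < ρ ∧ ρ < R ∧ 0 < q := by
    intro z hz
    rw [mem_ball_iff_norm] at hz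
    obtain ⟨ρ, h1, h2⟩ := exists_between hz
    obtain ⟨q, h3, h4⟩ := exists_between h1
    exact ⟨q, ρ, h3, h4, h2, (norm_nonneg _).trans_lt h3⟩
  refine ⟨fun z => ∑' k, ((k.factorial : ℂ)⁻¹ • (z - z₀) ^ k • A k), ?_, ?_⟩
  · intro z hz
    obtain ⟨q, ρ, h1, h2, h3, h4⟩ := hmid z hz
    have hq : q / ρ < 1 := (div_lt_one (h4.trans h2)).2 h2
    have := Complex.differentiableOn_tsum_of_summable_norm
      (u := fun k => M * (q / ρ) ^ k) (U := Metric.ball z₀ q)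
      (F := fun k z => ((k.factorial : ℂ)⁻¹ • (z - z₀) ^ k • A k))
      ((summable_geometric_of_lt_one (by have := h4.trans h2; positivity) hq).mul_left M)
      (fun k => by fun_prop) Metric.isOpen_ball
      (fun k w hw => hterm ρ (h4.trans h2) _ _ _ _ (hAb ρ (h4.trans h2) h3 k)
        (mem_ball_iff_norm.1 hw).le)
    exact (this.differentiableAt
      (Metric.isOpen_ball.mem_nhds (mem_ball_iff_norm.2 h1))).differentiableWithinAt
  · intro z hz
    obtain ⟨q, ρ, h1, h2, h3, h4⟩ := hmid z hz
    have hq : q / ρ < 1 := (div_lt_one (h4.trans h2)).2 h2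
    simp_rw [fun n => ((Complex.hasSum_taylorSeries_on_ball (hf n) hz).tsum_eq).symm]
    refine tendsto_tsum_of_dominated_convergence (bound := fun k => M * (q / ρ) ^ k)
      ((summable_geometric_of_lt_one (by have := h4.trans h2; positivity) hq).mul_left M)
      (fun k => ((hA k).const_smul _).const_smul _)
      (Eventually.of_forall fun n k =>
        hterm ρ (h4.trans h2) _ _ _ _ (hbd ρ (h4.trans h2) h3 n k) h1.le)

/-- A polynomial of degree less than `r` that is `O(sʳ)` at `0+` vanishes. -/
theorem polynomial_eq_zero_of_norm_eval_le {P : Polynomial ℂ} {r : ℕ} {C ε : ℝ} (hε : 0 < ε)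
    (hdeg : P.natDegree < r)
    (hP : ∀ s : ℝ, 0 < s → s < ε → ‖P.eval (s : ℂ)‖ ≤ C * s ^ r) : P = 0 := by
  by_contra h0
  -- The zero at `0` is divided out: `P = Xᵏ Q` with `Q(0) ≠ 0` and `k ≤ deg P < r`. The hypothesis
  -- then bounds `Q` by `C s ^ (r - k)`, which forces `Q(0) = 0`.
  obtain ⟨Q, hQ, hnd⟩ := Polynomial.exists_eq_pow_rootMultiplicity_mul_and_not_dvd P h0 0
  set k := P.rootMultiplicity 0 with hk
  rw [map_zero, sub_zero] at hQ hnd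
  have hQ0 : Q.eval 0 ≠ 0 := fun h => hnd (by
    simpa using (Polynomial.dvd_iff_isRoot.2 (show Q.IsRoot 0 from h)))
  have hkr : k < r := by
    refine lt_of_le_of_lt ?_ hdeg
    calc k ≤ P.roots.card := by rw [hk, ← Polynomial.count_roots]; exact Multiset.count_le_card _ _
      _ ≤ P.natDegree := Polynomial.card_roots' P
  have hb : ∀ s : ℝ, 0 < s → s < ε → ‖Q.eval (s : ℂ)‖ ≤ C * s ^ (r - k) := by
    intro s h1 h2
    have := hP s h1 h2
    rw [hQ, Polynomial.eval_mul, Polynomial.eval_pow, Polynomial.eval_X, norm_mul, norm_pow,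
      Complex.norm_real, Real.norm_eq_abs, abs_of_pos h1,
      ← Nat.add_sub_cancel' hkr.le, pow_add, mul_left_comm] at this
    simpa using le_of_mul_le_mul_left this (by positivity)
  have ht1 : Tendsto (fun s : ℝ => ‖Q.eval (s : ℂ)‖) (𝓝[>] 0) (𝓝 ‖Q.eval 0‖) := by
    have : Continuous fun s : ℝ => ‖Q.eval (s : ℂ)‖ := by fun_prop
    simpa using (this.tendsto 0).mono_left nhdsWithin_le_nhds
  have ht2 : Tendsto (fun s : ℝ => C * s ^ (r - k)) (𝓝[>] 0) (𝓝 0) := by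
    have : Continuous fun s : ℝ => C * s ^ (r - k) := by fun_prop
    have h := (this.tendsto 0).mono_left (nhdsWithin_le_nhds (s := Set.Ioi 0))
    simpa [zero_pow (Nat.sub_pos_of_lt hkr).ne'] using h
  have := le_of_tendsto_of_tendsto ht1 ht2 (by
    filter_upwards [Ioo_mem_nhdsGT hε] with s hs using hb s hs.1 hs.2)
  exact hQ0 (norm_le_zero_iff.1 this)

/-- Two sequences that are asymptotic expansions at `0+` of the same function agree. It is enough
to have the remainder bounds for the orders `φ r`. -/
theorem eq_of_asymptotic_expansions {a b : ℕ → ℂ} {f : ℝ → ℂ} {ε : ℝ} (hε : 0 < ε)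
    {φ : ℕ → ℕ} (hφ : ∀ n, n < φ n)
    (ha : ∀ r, ∃ C : ℝ, ∀ s : ℝ, 0 < s → s < ε →
      ‖f s - ∑ k ∈ Finset.range (φ r), a k * (s : ℂ) ^ k‖ ≤ C * s ^ φ r)
    (hb : ∀ r, ∃ C : ℝ, ∀ s : ℝ, 0 < s → s < ε →
      ‖f s - ∑ k ∈ Finset.range (φ r), b k * (s : ℂ) ^ k‖ ≤ C * s ^ φ r) : a = b := by
  funext n
  obtain ⟨C₁, h1⟩ := ha n
  obtain ⟨C₂, h2⟩ := hb n
  have hcoeff : ∀ c : ℕ → ℂ, (∑ k ∈ Finset.range (φ n),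
      Polynomial.C (c k) * Polynomial.X ^ k : Polynomial ℂ).coeff n = c n := by
    intro c
    simp [Polynomial.coeff_C_mul, Polynomial.coeff_X_pow, hφ n]
  have hP := polynomial_eq_zero_of_norm_eval_le
    (P := ∑ k ∈ Finset.range (φ n), Polynomial.C (a k - b k) * Polynomial.X ^ k)
    (r := φ n) (C := C₁ + C₂) hε ?_ ?_
  · have := hcoeff (fun k => a k - b k)
    rw [hP, Polynomial.coeff_zero] at this
    exact (sub_eq_zero.1 this.symm)
  · refine lt_of_le_of_lt (b := φ n - 1) (Polynomial.natDegree_sum_le_of_forall_le _ _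
      fun k hk => ?_) (by have := hφ n; omega)
    refine (Polynomial.natDegree_C_mul_X_pow_le _ _).trans ?_
    have := Finset.mem_range.1 hk
    omega
  · intro s hs0 hs1
    have e : (∑ k ∈ Finset.range (φ n), Polynomial.C (a k - b k) * Polynomial.X ^ k :
        Polynomial ℂ).eval (s : ℂ) =
        (f s - ∑ k ∈ Finset.range (φ n), b k * (s : ℂ) ^ k) -
        (f s - ∑ k ∈ Finset.range (φ n), a k * (s : ℂ) ^ k) := by
      simp only [Polynomial.eval_finsetSum, Polynomial.eval_mul, Polynomial.eval_C,
        Polynomial.eval_pow, Polynomial.eval_X, sub_mul, Finset.sum_sub_distrib]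
      ring
    rw [e]
    refine (norm_sub_le _ _).trans ?_
    rw [add_mul, add_comm]
    exact add_le_add (h1 s hs0 hs1) (h2 s hs0 hs1)

/-! ### Gaussian integrals -/

/-- The integral of a product of functions of finitely many coordinates. -/
theorem integral_infinitePi_prod {𝕜 ι : Type*} [RCLike 𝕜] {X : ι → Type*}
    [∀ i, MeasurableSpace (X i)] (P : ∀ i, Measure (X i)) [∀ i, IsProbabilityMeasure (P i)]
    (s : Finset ι) {f : ∀ i, X i → 𝕜} (hf : ∀ i, Measurable (f i)) :
    ∫ x, ∏ i ∈ s, f i (x i) ∂(Measure.infinitePi P) = ∏ i ∈ s, ∫ y, f i y ∂(P i) := by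
  have h1 : ∀ x : ∀ i, X i, ∏ i ∈ s, f i (x i) = ∏ i : s, f i (s.restrict x i) := fun x => by
    rw [← Finset.prod_coe_sort]; rfl
  simp_rw [h1]
  rw [integral_restrict_infinitePi (μ := P) (f := fun y : ∀ i : s, X i => ∏ i : s, f i (y i)),
    integral_fintype_prod_eq_prod (fun (i : s) (y : X i) => f i y),
    Finset.prod_coe_sort s (fun i => ∫ y, f i y ∂(P i))]
  exact (Finset.measurable_prod _ fun (i : s) _ =>
    (hf i).comp (measurable_pi_apply i)).aestronglyMeasurable

/-- The integral of a non-integrable function is `0` by convention, so any explicit nonzero value of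
an integral also proves integrability. Gaussian and Laplace integrals below are handled in this way.
-/
theorem integrable_of_integral_ne_zero {α E : Type*} [MeasurableSpace α] [NormedAddCommGroup E]
    [NormedSpace ℝ E] {μ : Measure α} {f : α → E} (h : ∫ a, f a ∂μ ≠ 0) : Integrable f μ := by
  by_contra hn
  exact h (integral_undef hn)

/-- The square of the Gaussian integral of `exp (w x²)`. -/
theorem sq_integral_cexp_mul_sq_gaussianReal {v : ℝ} (hv : 0 < v) {w : ℂ} (hw : 2 * v * w.re < 1) :
    (∫ x : ℝ, Complex.exp (w * (x : ℂ) ^ 2) ∂(gaussianReal 0 v.toNNReal)) ^ 2 =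
      (1 - 2 * v * w)⁻¹ := by
  have hv' : v.toNNReal ≠ 0 := by simpa using hv
  rw [integral_gaussianReal_eq_integral_smul hv']
  have h1 : ∀ x : ℝ, gaussianPDFReal 0 v.toNNReal x • Complex.exp (w * (x : ℂ) ^ 2) =
      ((√(2 * Real.pi * v))⁻¹ : ℝ) * Complex.exp (-((2 * v : ℂ)⁻¹ - w) * (x : ℂ) ^ 2) := by
    intro x
    rw [gaussianPDFReal_def]
    simp only [Real.coe_toNNReal v hv.le, sub_zero, Complex.real_smul, Complex.ofReal_mul,
      Complex.ofReal_exp, mul_assoc]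
    rw [← Complex.exp_add]
    congr 2
    push_cast
    ring
  have hre : 0 < ((2 * v : ℂ)⁻¹ - w).re := by
    have : ((2 * v : ℂ)⁻¹ - w).re = (2 * v)⁻¹ - w.re := by
      rw [Complex.sub_re, ← Complex.ofReal_ofNat, ← Complex.ofReal_mul, ← Complex.ofReal_inv,
        Complex.ofReal_re]
    rw [this, sub_pos, ← one_div, lt_div_iff₀ (by positivity)]
    linarith
  simp_rw [h1]
  -- Squaring removes the complex square root in the Gaussian integral, so no branch has to be
  -- followed.
  rw [integral_const_mul, integral_gaussian_complex hre, mul_pow, ← Complex.ofReal_pow, inv_pow,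
    Real.sq_sqrt (by positivity), ← Complex.cpow_nat_mul]
  have hne : (1 : ℂ) - 2 * v * w ≠ 0 := by
    intro h
    have := congrArg Complex.re h
    simp [Complex.mul_re] at this
    linarith
  have hv0 : (v : ℂ) ≠ 0 := by exact_mod_cast hv.ne'
  have hpi : (Real.pi : ℂ) ≠ 0 := by exact_mod_cast Real.pi_ne_zero
  have hne2 : (2 * v : ℂ)⁻¹ - w ≠ 0 := fun h => by rw [h] at hre; simp at hre
  have e : (2 * v : ℂ)⁻¹ - w = (1 - 2 * v * w) / (2 * v) := by field_simp
  rw [e]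
  push_cast
  norm_num
  field_simp

/-- The Gaussian integral of `exp (a x²)` for real `a`. -/
theorem sq_integral_exp_mul_sq_gaussianReal {v : ℝ} (hv : 0 < v) {a : ℝ} (ha : 2 * v * a < 1) :
    (∫ x : ℝ, Real.exp (a * x ^ 2) ∂(gaussianReal 0 v.toNNReal)) ^ 2 = (1 - 2 * v * a)⁻¹ := by
  have := sq_integral_cexp_mul_sq_gaussianReal hv (w := a) (by simpa using ha)
  have e : ∀ x : ℝ, Complex.exp ((a : ℂ) * (x : ℂ) ^ 2) = ((Real.exp (a * x ^ 2) : ℝ) : ℂ) :=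
    fun x => by push_cast; rfl
  simp_rw [e] at this
  rw [integral_complex_ofReal] at this
  exact_mod_cast this

theorem one_sub_two_mul_inv_le_exp {a : ℝ} (h0 : 0 ≤ a) (h1 : a ≤ 1 / 4) :
    (1 - 2 * a)⁻¹ ≤ Real.exp (4 * a) := by
  refine le_trans ?_ (Real.add_one_le_exp _)
  rw [inv_le_iff_one_le_mul₀ (by linarith)]
  nlinarith

/-- Bound of the standard Gaussian integral of `exp (a x²)`. -/
theorem integral_exp_mul_sq_gaussianReal_le {a : ℝ} (h0 : 0 ≤ a) (h1 : a ≤ 1 / 4) :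
    ∫ x : ℝ, Real.exp (a * x ^ 2) ∂(gaussianReal 0 1) ≤ Real.exp (2 * a) := by
  have := sq_integral_exp_mul_sq_gaussianReal one_pos (a := a) (by linarith)
  rw [Real.toNNReal_one, mul_one] at this
  refine (sq_le_sq₀ (integral_nonneg fun x => by positivity) (by positivity)).1 ?_
  rw [this, ← Real.exp_nat_mul]
  refine (one_sub_two_mul_inv_le_exp h0 h1).trans_eq ?_
  congr 1
  push_cast; ring

theorem integral_exp_mul_sq_gaussianReal_pos {a : ℝ} (h1 : a ≤ 1 / 4) :
    0 < ∫ x : ℝ, Real.exp (a * x ^ 2) ∂(gaussianReal 0 1) := by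
  have := sq_integral_exp_mul_sq_gaussianReal one_pos (a := a) (by linarith)
  rw [Real.toNNReal_one, mul_one] at this
  refine lt_of_le_of_ne (integral_nonneg fun x => by positivity) fun h => ?_
  rw [← h] at this
  have h3 : (0 : ℝ) < (1 - 2 * a)⁻¹ := inv_pos.2 (by linarith)
  rw [← this] at h3
  simp at h3

theorem integral_cexp_gaussianReal (t : ℝ) :
    ∫ x : ℝ, Complex.exp (Complex.I * t * x) ∂(gaussianReal 0 1) =
      Complex.exp (-(t : ℂ) ^ 2 / 2) := by
  have := charFun_gaussianReal (μ := 0) (v := 1) t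
  rw [charFun_apply_real] at this
  have e : ∀ x : ℝ, Complex.I * t * x = t * x * Complex.I := fun x => by ring
  simp_rw [e, this]
  simp [neg_div]

theorem integral_exp_mul_gaussianReal (t : ℝ) :
    ∫ x : ℝ, Real.exp (t * x) ∂(gaussianReal 0 1) = Real.exp (t ^ 2 / 2) := by
  have := mgf_gaussianReal (p := gaussianReal 0 1) (X := id) (μ := 0) (v := 1) (by simp) t
  simpa [mgf] using this

namespace TGFT

/-! ### Circular complex Gaussian variables -/

/-- The Laplace transform of the squared modulus of a circular complex Gaussian variable. -/
theorem integral_cexp_mul_normSq_complexGaussian {c : ℝ} (hc : 0 < c) {w : ℂ}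
    (hw : c * w.re < 1) :
    ∫ z, Complex.exp (w * ((‖z‖ ^ 2 : ℝ) : ℂ)) ∂(complexGaussian c) = (1 - c * w)⁻¹ := by
  rw [complexGaussian, integral_map (by fun_prop) (by
    exact Measurable.aestronglyMeasurable (by fun_prop))]
  have e : ∀ q : ℝ × ℝ, Complex.exp (w * ((‖(q.1 : ℂ) + (q.2 : ℂ) * Complex.I‖ ^ 2 : ℝ) : ℂ)) =
      Complex.exp (w * (q.1 : ℂ) ^ 2) * Complex.exp (w * (q.2 : ℂ) ^ 2) := by
    intro q
    rw [← Complex.exp_add, Complex.sq_norm, Complex.normSq_add_mul_I]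
    congr 1
    push_cast
    ring
  simp_rw [e]
  rw [integral_prod_mul (fun x : ℝ => Complex.exp (w * (x : ℂ) ^ 2))
    (fun x : ℝ => Complex.exp (w * (x : ℂ) ^ 2)), ← sq,
    sq_integral_cexp_mul_sq_gaussianReal (by positivity) (by linarith)]
  push_cast
  ring_nf

/-- Moments of the squared modulus of a circular complex Gaussian variable. -/
theorem lintegral_normSq_pow_complexGaussian_le {c : ℝ} (hc : 0 < c) (n : ℕ) :
    ∫⁻ z, ENNReal.ofReal (‖z‖ ^ 2) ^ n ∂(complexGaussian c) ≤
      ENNReal.ofReal (2 * (2 * c) ^ n * n.factorial) := by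
  -- At `w = 1 / (2c)` the Laplace transform equals `2`; with `xⁿ ≤ n! eˣ` this single value bounds
  -- all moments.
  have h1 := integral_cexp_mul_normSq_complexGaussian hc (w := ((2 * c)⁻¹ : ℝ))
    (by rw [Complex.ofReal_re]; field_simp; norm_num)
  have e : ∀ z : ℂ, Complex.exp (((2 * c)⁻¹ : ℝ) * ((‖z‖ ^ 2 : ℝ) : ℂ)) =
      ((Real.exp ((2 * c)⁻¹ * ‖z‖ ^ 2) : ℝ) : ℂ) := fun z => by push_cast; rfl
  simp_rw [e] at h1
  have hc' : (c : ℂ) ≠ 0 := by exact_mod_cast hc.ne'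
  have e2 : (1 - (c : ℂ) * ((2 * c)⁻¹ : ℝ))⁻¹ = (2 : ℝ) := by
    push_cast
    field_simp
    norm_num
  rw [integral_complex_ofReal, e2] at h1
  have h2 : ∫ z, Real.exp ((2 * c)⁻¹ * ‖z‖ ^ 2) ∂(complexGaussian c) = 2 := by exact_mod_cast h1
  have hi := integrable_of_integral_ne_zero (μ := complexGaussian c)
    (f := fun z : ℂ => Real.exp ((2 * c)⁻¹ * ‖z‖ ^ 2)) (by rw [h2]; norm_num)
  have hA : (0 : ℝ) ≤ (2 * c) ^ n * n.factorial := by positivity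
  calc ∫⁻ z, ENNReal.ofReal (‖z‖ ^ 2) ^ n ∂(complexGaussian c)
      ≤ ∫⁻ z, ENNReal.ofReal ((2 * c) ^ n * n.factorial) *
          ENNReal.ofReal (Real.exp ((2 * c)⁻¹ * ‖z‖ ^ 2)) ∂(complexGaussian c) := by
        refine lintegral_mono fun z => ?_
        rw [← ENNReal.ofReal_pow (by positivity), ← ENNReal.ofReal_mul hA]
        refine ENNReal.ofReal_le_ofReal ?_
        have := Real.pow_div_factorial_le_exp ((2 * c)⁻¹ * ‖z‖ ^ 2) (by positivity) n
        rw [div_le_iff₀ (by positivity), mul_pow, inv_pow, inv_mul_le_iff₀ (by positivity)] at this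
        linarith
    _ = ENNReal.ofReal (2 * (2 * c) ^ n * n.factorial) := by
        rw [lintegral_const_mul _ (by fun_prop), ← ofReal_integral_eq_lintegral_ofReal hi
          (ae_of_all _ fun z => by positivity), h2, ← ENNReal.ofReal_mul hA]
        congr 1
        ring

/-! ### Bounds of the propagator -/

/-- The one-dimensional weight that controls the propagator. -/
def weight (m : ℝ) (a : ℤ) : ℝ := ((a : ℝ) ^ 2 + m ^ 2) ^ (-(1 / 3) : ℝ)

theorem weight_pos {m : ℝ} (hm : 0 < m) (a : ℤ) : 0 < weight m a :=
  Real.rpow_pos_of_pos (by positivity) _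

/-- The squared weight decays like `|a| ^ (-4/3)`, just as much as summability over `ℤ` requires of
the exponent `1/3`. -/
theorem summable_weight_sq {m : ℝ} (hm : 0 < m) : Summable fun a : ℤ => weight m a ^ 2 := by
  refine Summable.of_norm_bounded_eventually
    (Real.summable_abs_int_rpow (b := 4 / 3) (by norm_num)) ?_
  have : {a : ℤ | a ≠ 0} ∈ cofinite := (Set.finite_singleton (0 : ℤ)).compl_mem_cofinite
  filter_upwards [this] with a ha
  have ha' : 0 < |(a : ℝ)| := by simpa using ha
  rw [Real.norm_of_nonneg (by positivity), weight, ← Real.rpow_mul_natCast (by positivity)]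
  calc ((a : ℝ) ^ 2 + m ^ 2) ^ (-(1 / 3) * (2 : ℕ) : ℝ) ≤ (|(a : ℝ)| ^ 2) ^ (-(1 / 3) * (2 : ℕ) : ℝ) :=
        Real.rpow_le_rpow_of_nonpos (by positivity) (by rw [sq_abs]; nlinarith) (by norm_num)
    _ = |(a : ℝ)| ^ (-(4 / 3) : ℝ) := by
        rw [← Real.rpow_natCast, ← Real.rpow_mul ha'.le]
        norm_num

theorem C₀_pos {m : ℝ} (hm : 0 < m) (p : Fin 3 → ℤ) : 0 < C₀ m p :=
  inv_pos.2 (by have := Finset.sum_nonneg fun i (_ : i ∈ Finset.univ) => sq_nonneg (p i : ℝ)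
                positivity)

/-- With `S = p² + m²`, the propagator is `S ^ (-1/3) · S ^ (-2/3)`, and each factor is estimated
through one component. The uneven split serves two sums at once: the free component `p j` carries a
squared weight, which is summable, and the fixed component `p i` carries a weight whose square is
summable. -/
theorem C₀_le_weight {m : ℝ} (hm : 0 < m) (p : Fin 3 → ℤ) {i j : Fin 3} (hij : i ≠ j) :
    C₀ m p ≤ weight m (p i) * weight m (p j) ^ 2 := by
  have hs : (p i : ℝ) ^ 2 + (p j : ℝ) ^ 2 ≤ ∑ l, (p l : ℝ) ^ 2 := by
    rw [← Finset.sum_pair (f := fun l => (p l : ℝ) ^ 2) hij]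
    exact Finset.sum_le_sum_of_subset_of_nonneg (Finset.subset_univ _) fun l _ _ => sq_nonneg _
  set A := (p i : ℝ) ^ 2 + m ^ 2 with hA
  set B := (p j : ℝ) ^ 2 + m ^ 2 with hB
  set S := ∑ l, (p l : ℝ) ^ 2 + m ^ 2 with hS
  have hA0 : 0 < A := by positivity
  have hB0 : 0 < B := by positivity
  have hAS : A ≤ S := by have := sq_nonneg (p j : ℝ); linarith
  have hBS : B ≤ S := by have := sq_nonneg (p i : ℝ); linarith
  have hS0 : 0 < S := hA0.trans_le hAS
  have e : C₀ m p = S ^ (-(1 / 3) : ℝ) * (S ^ (-(1 / 3) : ℝ)) ^ 2 := by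
    rw [C₀, ← Real.rpow_mul_natCast hS0.le, ← Real.rpow_add hS0, ← Real.rpow_neg_one]
    norm_num [hS]
  rw [e, weight, weight]
  have h1 := Real.rpow_le_rpow_of_nonpos hA0 hAS (show (-(1 / 3) : ℝ) ≤ 0 by norm_num)
  have h2 := Real.rpow_le_rpow_of_nonpos hB0 hBS (show (-(1 / 3) : ℝ) ≤ 0 by norm_num)
  have h3 := Real.rpow_pos_of_pos hS0 (-(1 / 3))
  gcongr

/-! ### Sums of the propagator over modes with one fixed component -/

/-- The pairs of a colour and a momentum component. -/
abbrev Key : Type := Fin 3 × ℤ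

/-- The sum of the propagator over the modes of `s` with a given component. -/
def fiberC (m : ℝ) (s : Finset Mode) (k : Key) : ℝ :=
  ∑ p ∈ s with p.1 k.1 = k.2, C₀ m p.1

/-- The sum of the squared one-dimensional weights. -/
def weightSum (m : ℝ) : ℝ := ∑' a : ℤ, weight m a ^ 2

theorem fiberC_nonneg {m : ℝ} (hm : 0 < m) (s : Finset Mode) (k : Key) : 0 ≤ fiberC m s k :=
  Finset.sum_nonneg fun _ _ => (C₀_pos hm _).le

theorem weightSum_pos {m : ℝ} (hm : 0 < m) : 0 < weightSum m :=
  (summable_weight_sq hm).tsum_pos (fun _ => sq_nonneg _) 0 (pow_pos (weight_pos hm 0) 2)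

/-- By the closure constraint the modes with a given component `i` are parametrised injectively by
the next component, taken cyclically, so the fibre is a one-dimensional sum of squared weights. -/
theorem fiberC_le {m : ℝ} (hm : 0 < m) (s : Finset Mode) (k : Key) :
    fiberC m s k ≤ weight m k.2 * weightSum m := by
  obtain ⟨i, a⟩ := k
  have hij : i ≠ i + 1 := by fin_cases i <;> decide
  have hinj : Set.InjOn (fun p : Mode => p.1 (i + 1)) (s.filter fun p => p.1 i = a) := by
    intro p hp q hq hpq
    simp only [Finset.coe_filter, Set.mem_ofPred_eq] at hp hq
    have hsum := p.2.trans q.2.symm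
    rw [Fin.sum_univ_three, Fin.sum_univ_three] at hsum
    have h1 := hp.2.trans hq.2.symm
    simp only at hpq
    apply Subtype.ext
    funext j
    fin_cases i <;> fin_cases j <;> simp_all
  calc fiberC m s (i, a) ≤ ∑ p ∈ s with p.1 i = a, weight m a * weight m (p.1 (i + 1)) ^ 2 := by
        refine Finset.sum_le_sum fun p hp => ?_
        have := C₀_le_weight hm p.1 hij
        rwa [(Finset.mem_filter.1 hp).2] at this
    _ = weight m a * ∑ b ∈ (s.filter fun p => p.1 i = a).image (fun p : Mode => p.1 (i + 1)),
          weight m b ^ 2 := by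
        rw [← Finset.mul_sum, Finset.sum_image hinj]
    _ ≤ weight m a * weightSum m := by
        have := weight_pos hm a
        gcongr
        exact (summable_weight_sq hm).sum_le_tsum _ fun b _ => sq_nonneg _

/-- A bound of the sum of the squares of `fiberC`. -/
def fiberBound (m : ℝ) : ℝ := 3 * weightSum m ^ 3

theorem fiberBound_pos {m : ℝ} (hm : 0 < m) : 0 < fiberBound m := by
  have := weightSum_pos hm
  unfold fiberBound
  positivity

/-- Each of the three colours contributes `weightSum² · weightSum`, hence the constant `3 *
weightSum m ^ 3`. -/
theorem hasSum_weight_sq_key {m : ℝ} (hm : 0 < m) :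
    HasSum (fun k : Key => (weight m k.2 * weightSum m) ^ 2) (fiberBound m) := by
  have h2 : HasSum (fun a : ℤ => (weight m a * weightSum m) ^ 2) (weightSum m ^ 3) := by
    simp_rw [mul_pow]
    rw [pow_succ' (weightSum m) 2]
    exact (summable_weight_sq hm).hasSum.mul_right (weightSum m ^ 2)
  have hsum : Summable (fun k : Key => (weight m k.2 * weightSum m) ^ 2) := by
    refine (summable_prod_of_nonneg fun k => sq_nonneg _).2 ⟨fun i => h2.summable, ?_⟩
    exact Summable.of_finite
  have := hsum.hasSum
  rwa [hsum.tsum_prod' (fun i => h2.summable), tsum_fintype, Finset.sum_congr rfl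
    (fun i _ => h2.tsum_eq), Finset.sum_const, Finset.card_univ, Fintype.card_fin, nsmul_eq_mul,
    Nat.cast_ofNat] at this

/-- This is the ultraviolet finiteness of the model: for `t = keys s` the left side is the variance
of `linSum`, and the bound does not depend on `s`. All estimates that are uniform in the cutoff come
from here. -/
theorem sum_fiberC_sq_le {m : ℝ} (hm : 0 < m) (s : Finset Mode) (t : Finset Key) :
    ∑ k ∈ t, fiberC m s k ^ 2 ≤ fiberBound m := by
  refine le_trans (Finset.sum_le_sum fun k _ => ?_)
    (sum_le_hasSum t (fun k _ => sq_nonneg _) (hasSum_weight_sq_key hm))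
  exact pow_le_pow_left₀ (fiberC_nonneg hm s k) (fiberC_le hm s k) 2

/-- The keys that occur in the modes of `s`. -/
def keys (s : Finset Mode) : Finset Key :=
  s.biUnion fun p => Finset.univ.image fun i => (i, p.1 i)

/-- Exchange of the sums over modes and over keys. -/
theorem sum_modes_eq_sum_keys {R : Type*} [CommSemiring R] (s : Finset Mode) (f : Mode → R)
    (g : Key → R) :
    ∑ p ∈ s, f p * ∑ i, g (i, p.1 i) =
      ∑ k ∈ keys s, g k * ∑ p ∈ s with p.1 k.1 = k.2, f p := by
  simp_rw [Finset.mul_sum (s := Finset.filter _ _), Finset.sum_filter]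
  rw [Finset.sum_comm]
  refine Finset.sum_congr rfl fun p hp => (?_ : f p * ∑ i, g (i, p.1 i) = _)
  have hinj : Function.Injective fun i => ((i, p.1 i) : Key) := fun i j h => congrArg Prod.fst h
  rw [← Finset.sum_filter, Finset.mul_sum]
  have : (keys s).filter (fun k => p.1 k.1 = k.2) = Finset.univ.image fun i => ((i, p.1 i) : Key) := by
    ext k
    simp only [keys, Finset.mem_filter, Finset.mem_biUnion, Finset.mem_image, Finset.mem_univ,
      true_and]
    constructor
    · rintro ⟨_, h⟩
      exact ⟨k.1, Prod.ext rfl h⟩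
    · rintro ⟨i, rfl⟩
      exact ⟨⟨p, hp, i, rfl⟩, rfl⟩
  rw [this, Finset.sum_image fun _ _ _ _ h => hinj h]
  exact Finset.sum_congr rfl fun i _ => mul_comm _ _

end TGFT

namespace TGFT

/-! ### Exponential moments of the intermediate fields -/

instance : IsProbabilityMeasure auxMeasure := by unfold auxMeasure; infer_instance

instance (m : ℝ) : IsProbabilityMeasure (fieldMeasure m) := by unfold fieldMeasure; infer_instance

/-- The argument `C₀(p) Γ(p)` of the loop vertex. -/
def amp (m : ℝ) (τ : Key → ℝ) (p : Mode) : ℝ := C₀ m p.1 * Γ τ p.1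

/-- The sum of `C₀(p) Γ(p)` over the modes of `s`. -/
def linSum (m : ℝ) (s : Finset Mode) (τ : Key → ℝ) : ℝ := ∑ p ∈ s, amp m τ p

/-- The sum of `(C₀(p) Γ(p))²` over the modes of `s`. -/
def quadSum (m : ℝ) (s : Finset Mode) (τ : Key → ℝ) : ℝ := ∑ p ∈ s, amp m τ p ^ 2

@[fun_prop]
theorem measurable_amp (m : ℝ) (p : Mode) : Measurable fun τ => amp m τ p := by
  unfold amp Γ; fun_prop

@[fun_prop]
theorem measurable_linSum (m : ℝ) (s : Finset Mode) : Measurable (linSum m s) := by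
  unfold linSum; fun_prop

@[fun_prop]
theorem measurable_quadSum (m : ℝ) (s : Finset Mode) : Measurable (quadSum m s) := by
  unfold quadSum; fun_prop

theorem quadSum_nonneg (m : ℝ) (s : Finset Mode) (τ : Key → ℝ) : 0 ≤ quadSum m s τ :=
  Finset.sum_nonneg fun _ _ => sq_nonneg _

theorem linSum_eq (m : ℝ) (s : Finset Mode) (τ : Key → ℝ) :
    linSum m s τ = ∑ k ∈ keys s, fiberC m s k * τ k := by
  simp_rw [linSum, amp, Γ, sum_modes_eq_sum_keys s (fun p => C₀ m p.1) τ, fiberC]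
  exact Finset.sum_congr rfl fun _ _ => mul_comm _ _

/-- The factor `3` is Cauchy–Schwarz over the three colours. After the sums are exchanged, the sum
of squared propagators in a fibre is at most the square of their sum, so the same quantities
`fiberC` control the linear and the quadratic part. -/
theorem quadSum_le {m : ℝ} (hm : 0 < m) (s : Finset Mode) (τ : Key → ℝ) :
    quadSum m s τ ≤ ∑ k ∈ keys s, 3 * fiberC m s k ^ 2 * τ k ^ 2 := by
  calc quadSum m s τ ≤ ∑ p ∈ s, C₀ m p.1 ^ 2 * ∑ i, 3 * τ (i, p.1 i) ^ 2 := by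
        refine Finset.sum_le_sum fun p _ => ?_
        rw [amp, mul_pow, Γ, ← Finset.mul_sum]
        gcongr
        simpa using sq_sum_le_card_mul_sum_sq (s := Finset.univ) (f := fun i => τ (i, p.1 i))
    _ = ∑ k ∈ keys s, 3 * τ k ^ 2 * ∑ p ∈ s with p.1 k.1 = k.2, C₀ m p.1 ^ 2 :=
        sum_modes_eq_sum_keys s (fun p => C₀ m p.1 ^ 2) (fun k => 3 * τ k ^ 2)
    _ ≤ ∑ k ∈ keys s, 3 * fiberC m s k ^ 2 * τ k ^ 2 := by
        refine Finset.sum_le_sum fun k _ => ?_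
        have h : ∑ p ∈ s with p.1 k.1 = k.2, C₀ m p.1 ^ 2 ≤ fiberC m s k ^ 2 :=
          Finset.sum_sq_le_sq_sum_of_nonneg fun p _ => (C₀_pos hm _).le
        nlinarith [sq_nonneg (τ k)]

theorem integrable_exp_sum_mul_sq {t : Finset Key} {w : Key → ℝ} (h1 : ∀ k ∈ t, w k ≤ 1 / 4) :
    Integrable (fun τ : Key → ℝ => Real.exp (∑ k ∈ t, w k * τ k ^ 2)) auxMeasure := by
  refine integrable_of_integral_ne_zero ?_
  simp_rw [Real.exp_sum]
  rw [auxMeasure, integral_infinitePi_prod _ t (f := fun k x => Real.exp (w k * x ^ 2))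
    (fun k => by fun_prop)]
  exact Finset.prod_ne_zero_iff.2 fun k hk => (integral_exp_mul_sq_gaussianReal_pos (h1 k hk)).ne'

theorem integral_exp_sum_mul_sq_le {t : Finset Key} {w : Key → ℝ} (h0 : ∀ k ∈ t, 0 ≤ w k)
    (h1 : ∀ k ∈ t, w k ≤ 1 / 4) :
    ∫ τ : Key → ℝ, Real.exp (∑ k ∈ t, w k * τ k ^ 2) ∂auxMeasure ≤
      Real.exp (2 * ∑ k ∈ t, w k) := by
  simp_rw [Real.exp_sum]
  rw [auxMeasure, integral_infinitePi_prod _ t (f := fun k x => Real.exp (w k * x ^ 2))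
    (fun k => by fun_prop), Finset.mul_sum, Real.exp_sum]
  exact Finset.prod_le_prod (fun k hk => (integral_exp_mul_sq_gaussianReal_pos (h1 k hk)).le)
    fun k hk => integral_exp_mul_sq_gaussianReal_le (h0 k hk) (h1 k hk)

theorem integral_exp_sum_mul (t : Finset Key) (w : Key → ℝ) :
    ∫ τ : Key → ℝ, Real.exp (∑ k ∈ t, w k * τ k) ∂auxMeasure =
      Real.exp (∑ k ∈ t, w k ^ 2 / 2) := by
  simp_rw [Real.exp_sum]
  rw [auxMeasure, integral_infinitePi_prod _ t (f := fun k x => Real.exp (w k * x))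
    (fun k => by fun_prop)]
  simp_rw [integral_exp_mul_gaussianReal]

/-- The square in the exponent is linearised by an auxiliary standard Gaussian `g`: `exp (a X²) = E
exp (√(2a) X g)`. By Tonelli the `τ` are integrated first, which leaves `exp (a σ g²)` with `σ = ∑
w²`, a one-dimensional integral. -/
theorem lintegral_exp_mul_sq_sum_le {t : Finset Key} {w : Key → ℝ} {a : ℝ} (ha : 0 ≤ a)
    (h1 : a * ∑ k ∈ t, w k ^ 2 ≤ 1 / 4) :
    ∫⁻ τ : Key → ℝ, ENNReal.ofReal (Real.exp (a * (∑ k ∈ t, w k * τ k) ^ 2)) ∂auxMeasure ≤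
      ENNReal.ofReal (Real.exp (2 * (a * ∑ k ∈ t, w k ^ 2))) := by
  set σ := ∑ k ∈ t, w k ^ 2 with hσ
  have hσ0 : 0 ≤ σ := Finset.sum_nonneg fun _ _ => sq_nonneg _
  have hsq : √(2 * a) ^ 2 = 2 * a := Real.sq_sqrt (by positivity)
  have e1 : ∀ τ : Key → ℝ, ENNReal.ofReal (Real.exp (a * (∑ k ∈ t, w k * τ k) ^ 2)) =
      ∫⁻ g : ℝ, ENNReal.ofReal (Real.exp (√(2 * a) * (∑ k ∈ t, w k * τ k) * g))
        ∂(gaussianReal 0 1) := by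
    intro τ
    have h := integral_exp_mul_gaussianReal (√(2 * a) * (∑ k ∈ t, w k * τ k))
    rw [← ofReal_integral_eq_lintegral_ofReal
      (integrable_of_integral_ne_zero (by rw [h]; positivity)) (ae_of_all _ fun x => by positivity),
      h, mul_pow, hsq]
    congr 2
    ring
  have e2 : ∀ g : ℝ, ∫⁻ τ : Key → ℝ, ENNReal.ofReal (Real.exp (√(2 * a) *
      (∑ k ∈ t, w k * τ k) * g)) ∂auxMeasure = ENNReal.ofReal (Real.exp (a * σ * g ^ 2)) := by
    intro g
    have h := integral_exp_sum_mul t (fun k => √(2 * a) * g * w k)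
    have e : ∀ τ : Key → ℝ, √(2 * a) * (∑ k ∈ t, w k * τ k) * g =
        ∑ k ∈ t, √(2 * a) * g * w k * τ k := by
      intro τ
      rw [Finset.mul_sum, Finset.sum_mul]
      exact Finset.sum_congr rfl fun _ _ => by ring
    simp_rw [e]
    rw [← ofReal_integral_eq_lintegral_ofReal
      (integrable_of_integral_ne_zero (by rw [h]; positivity)) (ae_of_all _ fun x => by positivity),
      h]
    congr 2
    simp_rw [mul_pow, hsq, ← Finset.sum_div, ← Finset.mul_sum, ← hσ]
    ring
  simp_rw [e1]
  rw [lintegral_lintegral_swap (by fun_prop)]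
  simp_rw [e2]
  have h0 : 0 ≤ a * σ := by positivity
  rw [← ofReal_integral_eq_lintegral_ofReal (integrable_of_integral_ne_zero
    (integral_exp_mul_sq_gaussianReal_pos h1).ne') (ae_of_all _ fun x => by positivity)]
  exact ENNReal.ofReal_le_ofReal (integral_exp_mul_sq_gaussianReal_le h0 h1)

/-- The rate of exponential integrability of the intermediate fields. -/
def rate (m : ℝ) : ℝ := 1 / (24 * fiberBound m)

theorem rate_pos {m : ℝ} (hm : 0 < m) : 0 < rate m := by
  have := fiberBound_pos hm
  unfold rate; positivity

/-- The linear and the quadratic form are dependent; the inequality `x y ≤ (x² + y²) / 2` for their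
exponentials separates them at the price of doubling the rate, and each one is then an explicit
Gaussian integral. -/
theorem lintegral_exp_rate_le {m : ℝ} (hm : 0 < m) (s : Finset Mode) :
    ∫⁻ τ, ENNReal.ofReal (Real.exp (rate m * (linSum m s τ ^ 2 + quadSum m s τ))) ∂auxMeasure ≤
      ENNReal.ofReal 2 := by
  have hD := fiberBound_pos hm
  have hr := rate_pos hm
  -- The constant `24` makes `6 * rate * fiberC² ≤ 6 / 24 = 1/4`, the limit of the one-dimensional
  -- bound. It yields `exp (1/6)` for the linear part and `exp (1/2)` for the quadratic part, both
  -- below `2`.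
  have hrD : rate m * fiberBound m = 1 / 24 := by unfold rate; field_simp
  have hS := sum_fiberC_sq_le hm s (keys s)
  have hk : ∀ k, fiberC m s k ^ 2 ≤ fiberBound m := fun k => by
    simpa using sum_fiberC_sq_le hm s {k}
  have h1 : ∀ τ : Key → ℝ, Real.exp (rate m * (linSum m s τ ^ 2 + quadSum m s τ)) ≤
      2⁻¹ * Real.exp (2 * rate m * (∑ k ∈ keys s, fiberC m s k * τ k) ^ 2) +
      2⁻¹ * Real.exp (∑ k ∈ keys s, 6 * rate m * fiberC m s k ^ 2 * τ k ^ 2) := by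
    intro τ
    have hq := quadSum_le hm s τ
    rw [linSum_eq]
    have e : ∑ k ∈ keys s, 6 * rate m * fiberC m s k ^ 2 * τ k ^ 2 =
        2 * (rate m * ∑ k ∈ keys s, 3 * fiberC m s k ^ 2 * τ k ^ 2) := by
      rw [Finset.mul_sum, Finset.mul_sum]
      exact Finset.sum_congr rfl fun _ _ => by ring
    rw [e]
    set A := ∑ k ∈ keys s, fiberC m s k * τ k
    set Q := ∑ k ∈ keys s, 3 * fiberC m s k ^ 2 * τ k ^ 2
    have h2 : Real.exp (rate m * (A ^ 2 + quadSum m s τ)) ≤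
        Real.exp (rate m * A ^ 2) * Real.exp (rate m * Q) := by
      rw [← Real.exp_add, ← mul_add]
      gcongr
    have h3 : Real.exp (2 * rate m * A ^ 2) = Real.exp (rate m * A ^ 2) ^ 2 := by
      rw [← Real.exp_nat_mul]; congr 1; push_cast; ring
    have h4 : Real.exp (2 * (rate m * Q)) = Real.exp (rate m * Q) ^ 2 := by
      rw [← Real.exp_nat_mul]; push_cast; rfl
    rw [h3, h4]
    nlinarith [sq_nonneg (Real.exp (rate m * A ^ 2) - Real.exp (rate m * Q))]
  calc _ ≤ ∫⁻ τ, (ENNReal.ofReal 2⁻¹ * ENNReal.ofReal (Real.exp (2 * rate m *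
          (∑ k ∈ keys s, fiberC m s k * τ k) ^ 2)) + ENNReal.ofReal 2⁻¹ *
          ENNReal.ofReal (Real.exp (∑ k ∈ keys s, 6 * rate m * fiberC m s k ^ 2 * τ k ^ 2)))
          ∂auxMeasure := by
        refine lintegral_mono fun τ => ?_
        rw [← ENNReal.ofReal_mul (by positivity), ← ENNReal.ofReal_mul (by positivity),
          ← ENNReal.ofReal_add (by positivity) (by positivity)]
        exact ENNReal.ofReal_le_ofReal (h1 τ)
    _ ≤ ENNReal.ofReal 2⁻¹ * ENNReal.ofReal (Real.exp (1 / 2)) +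
          ENNReal.ofReal 2⁻¹ * ENNReal.ofReal (Real.exp (1 / 2)) := by
        rw [lintegral_add_left (by fun_prop), lintegral_const_mul _ (by fun_prop),
          lintegral_const_mul _ (by fun_prop)]
        gcongr
        · refine (lintegral_exp_mul_sq_sum_le (by positivity) ?_).trans
            (ENNReal.ofReal_le_ofReal (Real.exp_le_exp.2 ?_))
          · nlinarith
          · nlinarith
        · have hw : ∀ k ∈ keys s, 6 * rate m * fiberC m s k ^ 2 ≤ 1 / 4 := fun k _ => by
            nlinarith [hk k]
          rw [← ofReal_integral_eq_lintegral_ofReal (integrable_exp_sum_mul_sq hw)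
            (ae_of_all _ fun x => by positivity)]
          refine ENNReal.ofReal_le_ofReal ((integral_exp_sum_mul_sq_le
            (fun k _ => by positivity) hw).trans (Real.exp_le_exp.2 ?_))
          rw [← Finset.mul_sum]
          nlinarith
    _ ≤ ENNReal.ofReal 2 := by
        rw [← ENNReal.ofReal_mul (by positivity), ← ENNReal.ofReal_add (by positivity)
          (by positivity)]
        refine ENNReal.ofReal_le_ofReal ?_
        have h : Real.exp (1 / 2) ^ 2 < 2 ^ 2 := by
          rw [← Real.exp_nat_mul]
          norm_num
          linarith [Real.exp_one_lt_d9]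
        have := abs_lt_of_sq_lt_sq h (by norm_num)
        rw [abs_lt] at this
        linarith [this.2]

theorem integrable_exp_rate {m : ℝ} (hm : 0 < m) (s : Finset Mode) :
    Integrable (fun τ => Real.exp (rate m * (linSum m s τ ^ 2 + quadSum m s τ))) auxMeasure := by
  refine ⟨by fun_prop, ?_⟩
  rw [hasFiniteIntegral_iff_ofReal (ae_of_all _ fun x => by positivity)]
  exact (lintegral_exp_rate_le hm s).trans_lt ENNReal.ofReal_lt_top

theorem integral_exp_rate_le {m : ℝ} (hm : 0 < m) (s : Finset Mode) :
    ∫ τ, Real.exp (rate m * (linSum m s τ ^ 2 + quadSum m s τ)) ∂auxMeasure ≤ 2 := by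
  rw [integral_eq_lintegral_of_nonneg_ae (ae_of_all _ fun x => by positivity) (by fun_prop)]
  exact ENNReal.toReal_le_of_le_ofReal (by norm_num) (lintegral_exp_rate_le hm s)

/-! ### The integrand of the intermediate field representation -/

/-- The disc `|z|² < k Re z`. It is mapped to the cardioid by `z ↦ z² / 2`. -/
def rootDisc (k : ℝ) : Set ℂ := {z | ‖z‖ ^ 2 < k * z.re}

/-- The product of the inverse factors `1 - i z C₀(p) Γ(p)`. -/
def integrand (m : ℝ) (s : Finset Mode) (z : ℂ) (τ : Key → ℝ) : ℂ :=
  ∏ p ∈ s, (1 - Complex.I * z * (amp m τ p : ℂ))⁻¹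

@[fun_prop]
theorem measurable_integrand (m : ℝ) (s : Finset Mode) (z : ℂ) :
    Measurable (integrand m s z) := by
  unfold integrand; fun_prop

theorem sq_norm_factor (z : ℂ) (x : ℝ) :
    ‖1 - Complex.I * z * (x : ℂ)‖ ^ 2 = 1 + 2 * (x * z.im) + ‖z‖ ^ 2 * x ^ 2 := by
  rw [Complex.sq_norm, Complex.sq_norm, Complex.normSq_apply, Complex.normSq_apply]
  simp
  ring

theorem im_mul_sq_le (z : ℂ) (x : ℝ) : (x * z.im) ^ 2 ≤ ‖z‖ ^ 2 * x ^ 2 := by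
  rw [Complex.sq_norm, Complex.normSq_apply]
  nlinarith [mul_self_nonneg (z.re * x)]

/-- Bound of one factor, where `δ` is a lower bound of its squared modulus. -/
theorem sq_norm_inv_factor_le {z : ℂ} {x B : ℝ}
    (hq : 0 < 1 + 2 * (x * z.im) + ‖z‖ ^ 2 * x ^ 2)
    (hB : ‖z‖ ^ 2 * x ^ 2 ≤ B * (1 + 2 * (x * z.im) + ‖z‖ ^ 2 * x ^ 2)) :
    ‖(1 - Complex.I * z * (x : ℂ))⁻¹‖ ^ 2 ≤
      Real.exp (-2 * (x * z.im) + 5 * B + ‖z‖ ^ 2 * x ^ 2) := by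
  rw [norm_inv, inv_pow, sq_norm_factor]
  have hu := im_mul_sq_le z x
  set u := x * z.im
  set v := ‖z‖ ^ 2 * x ^ 2
  have hv : 0 ≤ v := by positivity
  set q := 1 + 2 * u + v with hqdef
  have h1 : Real.log q⁻¹ ≤ q⁻¹ - 1 := Real.log_le_sub_one_of_pos (inv_pos.2 hq)
  -- The term `-2 u` must be kept exactly, as it has to be summed over the modes before absolute
  -- values are taken. The second-order error `4 u²` is absorbed by `5 B q`, since `u² ≤ v ≤ B q`.
  have h2 : q⁻¹ - 1 ≤ -2 * u + 5 * B + v := by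
    have : q⁻¹ - 1 = (1 - q) / q := by field_simp
    rw [this, div_le_iff₀ hq]
    nlinarith
  exact (Real.log_le_iff_le_exp (inv_pos.2 hq)).1 (h1.trans h2)

theorem sq_norm_integrand_le {m : ℝ} {s : Finset Mode} {z : ℂ} {τ : Key → ℝ} {b : ℝ}
    (hq : ∀ p ∈ s, 0 < 1 + 2 * (amp m τ p * z.im) + ‖z‖ ^ 2 * amp m τ p ^ 2)
    (hb : ∀ p ∈ s, ‖z‖ ^ 2 * amp m τ p ^ 2 ≤ b * amp m τ p ^ 2 *
      (1 + 2 * (amp m τ p * z.im) + ‖z‖ ^ 2 * amp m τ p ^ 2)) :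
    ‖integrand m s z τ‖ ^ 2 ≤
      Real.exp (-2 * (linSum m s τ * z.im) + (5 * b + ‖z‖ ^ 2) * quadSum m s τ) := by
  rw [integrand, norm_prod, ← Finset.prod_pow]
  calc ∏ p ∈ s, ‖(1 - Complex.I * z * (amp m τ p : ℂ))⁻¹‖ ^ 2
      ≤ ∏ p ∈ s, Real.exp (-2 * (amp m τ p * z.im) + 5 * (b * amp m τ p ^ 2) +
          ‖z‖ ^ 2 * amp m τ p ^ 2) :=
        Finset.prod_le_prod (fun _ _ => by positivity)
          fun p hp => sq_norm_inv_factor_le (hq p hp) (hb p hp)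
    _ = _ := by
        rw [← Real.exp_sum, linSum, quadSum, Finset.sum_mul, Finset.mul_sum, Finset.mul_sum,
          ← Finset.sum_add_distrib]
        congr 1
        exact Finset.sum_congr rfl fun _ _ => by ring

theorem re_pos_of_mem_rootDisc {k : ℝ} (hk : 0 < k) {z : ℂ} (hz : z ∈ rootDisc k) : 0 < z.re := by
  have : 0 < k * z.re := (sq_nonneg _).trans_lt hz
  exact pos_of_mul_pos_right this hk.le

theorem norm_lt_of_mem_rootDisc {k : ℝ} (hk : 0 < k) {z : ℂ} (hz : z ∈ rootDisc k) : ‖z‖ < k := by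
  have h1 : ‖z‖ ^ 2 < k * z.re := hz
  have h2 := Complex.re_le_norm z
  have h3 := re_pos_of_mem_rootDisc hk hz
  nlinarith

theorem factor_pos_of_re_pos {z : ℂ} (hz : 0 < z.re) (x : ℝ) :
    0 < 1 + 2 * (x * z.im) + ‖z‖ ^ 2 * x ^ 2 := by
  rw [Complex.sq_norm, Complex.normSq_apply]
  rcases eq_or_ne x 0 with rfl | hx
  · simp
  · have : 0 < z.re * z.re * x ^ 2 := by positivity
    nlinarith [sq_nonneg (1 + x * z.im)]

/-- A factor has squared modulus at least `(Re z / |z|)²`, and the condition `|z|² < k Re z` then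
gives `|z|² ≤ k² |1 - i z x|²`. This is where the shape of the disc, and so of the cardioid, enters.
The exponent is at most `(5 k² + |z|²) / 2 ≤ 3 k²` times `quadSum`. -/
theorem norm_integrand_le {m k : ℝ} (hk : 0 < k) (s : Finset Mode) {z : ℂ} (hz : z ∈ rootDisc k)
    (τ : Key → ℝ) :
    ‖integrand m s z τ‖ ≤ Real.exp (k * |linSum m s τ| + 3 * k ^ 2 * quadSum m s τ) := by
  have hre := re_pos_of_mem_rootDisc hk hz
  have hn := norm_lt_of_mem_rootDisc hk hz
  have hQ := quadSum_nonneg m s τ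
  refine abs_le_of_sq_le_sq' ?_ (by positivity) |>.2
  refine (sq_norm_integrand_le (b := k ^ 2) (fun p _ => factor_pos_of_re_pos hre _)
    (fun p _ => ?_)).trans ?_
  · set x := amp m τ p
    have hz2 : z.re ^ 2 ≤ ‖z‖ ^ 2 * (1 + 2 * (x * z.im) + ‖z‖ ^ 2 * x ^ 2) := by
      have : ‖z‖ ^ 2 = z.re ^ 2 + z.im ^ 2 := by
        rw [Complex.sq_norm, Complex.normSq_apply]; ring
      nlinarith [sq_nonneg (z.im + ‖z‖ ^ 2 * x)]
    have hz3 : ‖z‖ ^ 2 * ‖z‖ ^ 2 ≤ k ^ 2 * z.re ^ 2 := by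
      have h1 : ‖z‖ ^ 2 < k * z.re := hz
      have := sq_nonneg ‖z‖
      nlinarith
    have hz0 : 0 < ‖z‖ ^ 2 := by
      have : z ≠ 0 := fun h => by simp [h] at hre
      positivity
    have h5 : ‖z‖ ^ 2 ≤ k ^ 2 * (1 + 2 * (x * z.im) + ‖z‖ ^ 2 * x ^ 2) := by
      refine le_of_mul_le_mul_left ?_ hz0
      nlinarith [sq_nonneg k]
    nlinarith [sq_nonneg x]
  · rw [← Real.exp_nat_mul]
    refine Real.exp_le_exp.2 ?_
    have h1 : -2 * (linSum m s τ * z.im) ≤ 2 * (k * |linSum m s τ|) := by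
      have h2 : |linSum m s τ * z.im| ≤ |linSum m s τ| * k := by
        rw [abs_mul]
        exact mul_le_mul_of_nonneg_left ((Complex.abs_im_le_norm z).trans hn.le) (abs_nonneg _)
      have := neg_le_of_abs_le h2
      linarith
    have h2 : ‖z‖ ^ 2 ≤ k ^ 2 := pow_le_pow_left₀ (norm_nonneg _) hn.le 2
    push_cast
    nlinarith

end TGFT

namespace TGFT

/-! ### Taylor expansion of the integrand -/

/-- The size of a configuration of intermediate fields. -/
def size (m : ℝ) (s : Finset Mode) (τ : Key → ℝ) : ℝ :=
  √(1 + (linSum m s τ ^ 2 + quadSum m s τ))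

@[fun_prop]
theorem measurable_size (m : ℝ) (s : Finset Mode) : Measurable (size m s) := by
  unfold size; fun_prop

theorem sq_size (m : ℝ) (s : Finset Mode) (τ : Key → ℝ) :
    size m s τ ^ 2 = 1 + (linSum m s τ ^ 2 + quadSum m s τ) :=
  Real.sq_sqrt (by have := quadSum_nonneg m s τ; positivity)

theorem one_le_size (m : ℝ) (s : Finset Mode) (τ : Key → ℝ) : 1 ≤ size m s τ :=
  Real.one_le_sqrt.2 (by have := quadSum_nonneg m s τ; nlinarith [sq_nonneg (linSum m s τ)])

theorem abs_amp_le_size (m : ℝ) (s : Finset Mode) (τ : Key → ℝ) {p : Mode} (hp : p ∈ s) :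
    |amp m τ p| ≤ size m s τ := by
  refine Real.abs_le_sqrt ?_
  have h1 : amp m τ p ^ 2 ≤ quadSum m s τ :=
    Finset.single_le_sum (f := fun p => amp m τ p ^ 2) (fun _ _ => sq_nonneg _) hp
  nlinarith [sq_nonneg (linSum m s τ)]

theorem abs_linSum_le_size (m : ℝ) (s : Finset Mode) (τ : Key → ℝ) :
    |linSum m s τ| ≤ size m s τ := by
  refine Real.abs_le_sqrt ?_
  have := quadSum_nonneg m s τ
  linarith

theorem norm_mul_size_lt_one {m : ℝ} {s : Finset Mode} {τ : Key → ℝ} {z : ℂ}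
    (hz : z ∈ Metric.ball (0 : ℂ) (size m s τ)⁻¹) : ‖z‖ * size m s τ < 1 := by
  have h1 := one_le_size m s τ
  rw [mem_ball_zero_iff] at hz
  calc ‖z‖ * size m s τ < (size m s τ)⁻¹ * size m s τ := by gcongr
    _ = 1 := inv_mul_cancel₀ (by positivity)

theorem factor_ne_zero {m : ℝ} {s : Finset Mode} {τ : Key → ℝ} {z : ℂ}
    (hz : ‖z‖ * size m s τ < 1) {p : Mode} (hp : p ∈ s) :
    1 - Complex.I * z * (amp m τ p : ℂ) ≠ 0 := by
  intro h
  have h1 : ‖Complex.I * z * (amp m τ p : ℂ)‖ = 1 := by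
    rw [← sub_eq_zero.1 h]; simp
  have h2 := abs_amp_le_size m s τ hp
  rw [norm_mul, norm_mul, Complex.norm_I, one_mul, Complex.norm_real, Real.norm_eq_abs] at h1
  nlinarith [norm_nonneg z]

theorem differentiableOn_integrand_ball (m : ℝ) (s : Finset Mode) (τ : Key → ℝ) :
    DifferentiableOn ℂ (fun z => integrand m s z τ) (Metric.ball 0 (size m s τ)⁻¹) := by
  unfold integrand
  refine DifferentiableOn.fun_finsetProd fun p hp => ?_
  refine DifferentiableOn.fun_inv (by fun_prop) fun z hz => ?_
  exact factor_ne_zero (norm_mul_size_lt_one hz) hp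

theorem factor_ne_zero_of_re_pos {z : ℂ} (hz : 0 < z.re) (x : ℝ) :
    1 - Complex.I * z * (x : ℂ) ≠ 0 := by
  intro h
  have h1 := sq_norm_factor z x
  rw [h] at h1
  have h2 := factor_pos_of_re_pos hz x
  rw [← h1] at h2
  simp at h2

theorem differentiableOn_integrand_rootDisc {k : ℝ} (hk : 0 < k) (m : ℝ) (s : Finset Mode)
    (τ : Key → ℝ) : DifferentiableOn ℂ (fun z => integrand m s z τ) (rootDisc k) := by
  unfold integrand
  refine DifferentiableOn.fun_finsetProd fun p hp => ?_
  exact DifferentiableOn.fun_inv (by fun_prop) fun z hz =>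
    factor_ne_zero_of_re_pos (re_pos_of_mem_rootDisc hk hz) _

/-- When `|z| size ≤ 1/2` every factor has modulus at least `1/2` and both `|z linSum|` and `|z|²
quadSum` are bounded, so the bound does not see the number of modes. It holds near `0` in all
directions, also outside the disc, which is what Cauchy's estimates need. -/
theorem norm_integrand_le_of_small {m : ℝ} {s : Finset Mode} {τ : Key → ℝ} {z : ℂ}
    (hz : ‖z‖ * size m s τ ≤ 1 / 2) : ‖integrand m s z τ‖ ≤ Real.exp 4 := by
  have hV := one_le_size m s τ
  have hQ := quadSum_nonneg m s τ
  have hx : ∀ p ∈ s, |‖z‖ * amp m τ p| ≤ 1 / 2 := by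
    intro p hp
    rw [abs_mul, abs_norm]
    exact (mul_le_mul_of_nonneg_left (abs_amp_le_size m s τ hp) (norm_nonneg _)).trans hz
  have hq : ∀ p ∈ s, 1 / 4 ≤ 1 + 2 * (amp m τ p * z.im) + ‖z‖ ^ 2 * amp m τ p ^ 2 := by
    intro p hp
    have h1 := hx p hp
    have h2 : |amp m τ p * z.im| ≤ |‖z‖ * amp m τ p| := by
      rw [abs_mul, abs_mul, abs_norm, mul_comm]
      gcongr
      exact Complex.abs_im_le_norm z
    set w := ‖z‖ * amp m τ p
    have h3 : ‖z‖ ^ 2 * amp m τ p ^ 2 = |w| ^ 2 := by rw [sq_abs]; ring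
    rw [h3]
    have h4 := neg_le_of_abs_le h2
    nlinarith
  refine abs_le_of_sq_le_sq' ?_ (by positivity) |>.2
  refine (sq_norm_integrand_le (b := 4 * ‖z‖ ^ 2) (fun p hp => by linarith [hq p hp])
    (fun p hp => ?_)).trans ?_
  · have h1 := hq p hp
    have h2 : 0 ≤ ‖z‖ ^ 2 * amp m τ p ^ 2 := by positivity
    nlinarith
  · rw [← Real.exp_nat_mul]
    refine Real.exp_le_exp.2 ?_
    have h1 : |linSum m s τ * z.im| ≤ 1 / 2 := by
      rw [abs_mul, mul_comm]
      refine le_trans ?_ hz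
      gcongr
      · exact Complex.abs_im_le_norm z
      · exact abs_linSum_le_size m s τ
    have h2 := neg_le_of_abs_le h1
    have h3 : ‖z‖ ^ 2 * quadSum m s τ ≤ 1 / 4 := by
      have h4 := sq_size m s τ
      calc ‖z‖ ^ 2 * quadSum m s τ ≤ ‖z‖ ^ 2 * size m s τ ^ 2 := by
            gcongr; rw [h4]; nlinarith [sq_nonneg (linSum m s τ)]
        _ = (‖z‖ * size m s τ) ^ 2 := by ring
        _ ≤ (1 / 2) ^ 2 := by gcongr
        _ = 1 / 4 := by norm_num
    push_cast
    linarith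

/-- The Taylor coefficients at `0` of the integrand, as a function of `z`. -/
def taylorCoeff (m : ℝ) (s : Finset Mode) (n : ℕ) (τ : Key → ℝ) : ℂ :=
  (n.factorial : ℂ)⁻¹ * iteratedDeriv n (fun z => integrand m s z τ) 0

theorem diffContOnCl_integrand (m : ℝ) (s : Finset Mode) (τ : Key → ℝ) :
    DiffContOnCl ℂ (fun z => integrand m s z τ) (Metric.ball 0 (2 * size m s τ)⁻¹) := by
  have h1 := one_le_size m s τ
  refine DifferentiableOn.diffContOnCl ?_
  rw [closure_ball _ (by positivity)]
  refine (differentiableOn_integrand_ball m s τ).mono (Metric.closedBall_subset_ball ?_)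
  gcongr
  linarith

theorem norm_taylorCoeff_le (m : ℝ) (s : Finset Mode) (n : ℕ) (τ : Key → ℝ) :
    ‖taylorCoeff m s n τ‖ ≤ Real.exp 4 * (2 * size m s τ) ^ n := by
  have h1 := one_le_size m s τ
  have h := Complex.norm_iteratedDeriv_le_of_forall_mem_sphere_norm_le n
    (by positivity) (diffContOnCl_integrand m s τ) (C := Real.exp 4) fun z hz =>
      norm_integrand_le_of_small (by
        rw [mem_sphere_zero_iff_norm] at hz
        rw [hz]
        field_simp
        norm_num)
  have hf : (0 : ℝ) < n.factorial := by positivity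
  rw [taylorCoeff, norm_mul, norm_inv, Complex.norm_natCast, inv_mul_le_iff₀ hf]
  refine h.trans_eq ?_
  rw [inv_pow, div_inv_eq_mul]
  ring

theorem hasSum_taylorCoeff {m : ℝ} {s : Finset Mode} {τ : Key → ℝ} {z : ℂ}
    (hz : z ∈ Metric.ball (0 : ℂ) (size m s τ)⁻¹) :
    HasSum (fun n => taylorCoeff m s n τ * z ^ n) (integrand m s z τ) := by
  have := Complex.hasSum_taylorSeries_on_ball (differentiableOn_integrand_ball m s τ) hz
  simpa [taylorCoeff, mul_assoc, mul_comm, mul_left_comm] using this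

/-- Cauchy's formula over a circle whose radius is a measurable function of `τ` writes the
coefficient as an integral depending measurably on `τ`. -/
theorem measurable_taylorCoeff (m : ℝ) (s : Finset Mode) (n : ℕ) :
    Measurable (taylorCoeff m s n) := by
  have e : taylorCoeff m s n = fun τ => (n.factorial : ℂ)⁻¹ * (n.factorial •
      (2 * Real.pi * Complex.I : ℂ)⁻¹ • ∫ θ in (0 : ℝ)..2 * Real.pi,
        deriv (circleMap 0 (2 * size m s τ)⁻¹) θ •
          ((circleMap 0 (2 * size m s τ)⁻¹ θ - 0)⁻¹ ^ (n + 1) •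
            integrand m s (circleMap 0 (2 * size m s τ)⁻¹ θ) τ)) := by
    funext τ
    have h1 := one_le_size m s τ
    rw [taylorCoeff, iteratedDeriv_eq_smul_circleIntegral (by positivity)
      (diffContOnCl_integrand m s τ) n]
    rfl
  rw [e]
  simp_rw [intervalIntegral.integral_of_le Real.two_pi_pos.le]
  refine measurable_const.mul (Measurable.fun_const_smul (Measurable.fun_const_smul ?_ _) _)
  refine (StronglyMeasurable.integral_prod_right (ν := volume.restrict (Set.Ioc 0 (2 * Real.pi)))
    (f := fun (τ : Key → ℝ) (θ : ℝ) => deriv (circleMap 0 (2 * size m s τ)⁻¹) θ •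
          ((circleMap 0 (2 * size m s τ)⁻¹ θ - 0)⁻¹ ^ (n + 1) •
            integrand m s (circleMap 0 (2 * size m s τ)⁻¹ θ) τ)) ?_).measurable
  refine Measurable.stronglyMeasurable ?_
  simp only [deriv_circleMap, circleMap, integrand, Function.uncurry_def, smul_eq_mul]
  fun_prop

/-- There are two regimes for `q = 2 size |z|`. For `q ≤ 1/2` the difference is a geometric tail.
For `q > 1/2` the right-hand power `(2q)ᴺ` is at least `1`, so the integrand and the Taylor
polynomial may be bounded separately. No derivative of the integrand away from `0` is needed. -/
theorem norm_integrand_sub_le (m : ℝ) (s : Finset Mode) (z : ℂ) (τ : Key → ℝ) (N : ℕ) :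
    ‖integrand m s z τ - ∑ n ∈ Finset.range N, taylorCoeff m s n τ * z ^ n‖ ≤
      (‖integrand m s z τ‖ + 2 * Real.exp 4) * (4 * size m s τ * ‖z‖) ^ N := by
  have hV := one_le_size m s τ
  have hz0 := norm_nonneg z
  set q := 2 * size m s τ * ‖z‖ with hq
  have hq0 : 0 ≤ q := by positivity
  have e : 4 * size m s τ * ‖z‖ = 2 * q := by rw [hq]; ring
  have hterm : ∀ n, ‖taylorCoeff m s n τ * z ^ n‖ ≤ Real.exp 4 * q ^ n := by
    intro n
    rw [norm_mul, norm_pow, hq, mul_pow _ ‖z‖, ← mul_assoc]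
    gcongr
    exact norm_taylorCoeff_le m s n τ
  rw [e]
  rcases le_or_gt q (1 / 2) with h | h
  · have hz : z ∈ Metric.ball (0 : ℂ) (size m s τ)⁻¹ := by
      rw [mem_ball_zero_iff, ← one_div, lt_div_iff₀ (by positivity)]
      linarith
    have h1 := norm_sub_le_of_geometric_bound_of_hasSum (by linarith) hterm
      (hasSum_taylorCoeff hz) N
    rw [norm_sub_rev]
    refine h1.trans ?_
    have h2 : q ^ N ≤ (2 * q) ^ N := by gcongr; linarith
    have h4 : Real.exp 4 * q ^ N / (1 - q) ≤ Real.exp 4 * (2 * q) ^ N / (1 / 2) := by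
      gcongr
      linarith
    have h6 : 0 ≤ ‖integrand m s z τ‖ * (2 * q) ^ N := by positivity
    linarith
  · have h2 : ∀ n ≤ N, q ^ n ≤ (1 / 2) ^ n * (2 * q) ^ N := by
      intro n hn
      calc q ^ n = (1 / 2) ^ n * (2 * q) ^ n := by rw [← mul_pow]; ring
        _ ≤ (1 / 2) ^ n * (2 * q) ^ N := by
          gcongr
          linarith
    have h3 : (1 : ℝ) ≤ (2 * q) ^ N := one_le_pow₀ (by linarith)
    have h4 : ‖∑ n ∈ Finset.range N, taylorCoeff m s n τ * z ^ n‖ ≤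
        2 * Real.exp 4 * (2 * q) ^ N := by
      calc _ ≤ ∑ n ∈ Finset.range N, Real.exp 4 * ((1 / 2) ^ n * (2 * q) ^ N) := by
            refine norm_sum_le_of_le _ fun n hn => (hterm n).trans ?_
            gcongr
            exact h2 n (Finset.mem_range.1 hn).le
        _ = (∑ n ∈ Finset.range N, (1 / 2 : ℝ) ^ n) * (Real.exp 4 * (2 * q) ^ N) := by
            rw [Finset.sum_mul]
            exact Finset.sum_congr rfl fun _ _ => by ring
        _ ≤ 2 * (Real.exp 4 * (2 * q) ^ N) := by
            gcongr
            exact sum_geometric_two_le N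
        _ = _ := by ring
    calc _ ≤ ‖integrand m s z τ‖ * 1 + 2 * Real.exp 4 * (2 * q) ^ N := by
          rw [mul_one]; exact (norm_sub_le _ _).trans (by gcongr)
      _ ≤ ‖integrand m s z τ‖ * (2 * q) ^ N + 2 * Real.exp 4 * (2 * q) ^ N := by gcongr
      _ = _ := by ring

/-! ### The partition function with cutoff -/

/-- The partition function of the modes in `s`, as a function of `z = √(2 lam)`. -/
def finitePartition (m : ℝ) (s : Finset Mode) (z : ℂ) : ℂ := ∫ τ, integrand m s z τ ∂auxMeasure

/-- The size of the disc on which the partition function is controlled. -/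
def radius (m : ℝ) : ℝ := √(rate m / 12)

theorem radius_pos {m : ℝ} (hm : 0 < m) : 0 < radius m :=
  Real.sqrt_pos.2 (by have := rate_pos hm; positivity)

/-- The integrable function that dominates the integrand. -/
def expRate (m : ℝ) (s : Finset Mode) (τ : Key → ℝ) : ℝ :=
  Real.exp (rate m * (linSum m s τ ^ 2 + quadSum m s τ))

theorem integrable_expRate {m : ℝ} (hm : 0 < m) (s : Finset Mode) :
    Integrable (expRate m s) auxMeasure := integrable_exp_rate hm s

theorem integral_expRate_le {m : ℝ} (hm : 0 < m) (s : Finset Mode) :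
    ∫ τ, expRate m s τ ∂auxMeasure ≤ 2 := integral_exp_rate_le hm s

/-- The choice `radius² = rate / 12` lets the integrand use only half of the rate of exponential
integrability; the other half is reserved for the powers of `size` in the remainder. -/
theorem norm_integrand_le_exp_half {m : ℝ} (hm : 0 < m) (s : Finset Mode) {z : ℂ}
    (hz : z ∈ rootDisc (radius m)) (τ : Key → ℝ) :
    ‖integrand m s z τ‖ ≤
      Real.exp 1 * Real.exp (rate m / 2 * (linSum m s τ ^ 2 + quadSum m s τ)) := by
  refine (norm_integrand_le (radius_pos hm) s hz τ).trans ?_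
  rw [← Real.exp_add]
  refine Real.exp_le_exp.2 ?_
  have hr := rate_pos hm
  have hk : radius m ^ 2 = rate m / 12 := Real.sq_sqrt (by positivity)
  have hQ := quadSum_nonneg m s τ
  have hL : |linSum m s τ| ^ 2 = linSum m s τ ^ 2 := sq_abs _
  set x := |linSum m s τ|
  set k := radius m
  rw [← hL]
  nlinarith [sq_nonneg (k * x - 1), mul_nonneg hr.le hQ, mul_nonneg hr.le (sq_nonneg x)]

theorem exp_half_le_expRate {m : ℝ} (hm : 0 < m) (s : Finset Mode) (τ : Key → ℝ) :
    Real.exp (rate m / 2 * (linSum m s τ ^ 2 + quadSum m s τ)) ≤ expRate m s τ := by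
  have hr := rate_pos hm
  have hQ := quadSum_nonneg m s τ
  refine Real.exp_le_exp.2 ?_
  nlinarith [mul_nonneg hr.le hQ, mul_nonneg hr.le (sq_nonneg (linSum m s τ))]

theorem norm_integrand_le_expRate {m : ℝ} (hm : 0 < m) (s : Finset Mode) {z : ℂ}
    (hz : z ∈ rootDisc (radius m)) (τ : Key → ℝ) :
    ‖integrand m s z τ‖ ≤ Real.exp 1 * expRate m s τ :=
  (norm_integrand_le_exp_half hm s hz τ).trans (by
    gcongr; exact exp_half_le_expRate hm s τ)

/-- This is `xʳ ≤ r! eˣ` with `x = rate / 2 * size²`. Since `size²` itself is exponentially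
integrable, `2r` powers of `size` cost `r!` and not `(2r)!`, which gives the factorial of the
theorem in the variable `lam = z² / 2`. -/
theorem size_pow_le {m : ℝ} (hm : 0 < m) (s : Finset Mode) (τ : Key → ℝ) (r : ℕ) :
    size m s τ ^ (2 * r) ≤ r.factorial * (2 / rate m) ^ r * (Real.exp (rate m / 2) *
      Real.exp (rate m / 2 * (linSum m s τ ^ 2 + quadSum m s τ))) := by
  have hr := rate_pos hm
  rw [pow_mul, sq_size, ← Real.exp_add]
  have hQ := quadSum_nonneg m s τ
  have h0 : 0 ≤ 1 + (linSum m s τ ^ 2 + quadSum m s τ) := by positivity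
  have h := Real.pow_div_factorial_le_exp (rate m / 2 * (1 + (linSum m s τ ^ 2 + quadSum m s τ)))
    (by positivity) r
  rw [div_le_iff₀ (by positivity), mul_pow] at h
  rw [div_pow]
  have e : (rate m / 2) ^ r = rate m ^ r / 2 ^ r := div_pow _ _ _
  rw [e, div_mul_eq_mul_div, div_le_iff₀ (by positivity)] at h
  have e2 : rate m / 2 * (1 + (linSum m s τ ^ 2 + quadSum m s τ)) =
    rate m / 2 + rate m / 2 * (linSum m s τ ^ 2 + quadSum m s τ) := by ring
  rw [e2] at h
  rw [mul_div_assoc', div_mul_eq_mul_div, le_div_iff₀ (by positivity)]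
  linarith

theorem integrable_integrand {m : ℝ} (hm : 0 < m) (s : Finset Mode) {z : ℂ}
    (hz : z ∈ rootDisc (radius m)) : Integrable (integrand m s z) auxMeasure :=
  ((integrable_expRate hm s).const_mul (Real.exp 1)).mono'
    (measurable_integrand m s z).aestronglyMeasurable
    (ae_of_all _ fun τ => norm_integrand_le_expRate hm s hz τ)

theorem integrable_taylorCoeff {m : ℝ} (hm : 0 < m) (s : Finset Mode) (n : ℕ) :
    Integrable (taylorCoeff m s n) auxMeasure := by
  refine ((integrable_expRate hm s).const_mul (Real.exp 4 * (2 ^ n * (n.factorial *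
    (2 / rate m) ^ n * Real.exp (rate m / 2))))).mono'
    (measurable_taylorCoeff m s n).aestronglyMeasurable (ae_of_all _ fun τ => ?_)
  have hr := rate_pos hm
  have h1 : size m s τ ^ n ≤ size m s τ ^ (2 * n) :=
    pow_le_pow_right₀ (one_le_size m s τ) (by omega)
  refine (norm_taylorCoeff_le m s n τ).trans ?_
  rw [mul_pow, mul_assoc (Real.exp 4), mul_assoc (2 ^ n)]
  gcongr
  refine h1.trans ((size_pow_le hm s τ n).trans ?_)
  rw [← mul_assoc]
  gcongr
  exact exp_half_le_expRate hm s τ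

theorem norm_finitePartition_le {m : ℝ} (hm : 0 < m) (s : Finset Mode) {z : ℂ}
    (hz : z ∈ rootDisc (radius m)) : ‖finitePartition m s z‖ ≤ 2 * Real.exp 1 := by
  refine (norm_integral_le_of_norm_le ((integrable_expRate hm s).const_mul (Real.exp 1))
    (ae_of_all _ fun τ => norm_integrand_le_expRate hm s hz τ)).trans ?_
  rw [integral_const_mul]
  nlinarith [integral_expRate_le hm s, Real.exp_pos 1]

theorem isOpen_rootDisc (k : ℝ) : IsOpen (rootDisc k) :=
  isOpen_lt (by fun_prop) (by fun_prop)

theorem differentiableOn_finitePartition {m : ℝ} (hm : 0 < m) (s : Finset Mode) :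
    DifferentiableOn ℂ (finitePartition m s) (rootDisc (radius m)) :=
  differentiableOn_integral_of_dominated (isOpen_rootDisc _) (f := fun τ z => integrand m s z τ)
    (fun z _ => (measurable_integrand m s z).aestronglyMeasurable)
    (ae_of_all _ fun τ => differentiableOn_integrand_rootDisc (radius_pos hm) m s τ)
    ((integrable_expRate hm s).const_mul (Real.exp 1))
    (ae_of_all _ fun τ _ hz => norm_integrand_le_expRate hm s hz τ)

/-- The constants in the remainder bound of the partition function. -/
def remConst (m : ℝ) : ℝ := (Real.exp 1 + 2 * Real.exp 4) * Real.exp (rate m / 2) * 2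

/-- The expansion of the partition function in powers of `z`, uniformly in the modes. -/
theorem norm_finitePartition_sub_le {m : ℝ} (hm : 0 < m) (s : Finset Mode) {z : ℂ}
    (hz : z ∈ rootDisc (radius m)) (r : ℕ) :
    ‖finitePartition m s z - ∑ n ∈ Finset.range (2 * r),
        (∫ τ, taylorCoeff m s n τ ∂auxMeasure) * z ^ n‖ ≤
      remConst m * (32 / rate m) ^ r * r.factorial * (‖z‖ ^ 2) ^ r := by
  have hr := rate_pos hm
  simp_rw [finitePartition, ← integral_mul_const]
  rw [← integral_finsetSum _ fun n _ => (integrable_taylorCoeff hm s n).mul_const _,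
    ← integral_sub (integrable_integrand hm s hz)
      (integrable_finsetSum _ fun n _ => (integrable_taylorCoeff hm s n).mul_const _)]
  set K := (Real.exp 1 + 2 * Real.exp 4) * Real.exp (rate m / 2) *
    ((32 / rate m) ^ r * r.factorial * (‖z‖ ^ 2) ^ r) with hK
  have hK0 : 0 ≤ K := by positivity
  refine (norm_integral_le_of_norm_le ((integrable_expRate hm s).const_mul K)
    (ae_of_all _ fun τ => ?_)).trans ?_
  · refine (norm_integrand_sub_le m s z τ (2 * r)).trans ?_
    set E := Real.exp (rate m / 2 * (linSum m s τ ^ 2 + quadSum m s τ)) with hE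
    have hE1 : 1 ≤ E := Real.one_le_exp (by have := quadSum_nonneg m s τ; positivity)
    -- One factor `E` pays for the integrand, the other for the power of `size`.
    have hEE : expRate m s τ = E * E := by
      rw [hE, ← Real.exp_add, expRate]; congr 1; ring
    have h1 : ‖integrand m s z τ‖ + 2 * Real.exp 4 ≤ (Real.exp 1 + 2 * Real.exp 4) * E := by
      have := norm_integrand_le_exp_half hm s hz τ
      nlinarith [Real.exp_pos 4]
    have h2 := size_pow_le hm s τ r
    have hV : 0 ≤ size m s τ := Real.sqrt_nonneg _
    have e : (4 * size m s τ * ‖z‖) ^ (2 * r) =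
        (16 * ‖z‖ ^ 2) ^ r * size m s τ ^ (2 * r) := by
      rw [pow_mul, pow_mul, ← mul_pow]; ring
    rw [e]
    calc _ ≤ ((Real.exp 1 + 2 * Real.exp 4) * E) * ((16 * ‖z‖ ^ 2) ^ r *
          (r.factorial * (2 / rate m) ^ r * (Real.exp (rate m / 2) * E))) := by gcongr
      _ = K * expRate m s τ := by
        rw [hEE, hK]
        have : (32 / rate m) ^ r = 16 ^ r * (2 / rate m) ^ r := by rw [← mul_pow]; ring
        rw [this, mul_pow]
        ring
  · rw [integral_const_mul]
    calc _ ≤ K * 2 := by gcongr; exact integral_expRate_le hm s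
      _ = _ := by rw [hK, remConst]; ring

end TGFT

/-! ### A power-mean inequality for series in `[0, ∞]` -/

/-- Jensen's inequality for the powers of a weighted sum. -/
theorem ENNReal.pow_tsum_mul_le {ι : Type*} (w y : ι → ENNReal) (n : ℕ) :
    (∑' i, w i * y i) ^ (n + 1) ≤ (∑' i, w i) ^ n * ∑' i, w i * y i ^ (n + 1) := by
  have hfin : ∀ s : Finset ι, (∑ i ∈ s, w i * y i) ^ (n + 1) ≤
      (∑' i, w i) ^ n * ∑' i, w i * y i ^ (n + 1) := by
    intro s
    have hp : (1 : ℝ) ≤ (n + 1 : ℕ) := by push_cast; linarith [n.cast_nonneg (α := ℝ)]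
    have hp0 : ((n + 1 : ℕ) : ℝ) ≠ 0 := by positivity
    have h := ENNReal.rpow_le_rpow (ENNReal.inner_le_weight_mul_Lp_of_nonneg s hp w y)
      (zero_le_one.trans hp)
    rw [ENNReal.mul_rpow_of_nonneg _ _ (by positivity), ← ENNReal.rpow_mul, ← ENNReal.rpow_mul,
      inv_mul_cancel₀ hp0, ENNReal.rpow_one, sub_mul, inv_mul_cancel₀ hp0, one_mul,
      ENNReal.rpow_natCast] at h
    have e : ((n + 1 : ℕ) : ℝ) - 1 = (n : ℕ) := by push_cast; ring
    rw [e, ENNReal.rpow_natCast] at h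
    simp_rw [ENNReal.rpow_natCast] at h
    refine h.trans ?_
    gcongr
    · exact ENNReal.sum_le_tsum s
    · exact ENNReal.sum_le_tsum s
  refine le_of_tendsto ((ENNReal.continuous_pow (n + 1)).tendsto _ |>.comp
    ENNReal.summable.hasSum) (Eventually.of_forall hfin)

namespace TGFT

/-! ### The interaction -/

/-- The sum of `|T_p|²` over the modes of `s` with a given component. -/
def fiberSum (s : Finset Mode) (k : Key) (T : Mode → ℂ) : ℝ := ∑ p ∈ s with p.1 k.1 = k.2, ‖T p‖ ^ 2

/-- The interaction of the modes of `s`. -/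
def action (s : Finset Mode) (T : Mode → ℂ) : ℝ := ∑ k ∈ keys s, fiberSum s k T ^ 2

/-- The sum of `|T_p|²` over all modes with a given component. -/
def fullFiber (k : Key) (T : Mode → ℂ) : ENNReal :=
  ∑' p : Mode, if p.1 k.1 = k.2 then ENNReal.ofReal (‖T p‖ ^ 2) else 0

/-- The interaction with values in `[0, ∞]`. -/
def fullAction (T : Mode → ℂ) : ENNReal := ∑' k : Key, fullFiber k T ^ 2

@[fun_prop]
theorem measurable_fiberSum (s : Finset Mode) (k : Key) : Measurable (fiberSum s k) := by
  unfold fiberSum; fun_prop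

@[fun_prop]
theorem measurable_action (s : Finset Mode) : Measurable (action s) := by
  unfold action; fun_prop

@[fun_prop]
theorem measurable_fullFiber (k : Key) : Measurable (fullFiber k) := by
  unfold fullFiber
  refine Measurable.tsum fun p => ?_
  split_ifs <;> fun_prop

@[fun_prop]
theorem measurable_fullAction : Measurable fullAction := by
  unfold fullAction
  exact Measurable.tsum fun k => by fun_prop

theorem action_nonneg (s : Finset Mode) (T : Mode → ℂ) : 0 ≤ action s T :=
  Finset.sum_nonneg fun _ _ => sq_nonneg _

theorem mode_ext {p q : Mode} {i : Fin 3} (h : ∀ j, j ≠ i → p.1 j = q.1 j) : p = q := by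
  have hsum := p.2.trans q.2.symm
  rw [← Finset.add_sum_erase _ _ (Finset.mem_univ i),
    ← Finset.add_sum_erase _ q.1 (Finset.mem_univ i),
    Finset.sum_congr rfl fun j hj => h j (Finset.ne_of_mem_erase hj)] at hsum
  refine Subtype.ext (funext fun j => ?_)
  by_cases hj : j = i
  · subst hj; linarith
  · exact h j hj

/-- No summability is assumed: if the series diverges, both sides take the default value `0`. -/
theorem ofReal_toReal_fullFiber (k : Key) (T : Mode → ℂ) :
    (((fullFiber k T).toReal : ℝ) : ℂ) =
      ∑' p : Mode, if p.1 k.1 = k.2 then ((‖T p‖ ^ 2 : ℝ) : ℂ) else 0 := by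
  rw [fullFiber, ENNReal.tsum_toReal_eq fun p => by split_ifs <;> simp, Complex.ofReal_tsum]
  refine tsum_congr fun p => ?_
  split_ifs
  · rw [ENNReal.toReal_ofReal (by positivity)]
  · simp

/-- Two modes that agree in all components other than `i` are equal by the closure constraint, so
only the pairs `(p, p)` contribute and the matrix is diagonal. -/
theorem traceMatrix_eq (T : Mode → ℂ) (i : Fin 3) (a b : ℤ) :
    traceMatrix T i a b = if a = b then (((fullFiber (i, a) T).toReal : ℝ) : ℂ) else 0 := by
  classical
  unfold traceMatrix
  split_ifs with hab
  · subst hab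
    rw [ofReal_toReal_fullFiber, ← Function.Injective.tsum_eq
      (g := fun p : Mode => (p, p)) (fun p q h => congrArg Prod.fst h)]
    · refine tsum_congr fun p => ?_
      by_cases h : p.1 i = a
      · rw [if_pos ⟨fun _ _ => rfl, h, h⟩, if_pos h, Complex.mul_conj, Complex.normSq_eq_norm_sq]
      · rw [if_neg fun h' => h h'.2.1, if_neg h]
    · rintro ⟨p, q⟩ hpq
      have hc : (∀ j, j ≠ i → p.1 j = q.1 j) ∧ p.1 i = a ∧ q.1 i = a := by
        by_contra hc
        exact hpq (if_neg hc)
      exact ⟨p, Prod.ext rfl (mode_ext hc.1)⟩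
  · refine (tsum_congr fun pq => if_neg fun hc => hab ?_).trans tsum_zero
    rw [← hc.2.1, ← hc.2.2, mode_ext hc.1]

/-- The traces reduce to sums of squared diagonal entries. Finiteness is needed to exchange `toReal`
with the sums; it holds almost surely by the moment bounds below. -/
theorem interaction_eq {T : Mode → ℂ} (hT : fullAction T ≠ ⊤) :
    interaction T = ((fullAction T).toReal : ℂ) := by
  have h1 : ∀ i, ∑' ab : ℤ × ℤ, traceMatrix T i ab.1 ab.2 * traceMatrix T i ab.2 ab.1 =
      (((∑' a : ℤ, fullFiber (i, a) T ^ 2).toReal : ℝ) : ℂ) := by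
    intro i
    have htop : ∀ a : ℤ, fullFiber (i, a) T ^ 2 ≠ ⊤ := fun a =>
      ENNReal.ne_top_of_tsum_ne_top hT (i, a)
    rw [ENNReal.tsum_toReal_eq htop, Complex.ofReal_tsum,
      ← Function.Injective.tsum_eq (g := fun a : ℤ => (a, a)) (fun p q h => congrArg Prod.fst h)]
    · refine tsum_congr fun a => ?_
      simp only [traceMatrix_eq, if_true, ENNReal.toReal_pow]
      push_cast
      ring
    · rintro ⟨a, b⟩ hab
      by_cases h : a = b
      · exact ⟨a, Prod.ext rfl h⟩
      · exact absurd (by simp [traceMatrix_eq, h]) hab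
  rw [interaction, Finset.sum_congr rfl fun i _ => h1 i, ← Complex.ofReal_sum]
  have h2 : fullAction T = ∑ i : Fin 3, ∑' a : ℤ, fullFiber (i, a) T ^ 2 := by
    rw [fullAction, ENNReal.tsum_prod', tsum_fintype]
  rw [h2, ENNReal.toReal_sum fun i _ => ?_]
  intro h
  refine hT ?_
  rw [h2]
  exact ENNReal.sum_eq_top.2 ⟨i, Finset.mem_univ i, h⟩

/-! ### Moments of the interaction -/

theorem tsum_fiber_C₀_le {m : ℝ} (hm : 0 < m) (k : Key) :
    ∑' p : Mode, (if p.1 k.1 = k.2 then ENNReal.ofReal (C₀ m p.1) else 0) ≤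
      ENNReal.ofReal (weight m k.2 * weightSum m) := by
  rw [ENNReal.tsum_eq_iSup_sum]
  refine iSup_le fun s => ?_
  rw [← Finset.sum_filter, ← ENNReal.ofReal_sum_of_nonneg fun p _ => (C₀_pos hm _).le]
  exact ENNReal.ofReal_le_ofReal (fiberC_le hm s k)

theorem lintegral_field_normSq_pow_le {m : ℝ} (hm : 0 < m) (p : Mode) (n : ℕ) :
    ∫⁻ T, ENNReal.ofReal (‖T p‖ ^ 2) ^ n ∂(fieldMeasure m) ≤
      ENNReal.ofReal (2 * (2 * C₀ m p.1) ^ n * n.factorial) := by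
  have h := (measurePreserving_eval_infinitePi (fun p : Mode => complexGaussian (C₀ m p.1))
    p).lintegral_comp (f := fun z : ℂ => ENNReal.ofReal (‖z‖ ^ 2) ^ n) (by fun_prop)
  simp only [Function.eval] at h
  rw [fieldMeasure, h]
  exact lintegral_normSq_pow_complexGaussian_le (C₀_pos hm _) n

/-- Jensen's inequality with the weights `C₀(p)` reduces the moments of the infinite sum to those of
a single normalised `|T_p|² / C₀(p)`, which are bounded uniformly in `p`. No Wick combinatorics is
involved. -/
theorem lintegral_fullFiber_pow_le {m : ℝ} (hm : 0 < m) (k : Key) (n : ℕ) :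
    ∫⁻ T, fullFiber k T ^ (n + 1) ∂(fieldMeasure m) ≤
      ENNReal.ofReal (weight m k.2 * weightSum m) ^ (n + 1) *
        ENNReal.ofReal (2 * 2 ^ (n + 1) * (n + 1).factorial) := by
  set w : Mode → ENNReal := fun p => if p.1 k.1 = k.2 then ENNReal.ofReal (C₀ m p.1) else 0 with hw
  set M := ENNReal.ofReal (2 * 2 ^ (n + 1) * (n + 1).factorial)
  have hwy : ∀ T : Mode → ℂ, fullFiber k T =
      ∑' p, w p * (ENNReal.ofReal (‖T p‖ ^ 2) / ENNReal.ofReal (C₀ m p.1)) := by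
    intro T
    refine tsum_congr fun p => ?_
    have hC := C₀_pos hm p.1
    simp only [hw]
    split_ifs
    · rw [ENNReal.mul_div_cancel (by simpa using hC) ENNReal.ofReal_ne_top]
    · rw [zero_mul]
  have hint : ∀ p : Mode, ∫⁻ T, w p * (ENNReal.ofReal (‖T p‖ ^ 2) /
      ENNReal.ofReal (C₀ m p.1)) ^ (n + 1) ∂(fieldMeasure m) ≤ w p * M := by
    intro p
    have hC := C₀_pos hm p.1
    rw [lintegral_const_mul _ (by fun_prop)]
    gcongr
    simp_rw [ENNReal.div_eq_inv_mul, mul_pow]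
    rw [lintegral_const_mul _ (by fun_prop)]
    refine (mul_le_mul_right (lintegral_field_normSq_pow_le hm p (n + 1)) _).trans_eq ?_
    rw [← ENNReal.ofReal_inv_of_pos hC, ← ENNReal.ofReal_pow (by positivity),
      ← ENNReal.ofReal_mul (by positivity)]
    congr 1
    rw [mul_pow, inv_pow]
    field_simp
  calc ∫⁻ T, fullFiber k T ^ (n + 1) ∂(fieldMeasure m)
      ≤ ∫⁻ T, (∑' p, w p) ^ n * ∑' p, w p * (ENNReal.ofReal (‖T p‖ ^ 2) /
          ENNReal.ofReal (C₀ m p.1)) ^ (n + 1) ∂(fieldMeasure m) := by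
        refine lintegral_mono fun T => ?_
        rw [hwy]
        exact ENNReal.pow_tsum_mul_le _ _ n
    _ = (∑' p, w p) ^ n * ∑' p, ∫⁻ T, w p * (ENNReal.ofReal (‖T p‖ ^ 2) /
          ENNReal.ofReal (C₀ m p.1)) ^ (n + 1) ∂(fieldMeasure m) := by
        rw [lintegral_const_mul _ (Measurable.tsum fun p => by fun_prop),
          lintegral_tsum fun p => (Measurable.const_mul (by fun_prop) _).aemeasurable]
    _ ≤ (∑' p, w p) ^ n * ∑' p, w p * M := by
        gcongr with p
        exact hint p
    _ = (∑' p, w p) ^ (n + 1) * M := by rw [ENNReal.tsum_mul_right]; ring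
    _ ≤ _ := by
        gcongr
        exact tsum_fiber_C₀_le hm k

/-- Jensen's inequality is used a second time, over the keys, with weights `W²` where `W` bounds the
mean of the fibre sum; the total weight is `fiberBound`. Power `n` of the action uses moment `2n` of
the fibres, hence the `(2n)!`. -/
theorem lintegral_fullAction_pow_le {m : ℝ} (hm : 0 < m) (n : ℕ) :
    ∫⁻ T, fullAction T ^ n ∂(fieldMeasure m) ≤
      ENNReal.ofReal (2 * (4 * fiberBound m) ^ n * (2 * n).factorial) := by
  rcases n with _ | n
  · simp
  have hV := weightSum_pos hm
  set W : Key → ENNReal := fun k => ENNReal.ofReal (weight m k.2 * weightSum m) with hW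
  have hWpos : ∀ k, W k ≠ 0 := fun k => by
    have := mul_pos (weight_pos hm k.2) hV
    simpa [hW] using this
  have hWtop : ∀ k, W k ≠ ⊤ := fun k => ENNReal.ofReal_ne_top
  have hsumW : ∑' k, W k ^ 2 = ENNReal.ofReal (fiberBound m) := by
    have h := hasSum_weight_sq_key hm
    rw [← h.tsum_eq, ENNReal.ofReal_tsum_of_nonneg (fun k => sq_nonneg _) h.summable]
    refine tsum_congr fun k => ?_
    rw [hW, ENNReal.ofReal_pow (mul_nonneg (weight_pos hm k.2).le hV.le)]
  have hwy : ∀ T : Mode → ℂ, fullAction T = ∑' k, W k ^ 2 * (fullFiber k T / W k) ^ 2 := by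
    intro T
    refine tsum_congr fun k => ?_
    rw [← mul_pow, ENNReal.mul_div_cancel (hWpos k) (hWtop k)]
  set M := ENNReal.ofReal (2 * 2 ^ (2 * (n + 1)) * (2 * (n + 1)).factorial)
  have hint : ∀ k, ∫⁻ T, W k ^ 2 * ((fullFiber k T / W k) ^ 2) ^ (n + 1) ∂(fieldMeasure m) ≤
      W k ^ 2 * M := by
    intro k
    rw [lintegral_const_mul _ (by fun_prop)]
    gcongr
    simp_rw [ENNReal.div_eq_inv_mul, mul_pow, ← pow_mul]
    rw [lintegral_const_mul _ (by fun_prop)]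
    refine (mul_le_mul_right (lintegral_fullFiber_pow_le hm k (2 * n + 1)) _).trans_eq ?_
    rw [← mul_assoc, show 2 * n + 1 + 1 = 2 * (n + 1) by ring, ← mul_pow,
      ENNReal.inv_mul_cancel (hWpos k) (hWtop k), one_pow, one_mul]
  calc ∫⁻ T, fullAction T ^ (n + 1) ∂(fieldMeasure m)
      ≤ ∫⁻ T, (∑' k, W k ^ 2) ^ n * ∑' k, W k ^ 2 * ((fullFiber k T / W k) ^ 2) ^ (n + 1)
          ∂(fieldMeasure m) := by
        refine lintegral_mono fun T => ?_
        rw [hwy]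
        exact ENNReal.pow_tsum_mul_le _ _ n
    _ = (∑' k, W k ^ 2) ^ n * ∑' k, ∫⁻ T, W k ^ 2 * ((fullFiber k T / W k) ^ 2) ^ (n + 1)
          ∂(fieldMeasure m) := by
        rw [lintegral_const_mul _ (Measurable.tsum fun p => by fun_prop),
          lintegral_tsum fun p => by fun_prop]
    _ ≤ (∑' k, W k ^ 2) ^ n * ∑' k, W k ^ 2 * M := by
        gcongr with k
        exact hint k
    _ = (∑' k, W k ^ 2) ^ (n + 1) * M := by rw [ENNReal.tsum_mul_right]; ring
    _ = _ := by
        have hD := fiberBound_pos hm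
        rw [hsumW, ← ENNReal.ofReal_pow hD.le, ← ENNReal.ofReal_mul (by positivity)]
        congr 1
        rw [mul_pow, show (4 : ℝ) = 2 ^ 2 by norm_num, ← pow_mul]
        ring

/-- The interaction as a real number. -/
def realAction (T : Mode → ℂ) : ℝ := (fullAction T).toReal

@[fun_prop]
theorem measurable_realAction : Measurable realAction := by
  unfold realAction; fun_prop

theorem realAction_nonneg (T : Mode → ℂ) : 0 ≤ realAction T := ENNReal.toReal_nonneg

theorem ae_fullAction_ne_top {m : ℝ} (hm : 0 < m) : ∀ᵐ T ∂(fieldMeasure m), fullAction T ≠ ⊤ := by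
  have h := lintegral_fullAction_pow_le hm 1
  simp_rw [pow_one] at h
  filter_upwards [ae_lt_top measurable_fullAction (ne_top_of_le_ne_top ENNReal.ofReal_ne_top h)]
    with T hT using hT.ne

theorem ae_interaction_eq {m : ℝ} (hm : 0 < m) :
    ∀ᵐ T ∂(fieldMeasure m), interaction T = (realAction T : ℂ) := by
  filter_upwards [ae_fullAction_ne_top hm] with T hT using interaction_eq hT

theorem lintegral_realAction_pow_le {m : ℝ} (hm : 0 < m) (n : ℕ) :
    ∫⁻ T, ENNReal.ofReal (realAction T ^ n) ∂(fieldMeasure m) ≤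
      ENNReal.ofReal (2 * (4 * fiberBound m) ^ n * (2 * n).factorial) := by
  refine le_trans (lintegral_mono fun T => ?_) (lintegral_fullAction_pow_le hm n)
  rw [realAction, ← ENNReal.toReal_pow]
  exact ENNReal.ofReal_toReal_le

theorem integrable_realAction_pow {m : ℝ} (hm : 0 < m) (n : ℕ) :
    Integrable (fun T => realAction T ^ n) (fieldMeasure m) := by
  refine ⟨by fun_prop, ?_⟩
  rw [hasFiniteIntegral_iff_ofReal (ae_of_all _ fun T => pow_nonneg (realAction_nonneg T) n)]
  exact (lintegral_realAction_pow_le hm n).trans_lt ENNReal.ofReal_lt_top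

theorem integral_realAction_pow_le {m : ℝ} (hm : 0 < m) (n : ℕ) :
    ∫ T, realAction T ^ n ∂(fieldMeasure m) ≤
      2 * (4 * fiberBound m) ^ n * (2 * n).factorial := by
  have hD := fiberBound_pos hm
  rw [integral_eq_lintegral_of_nonneg_ae
    (ae_of_all _ fun T => pow_nonneg (realAction_nonneg T) n) (by fun_prop)]
  exact ENNReal.toReal_le_of_le_ofReal (by positivity) (lintegral_realAction_pow_le hm n)

theorem integrable_interaction_pow {m : ℝ} (hm : 0 < m) (n : ℕ) :
    Integrable (fun T => interaction T ^ n) (fieldMeasure m) := by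
  refine ((integrable_realAction_pow hm n).ofReal (𝕜 := ℂ)).congr ?_
  filter_upwards [ae_interaction_eq hm] with T hT
  rw [hT]; simp

/-! ### Removal of the cutoff in the interaction -/

theorem fiberSum_eq_zero {s : Finset Mode} {k : Key} (hk : k ∉ keys s) (T : Mode → ℂ) :
    fiberSum s k T = 0 := by
  rw [fiberSum, Finset.filter_eq_empty_iff.2, Finset.sum_empty]
  intro p hp h
  refine hk (Finset.mem_biUnion.2 ⟨p, hp, Finset.mem_image.2 ⟨k.1, Finset.mem_univ _, ?_⟩⟩)
  exact Prod.ext rfl h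

theorem action_eq_tsum (s : Finset Mode) (T : Mode → ℂ) :
    action s T = ∑' k, fiberSum s k T ^ 2 :=
  (tsum_eq_sum fun k hk => by rw [fiberSum_eq_zero hk]; simp).symm

theorem hasSum_fiber {k : Key} {T : Mode → ℂ} (h : fullFiber k T ≠ ⊤) :
    HasSum (fun p : Mode => if p.1 k.1 = k.2 then ‖T p‖ ^ 2 else 0) (fullFiber k T).toReal := by
  rw [fullFiber] at h ⊢
  rw [ENNReal.tsum_toReal_eq fun p => by split_ifs <;> simp]
  convert ENNReal.hasSum_toReal h using 2 with p
  split_ifs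
  · rw [ENNReal.toReal_ofReal (by positivity)]
  · simp

theorem fullFiber_ne_top {T : Mode → ℂ} (hT : fullAction T ≠ ⊤) (k : Key) : fullFiber k T ≠ ⊤ := by
  have := ENNReal.ne_top_of_tsum_ne_top hT k
  exact fun h => this (by rw [h]; simp)

theorem fiberSum_le {T : Mode → ℂ} (hT : fullAction T ≠ ⊤) (s : Finset Mode) (k : Key) :
    fiberSum s k T ≤ (fullFiber k T).toReal := by
  rw [fiberSum, Finset.sum_filter]
  exact sum_le_hasSum s (fun p _ => by split_ifs <;> positivity) (hasSum_fiber
    (fullFiber_ne_top hT k))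

theorem fiberSum_nonneg (s : Finset Mode) (k : Key) (T : Mode → ℂ) : 0 ≤ fiberSum s k T :=
  Finset.sum_nonneg fun _ _ => by positivity

theorem hasSum_realAction {T : Mode → ℂ} (hT : fullAction T ≠ ⊤) :
    HasSum (fun k => (fullFiber k T).toReal ^ 2) (realAction T) := by
  rw [realAction, fullAction, ENNReal.tsum_toReal_eq fun k => ENNReal.ne_top_of_tsum_ne_top hT k]
  simpa using ENNReal.hasSum_toReal hT

theorem action_le {T : Mode → ℂ} (hT : fullAction T ≠ ⊤) (s : Finset Mode) :
    action s T ≤ realAction T := by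
  refine le_trans (Finset.sum_le_sum fun k _ => ?_)
    (sum_le_hasSum (keys s) (fun k _ => sq_nonneg _) (hasSum_realAction hT))
  exact pow_le_pow_left₀ (fiberSum_nonneg s k T) (fiberSum_le hT s k) 2

theorem tendsto_action {T : Mode → ℂ} (hT : fullAction T ≠ ⊤) :
    Tendsto (fun s => action s T) atTop (𝓝 (realAction T)) := by
  simp_rw [action_eq_tsum]
  rw [← (hasSum_realAction hT).tsum_eq]
  refine tendsto_tsum_of_dominated_convergence (hasSum_realAction hT).summable (fun k => ?_)
    (Eventually.of_forall fun s k => ?_)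
  · refine Tendsto.pow ?_ 2
    have := hasSum_fiber (fullFiber_ne_top hT k)
    simp_rw [fiberSum, Finset.sum_filter]
    exact this
  · rw [Real.norm_of_nonneg (sq_nonneg _)]
    exact pow_le_pow_left₀ (fiberSum_nonneg s k T) (fiberSum_le hT s k) 2

end TGFT

/-! ### Identity theorem from real points and remainder of the exponential -/

/-- The identity theorem for functions that agree on the real points near a real point. -/
theorem eqOn_of_eq_real {f g : ℂ → ℂ} {U : Set ℂ} (hU : IsOpen U) (hc : IsPreconnected U)
    (hf : DifferentiableOn ℂ f U) (hg : DifferentiableOn ℂ g U) {x₀ : ℝ} (hx : (x₀ : ℂ) ∈ U)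
    (h : ∀ᶠ x : ℝ in 𝓝 x₀, f x = g x) : Set.EqOn f g U := by
  refine (hf.analyticOnNhd hU).eqOn_of_preconnected_of_frequently_eq (hg.analyticOnNhd hU) hc hx ?_
  have ht : Tendsto (fun x : ℝ => (x : ℂ)) (𝓝[≠] x₀) (𝓝[≠] (x₀ : ℂ)) := by
    refine tendsto_nhdsWithin_iff.2
      ⟨(Complex.continuous_ofReal.tendsto x₀).mono_left nhdsWithin_le_nhds, ?_⟩
    filter_upwards [self_mem_nhdsWithin] with x hx
    simpa using hx
  exact ht.frequently (h.filter_mono nhdsWithin_le_nhds).frequently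

/-- A bound of the remainder of the exponential series at negative arguments. -/
theorem norm_exp_neg_sub_sum_le {x : ℝ} (hx : 0 ≤ x) (r : ℕ) :
    ‖Complex.exp (-(x : ℂ)) - ∑ k ∈ Finset.range r, (-(x : ℂ)) ^ k / k.factorial‖ ≤
      (r + 3) * x ^ r := by
  have hn : ‖-(x : ℂ)‖ = x := by rw [norm_neg, Complex.norm_real, Real.norm_of_nonneg hx]
  rcases le_or_gt x 1 with h | h
  · have h1 := Complex.norm_exp_sub_sum_le_norm_mul_exp (-(x : ℂ)) r
    rw [hn] at h1
    refine h1.trans ?_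
    have h2 : Real.exp x ≤ 3 := (Real.exp_le_exp.2 h).trans
      (Real.exp_one_lt_d9.le.trans (by norm_num))
    have h3 : 0 ≤ x ^ r := by positivity
    have h4 : (0 : ℝ) ≤ r := r.cast_nonneg
    nlinarith
  · refine (norm_sub_le _ _).trans ?_
    have h1 : ‖Complex.exp (-(x : ℂ))‖ ≤ 1 := by
      rw [Complex.norm_exp]
      simpa using hx
    have h2 : (1 : ℝ) ≤ x ^ r := one_le_pow₀ h.le
    have h3 : ‖∑ k ∈ Finset.range r, (-(x : ℂ)) ^ k / k.factorial‖ ≤ r * x ^ r := by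
      calc _ ≤ ∑ k ∈ Finset.range r, x ^ r := by
            refine norm_sum_le_of_le _ fun k hk => ?_
            rw [norm_div, norm_pow, hn, Complex.norm_natCast]
            refine (div_le_self (by positivity) ?_).trans
              (pow_le_pow_right₀ h.le (Finset.mem_range.1 hk).le)
            exact_mod_cast Nat.one_le_iff_ne_zero.2 k.factorial_ne_zero
        _ = _ := by simp
    linarith

namespace TGFT

/-! ### Field representation of the partition function -/

/-- The Laplace transform `∫ exp (-(z² / 2) A)` of a function on fields. -/
def laplace (m : ℝ) (A : (Mode → ℂ) → ℝ) (z : ℂ) : ℂ :=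
  ∫ T, Complex.exp (-(z ^ 2 / 2 * (A T : ℂ))) ∂(fieldMeasure m)

/-- Hubbard–Stratonovich: `F` integrated over the fields first is the product of inverse factors,
and integrated over `τ` first is `exp (-(x² / 2) action)`. For real `x` it has modulus one, so
Fubini applies. -/
theorem finitePartition_eq_laplace {m : ℝ} (hm : 0 < m) (s : Finset Mode) (x : ℝ) :
    finitePartition m s x = laplace m (action s) x := by
  set F : (Key → ℝ) → (Mode → ℂ) → ℂ := fun τ T =>
    Complex.exp (Complex.I * x * ((∑ p ∈ s, ‖T p‖ ^ 2 * ∑ i, τ (i, p.1 i) : ℝ) : ℂ)) with hF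
  have h1 : ∀ τ, ∫ T, F τ T ∂(fieldMeasure m) = integrand m s x τ := by
    intro τ
    have e : ∀ T : Mode → ℂ, F τ T = ∏ p ∈ s,
        Complex.exp ((Complex.I * x * (Γ τ p.1 : ℝ)) * ((‖T p‖ ^ 2 : ℝ) : ℂ)) := by
      intro T
      rw [← Complex.exp_sum]
      refine congrArg Complex.exp ?_
      rw [Complex.ofReal_sum, Finset.mul_sum]
      refine Finset.sum_congr rfl fun p _ => ?_
      rw [Γ]; push_cast; ring
    simp_rw [e]
    rw [fieldMeasure, integral_infinitePi_prod (fun p : Mode => complexGaussian (C₀ m p.1)) s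
      (f := fun p z => Complex.exp ((Complex.I * x * (Γ τ p.1 : ℝ)) * ((‖z‖ ^ 2 : ℝ) : ℂ)))
      (fun p => by fun_prop)]
    refine Finset.prod_congr rfl fun p _ => ?_
    rw [integral_cexp_mul_normSq_complexGaussian (C₀_pos hm _) (by simp), amp]
    push_cast
    ring_nf
  have h2 : ∀ T, ∫ τ, F τ T ∂auxMeasure = Complex.exp (-((x : ℂ) ^ 2 / 2 * (action s T : ℂ))) := by
    intro T
    have e : ∀ τ : Key → ℝ, F τ T = ∏ k ∈ keys s,
        Complex.exp (Complex.I * ((x * fiberSum s k T : ℝ) : ℂ) * (τ k : ℂ)) := by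
      intro τ
      rw [← Complex.exp_sum]
      refine congrArg Complex.exp ?_
      rw [sum_modes_eq_sum_keys s (fun p => ‖T p‖ ^ 2) τ, Complex.ofReal_sum, Finset.mul_sum]
      refine Finset.sum_congr rfl fun p _ => ?_
      rw [fiberSum]; push_cast; ring
    simp_rw [e]
    rw [auxMeasure, integral_infinitePi_prod (fun _ : Key => gaussianReal 0 1) (keys s)
      (f := fun k y => Complex.exp (Complex.I * ((x * fiberSum s k T : ℝ) : ℂ) * (y : ℂ)))
      (fun p => by fun_prop)]
    simp_rw [integral_cexp_gaussianReal]
    rw [← Complex.exp_sum, action]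
    congr 1
    push_cast
    rw [Finset.mul_sum, ← Finset.sum_neg_distrib]
    exact Finset.sum_congr rfl fun _ _ => by ring
  rw [finitePartition, laplace]
  simp_rw [← h1, ← h2]
  refine integral_integral_swap (Integrable.of_bound (C := 1) ?_ (ae_of_all _ fun q => ?_))
  · refine Measurable.aestronglyMeasurable ?_
    simp only [hF, Function.uncurry_def]
    fun_prop
  · simp only [hF, Function.uncurry_def]
    rw [mul_assoc, ← Complex.ofReal_mul, mul_comm, Complex.norm_exp_ofReal_mul_I]

theorem norm_cexp_neg_le_one {z : ℂ} (hz : 0 ≤ (z ^ 2).re) {a : ℝ} (ha : 0 ≤ a) :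
    ‖Complex.exp (-(z ^ 2 / 2 * (a : ℂ)))‖ ≤ 1 := by
  rw [Complex.norm_exp, Real.exp_le_one_iff, Complex.neg_re, Complex.re_mul_ofReal,
    Complex.div_ofNat_re]
  have : 0 ≤ (z ^ 2).re / 2 * a := by positivity
  linarith

theorem isOpen_re_sq_pos : IsOpen {z : ℂ | 0 < (z ^ 2).re} :=
  isOpen_lt continuous_const (Complex.continuous_re.comp (continuous_pow 2))

theorem differentiableOn_laplace (m : ℝ) {A : (Mode → ℂ) → ℝ} (hA : Measurable A)
    (h0 : ∀ T, 0 ≤ A T) : DifferentiableOn ℂ (laplace m A) {z | 0 < (z ^ 2).re} :=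
  differentiableOn_integral_of_dominated isOpen_re_sq_pos (g := fun _ => 1)
    (f := fun T z => Complex.exp (-(z ^ 2 / 2 * (A T : ℂ))))
    (fun z _ => Measurable.aestronglyMeasurable (by fun_prop))
    (ae_of_all _ fun T => by fun_prop) (integrable_const _)
    (ae_of_all _ fun T z hz => norm_cexp_neg_le_one (le_of_lt hz) (h0 T))

theorem rootDisc_eq_ball {k : ℝ} (hk : 0 < k) :
    rootDisc k = Metric.ball ((k / 2 : ℝ) : ℂ) (k / 2) := by
  ext z
  have hk2 : 0 ≤ k / 2 := by positivity
  rw [mem_ball_iff_norm, ← sq_lt_sq₀ (norm_nonneg _) hk2, rootDisc, Set.mem_ofPred_eq,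
    Complex.sq_norm, Complex.sq_norm, Complex.normSq_apply, Complex.normSq_apply]
  simp only [Complex.sub_re, Complex.sub_im, Complex.ofReal_re, Complex.ofReal_im, sub_zero]
  constructor <;> intro h <;> nlinarith

/-- The part of the disc on which the field representation converges. -/
def innerDisc (k : ℝ) : Set ℂ := rootDisc k ∩ {z | 0 < (z ^ 2).re}

theorem isOpen_innerDisc (k : ℝ) : IsOpen (innerDisc k) :=
  (isOpen_rootDisc k).inter isOpen_re_sq_pos

/-- Since `Re z > 0` on the disc, `Re z² > 0` means `|Im z| < Re z`. The set is thus an intersection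
of convex sets, hence connected, and the identity theorem can carry the field representation from
the real points to all of it. -/
theorem innerDisc_eq {k : ℝ} (hk : 0 < k) :
    innerDisc k = Metric.ball ((k / 2 : ℝ) : ℂ) (k / 2) ∩
      ({z : ℂ | 0 < z.re - z.im} ∩ {z : ℂ | 0 < z.re + z.im}) := by
  ext z
  rw [innerDisc, ← rootDisc_eq_ball hk]
  refine and_congr_right fun hz => ?_
  have hre := re_pos_of_mem_rootDisc hk hz
  have e : (z ^ 2).re = (z.re - z.im) * (z.re + z.im) := by rw [sq, Complex.mul_re]; ring
  simp only [Set.mem_ofPred_eq, Set.mem_inter_iff, e]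
  constructor
  · intro h
    rcases mul_pos_iff.1 h with h | h
    · exact h
    · linarith [h.1, h.2]
  · exact fun h => mul_pos h.1 h.2

theorem isPreconnected_innerDisc {k : ℝ} (hk : 0 < k) : IsPreconnected (innerDisc k) := by
  rw [innerDisc_eq hk]
  refine ((convex_ball _ _).inter (Convex.inter ?_ ?_)).isPreconnected
  · exact convex_halfSpace_gt (f := fun z : ℂ => z.re - z.im)
      ⟨fun x y => by simp; ring, fun c x => by simp; ring⟩ 0
  · exact convex_halfSpace_gt (f := fun z : ℂ => z.re + z.im)
      ⟨fun x y => by simp; ring, fun c x => by simp; ring⟩ 0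

theorem center_mem_innerDisc {k : ℝ} (hk : 0 < k) : ((k / 2 : ℝ) : ℂ) ∈ innerDisc k := by
  rw [innerDisc_eq hk]
  have : 0 < k / 2 := by positivity
  exact ⟨Metric.mem_ball_self this, by simpa using hk, by simpa using hk⟩

theorem finitePartition_eqOn_laplace {m : ℝ} (hm : 0 < m) (s : Finset Mode) :
    Set.EqOn (finitePartition m s) (laplace m (action s)) (innerDisc (radius m)) :=
  eqOn_of_eq_real (isOpen_innerDisc _) (isPreconnected_innerDisc (radius_pos hm))
    ((differentiableOn_finitePartition hm s).mono Set.inter_subset_left)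
    ((differentiableOn_laplace m (measurable_action s) (action_nonneg s)).mono
      Set.inter_subset_right)
    (center_mem_innerDisc (radius_pos hm))
    (Eventually.of_forall fun x => finitePartition_eq_laplace hm s x)

/-! ### Removal of the cutoff -/

/-- The modes with `|p_i| ≤ N`. -/
def modes (N : ℕ) : Finset Mode := (cutoffModes N).subtype fun p => ∑ i, p i = 0

theorem tendsto_modes : Tendsto modes atTop atTop := by
  refine tendsto_atTop_finset_of_monotone (fun M N hMN p hp => ?_) fun p => ?_
  · simp only [modes, cutoffModes, Finset.mem_subtype, Finset.mem_filter, Finset.mem_Icc,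
      Pi.le_def] at hp ⊢
    refine ⟨⟨fun i => ?_, fun i => ?_⟩, hp.2⟩
    · have := hp.1.1 i; omega
    · have := hp.1.2 i; omega
  · refine ⟨∑ i, (p.1 i).natAbs, ?_⟩
    simp only [modes, cutoffModes, Finset.mem_subtype, Finset.mem_filter, Finset.mem_Icc,
      Pi.le_def]
    have h : ∀ i, (p.1 i).natAbs ≤ ∑ i, (p.1 i).natAbs := fun i =>
      Finset.single_le_sum (f := fun i => (p.1 i).natAbs) (fun _ _ => Nat.zero_le _)
        (Finset.mem_univ i)
    refine ⟨⟨fun i => ?_, fun i => ?_⟩, p.2⟩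
    · have := h i; omega
    · have := h i; omega

theorem tendsto_laplace {m : ℝ} (hm : 0 < m) {z : ℂ} (hz : 0 ≤ (z ^ 2).re) :
    Tendsto (fun N => laplace m (action (modes N)) z) atTop (𝓝 (laplace m realAction z)) := by
  refine tendsto_integral_of_dominated_convergence (fun _ => 1)
    (fun N => Measurable.aestronglyMeasurable (by fun_prop)) (integrable_const _)
    (fun N => ae_of_all _ fun T => norm_cexp_neg_le_one hz (action_nonneg _ T)) ?_
  filter_upwards [ae_fullAction_ne_top hm] with T hT
  have hc : Continuous fun a : ℝ => Complex.exp (-(z ^ 2 / 2 * (a : ℂ))) := by fun_prop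
  exact (hc.tendsto _).comp ((tendsto_action hT).comp tendsto_modes)

/-- Where `Re z² < 0` the field integral offers no domination. Convergence is known near the centre
of the disc only from the field representation; the uniform bound of the intermediate field
representation extends it to the whole disc by Vitali's argument. -/
theorem exists_limit_finitePartition {m : ℝ} (hm : 0 < m) :
    ∃ G : ℂ → ℂ, DifferentiableOn ℂ G (rootDisc (radius m)) ∧
      ∀ z ∈ rootDisc (radius m), Tendsto (fun N => finitePartition m (modes N) z) atTop
        (𝓝 (G z)) := by
  have hk := radius_pos hm
  have hmem := (isOpen_innerDisc (radius m)).mem_nhds (center_mem_innerDisc hk)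
  obtain ⟨r, hr, hsub⟩ := Metric.mem_nhds_iff.1 hmem
  have hb := rootDisc_eq_ball hk
  rw [hb]
  refine exists_tendsto_of_bounded_of_tendsto_ball (r := min r (radius m / 2))
    (lt_min hr (by positivity)) (min_le_right _ _)
    (fun N => hb ▸ differentiableOn_finitePartition hm (modes N))
    (fun N z hz => norm_finitePartition_le hm (modes N) (hb ▸ hz)) (laplace m realAction)
    fun z hz => ?_
  have hz' := hsub (Metric.ball_subset_ball (min_le_left _ _) hz)
  have := tendsto_laplace hm (le_of_lt hz'.2)
  exact this.congr fun N => (finitePartition_eqOn_laplace hm _ hz').symm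

/-- The partition function as a function of `z = √(2 lam)`. -/
def limitPartition (m : ℝ) (z : ℂ) : ℂ := limUnder atTop fun N => finitePartition m (modes N) z

theorem tendsto_limitPartition {m : ℝ} (hm : 0 < m) {z : ℂ} (hz : z ∈ rootDisc (radius m)) :
    Tendsto (fun N => finitePartition m (modes N) z) atTop (𝓝 (limitPartition m z)) := by
  obtain ⟨G, -, hG⟩ := exists_limit_finitePartition hm
  exact tendsto_nhds_limUnder ⟨_, hG z hz⟩

theorem differentiableOn_limitPartition {m : ℝ} (hm : 0 < m) :
    DifferentiableOn ℂ (limitPartition m) (rootDisc (radius m)) := by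
  obtain ⟨G, hd, hG⟩ := exists_limit_finitePartition hm
  exact hd.congr fun z hz => tendsto_nhds_unique (tendsto_limitPartition hm hz) (hG z hz)

theorem limitPartition_eq_laplace_of_pos {m : ℝ} (hm : 0 < m) {z : ℂ}
    (hz : z ∈ innerDisc (radius m)) : limitPartition m z = laplace m realAction z :=
  tendsto_nhds_unique (tendsto_limitPartition hm hz.1)
    ((tendsto_laplace hm (le_of_lt hz.2)).congr
      fun _ => (finitePartition_eqOn_laplace hm _ hz).symm)

/-- The boundary case `Re z² = 0` is reached by shifting `z` to the right by `1 / (n + 1)`, which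
makes `Re z²` positive because `Re z > 0`. Both sides are continuous along this sequence. -/
theorem limitPartition_eq_laplace {m : ℝ} (hm : 0 < m) {z : ℂ} (hz : z ∈ rootDisc (radius m))
    (h0 : 0 ≤ (z ^ 2).re) : limitPartition m z = laplace m realAction z := by
  have hre := re_pos_of_mem_rootDisc (radius_pos hm) hz
  have ht : Tendsto (fun n : ℕ => z + ((1 / ((n : ℝ) + 1) : ℝ) : ℂ)) atTop (𝓝 z) := by
    have h := (Complex.continuous_ofReal.tendsto 0).comp tendsto_one_div_add_atTop_nhds_zero_nat
    simpa [Function.comp_def] using tendsto_const_nhds.add h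
  have hpos : ∀ n : ℕ, 0 < ((z + ((1 / ((n : ℝ) + 1) : ℝ) : ℂ)) ^ 2).re := by
    intro n
    have hn : 0 < 1 / ((n : ℝ) + 1) := by positivity
    rw [sq, Complex.mul_re] at h0 ⊢
    simp only [Complex.add_re, Complex.add_im, Complex.ofReal_re, Complex.ofReal_im, add_zero]
    nlinarith [mul_pos hn hre]
  have h1 : Tendsto (fun n : ℕ => limitPartition m (z + ((1 / ((n : ℝ) + 1) : ℝ) : ℂ))) atTop
      (𝓝 (limitPartition m z)) :=
    ((differentiableOn_limitPartition hm).differentiableAt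
      ((isOpen_rootDisc _).mem_nhds hz)).continuousAt.tendsto.comp ht
  have h2 : Tendsto (fun n : ℕ => laplace m realAction (z + ((1 / ((n : ℝ) + 1) : ℝ) : ℂ))) atTop
      (𝓝 (laplace m realAction z)) := by
    refine tendsto_integral_of_dominated_convergence (fun _ => 1)
      (fun N => Measurable.aestronglyMeasurable (by fun_prop)) (integrable_const _)
      (fun N => ae_of_all _ fun T => norm_cexp_neg_le_one (hpos N).le (realAction_nonneg T))
      (ae_of_all _ fun T => ?_)
    have hc : Continuous fun w : ℂ => Complex.exp (-(w ^ 2 / 2 * (realAction T : ℂ))) := by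
      fun_prop
    exact (hc.tendsto z).comp ht
  refine tendsto_nhds_unique (h1.congr' ?_) h2
  filter_upwards [ht ((isOpen_rootDisc _).mem_nhds hz)] with n hn
  exact limitPartition_eq_laplace_of_pos hm ⟨hn, hpos n⟩

/-! ### Asymptotic expansion of the partition function -/

/-- The coefficients of the perturbative series of the partition function with interaction `A`. -/
def momentCoeff (m : ℝ) (A : (Mode → ℂ) → ℝ) (k : ℕ) : ℂ :=
  (-1) ^ k / (k.factorial : ℂ) * ((∫ T, A T ^ k ∂(fieldMeasure m) : ℝ) : ℂ)

theorem norm_laplace_sub_le {m : ℝ} {A : (Mode → ℂ) → ℝ} (hA : Measurable A)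
    (h0 : ∀ T, 0 ≤ A T) (hi : ∀ n, Integrable (fun T => A T ^ n) (fieldMeasure m)) (x : ℝ) (r : ℕ) :
    ‖laplace m A x - ∑ k ∈ Finset.range r, momentCoeff m A k * ((x : ℂ) ^ 2 / 2) ^ k‖ ≤
      (r + 3) * (∫ T, A T ^ r ∂(fieldMeasure m)) * (x ^ 2 / 2) ^ r := by
  have e : ∀ k, momentCoeff m A k * ((x : ℂ) ^ 2 / 2) ^ k =
      ∫ T, (-((x ^ 2 / 2 * A T : ℝ) : ℂ)) ^ k / k.factorial ∂(fieldMeasure m) := by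
    intro k
    have e1 : ∀ T, (-((x ^ 2 / 2 * A T : ℝ) : ℂ)) ^ k / k.factorial =
        ((-1) ^ k / k.factorial * ((x : ℂ) ^ 2 / 2) ^ k) * ((A T ^ k : ℝ) : ℂ) := by
      intro T
      rw [neg_pow]
      push_cast
      rw [mul_pow]
      ring
    simp_rw [e1]
    rw [integral_const_mul, integral_complex_ofReal, momentCoeff]
    ring
  have hi' : ∀ k, Integrable (fun T => (-((x ^ 2 / 2 * A T : ℝ) : ℂ)) ^ k / k.factorial)
      (fieldMeasure m) := by
    intro k
    refine (((hi k).const_mul ((-(x ^ 2 / 2)) ^ k / k.factorial)).ofReal (𝕜 := ℂ)).congr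
      (ae_of_all _ fun T => ?_)
    simp only [RCLike.ofReal_eq_complex_ofReal]
    push_cast
    rw [neg_pow, neg_pow ((x : ℂ) ^ 2 / 2 * _), mul_pow]
    ring
  have hL : laplace m A x = ∫ T, Complex.exp (-((x ^ 2 / 2 * A T : ℝ) : ℂ)) ∂(fieldMeasure m) := by
    rw [laplace]
    push_cast
    rfl
  simp_rw [e]
  rw [hL, ← integral_finsetSum _ fun k _ => hi' k, ← integral_sub _
    (integrable_finsetSum _ fun k _ => hi' k)]
  · refine (norm_integral_le_of_norm_le ((hi r).const_mul ((r + 3) * (x ^ 2 / 2) ^ r))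
      (ae_of_all _ fun T => ?_)).trans_eq ?_
    · have := norm_exp_neg_sub_sum_le (x := x ^ 2 / 2 * A T)
        (mul_nonneg (by positivity) (h0 T)) r
      refine this.trans_eq ?_
      rw [mul_pow]; ring
    · rw [integral_const_mul]; ring
  · refine Integrable.of_bound (C := 1) (Measurable.aestronglyMeasurable (by fun_prop))
      (ae_of_all _ fun T => ?_)
    rw [Complex.norm_exp, Real.exp_le_one_iff, Complex.neg_re, Complex.ofReal_re]
    have := mul_nonneg (show 0 ≤ x ^ 2 / 2 by positivity) (h0 T)
    linarith

theorem integrable_action_pow {m : ℝ} (hm : 0 < m) (s : Finset Mode) (n : ℕ) :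
    Integrable (fun T => action s T ^ n) (fieldMeasure m) := by
  refine (integrable_realAction_pow hm n).mono' (Measurable.aestronglyMeasurable (by fun_prop)) ?_
  filter_upwards [ae_fullAction_ne_top hm] with T hT
  rw [Real.norm_of_nonneg (pow_nonneg (action_nonneg s T) n)]
  exact pow_le_pow_left₀ (action_nonneg s T) (action_le hT s) n

theorem sum_range_two_mul_even (c : ℕ → ℂ) (z : ℂ) (r : ℕ) :
    ∑ n ∈ Finset.range (2 * r), (if Even n then c (n / 2) / 2 ^ (n / 2) else 0) * z ^ n =
      ∑ k ∈ Finset.range r, c k * (z ^ 2 / 2) ^ k := by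
  induction r with
  | zero => simp
  | succ r ih =>
    rw [show 2 * (r + 1) = 2 * r + 1 + 1 by ring, Finset.sum_range_succ, Finset.sum_range_succ, ih,
      Finset.sum_range_succ, if_pos (even_two_mul r), if_neg (by simp)]
    rw [Nat.mul_div_cancel_left r two_pos, div_pow, ← pow_mul]
    ring

/-- Both sequences are asymptotic expansions of the same function of real `x → 0+`, one from the
intermediate fields and one from the field representation, so they agree; in particular the odd
coefficients vanish. The orders `2 * (r + 1)` are used because the remainder bounds are available at
even orders in `z` only. -/
theorem integral_taylorCoeff_eq {m : ℝ} (hm : 0 < m) (s : Finset Mode) :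
    (fun n => ∫ τ, taylorCoeff m s n τ ∂auxMeasure) =
      fun n => if Even n then momentCoeff m (action s) (n / 2) / 2 ^ (n / 2) else 0 := by
  have hk := radius_pos hm
  refine eq_of_asymptotic_expansions (f := fun x : ℝ => finitePartition m s x) hk
    (φ := fun r => 2 * (r + 1)) (fun n => by omega) (fun r => ?_) (fun r => ?_)
  · refine ⟨remConst m * (32 / rate m) ^ (r + 1) * (r + 1).factorial, fun x h0 h1 => ?_⟩
    have hx : (x : ℂ) ∈ rootDisc (radius m) := by
      rw [rootDisc, Set.mem_ofPred_eq, Complex.norm_real, Real.norm_of_nonneg h0.le,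
        Complex.ofReal_re]
      nlinarith
    refine (norm_finitePartition_sub_le hm s hx (r + 1)).trans_eq ?_
    rw [Complex.norm_real, Real.norm_of_nonneg h0.le, ← pow_mul]
  · refine ⟨((r + 1 : ℕ) + 3) * (∫ T, action s T ^ (r + 1) ∂(fieldMeasure m)) / 2 ^ (r + 1),
      fun x h0 h1 => ?_⟩
    rw [sum_range_two_mul_even, finitePartition_eq_laplace hm]
    refine (norm_laplace_sub_le (measurable_action s) (action_nonneg s)
      (integrable_action_pow hm s) x (r + 1)).trans_eq ?_
    rw [div_pow, ← pow_mul]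
    ring

theorem tendsto_momentCoeff {m : ℝ} (hm : 0 < m) (k : ℕ) :
    Tendsto (fun N => momentCoeff m (action (modes N)) k) atTop
      (𝓝 (momentCoeff m realAction k)) := by
  refine Tendsto.const_mul _ ((Complex.continuous_ofReal.tendsto _).comp ?_)
  refine tendsto_integral_of_dominated_convergence (fun T => realAction T ^ k)
    (fun N => Measurable.aestronglyMeasurable (by fun_prop)) (integrable_realAction_pow hm k)
    (fun N => ?_) ?_
  · filter_upwards [ae_fullAction_ne_top hm] with T hT
    rw [Real.norm_of_nonneg (pow_nonneg (action_nonneg _ T) k)]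
    exact pow_le_pow_left₀ (action_nonneg _ T) (action_le hT _) k
  · filter_upwards [ae_fullAction_ne_top hm] with T hT
    exact ((tendsto_action hT).comp tendsto_modes).pow k

/-- The cutoff bounds have constants independent of the modes, and the coefficients converge with
the cutoff, so the estimate passes to the limit. -/
theorem norm_limitPartition_sub_le {m : ℝ} (hm : 0 < m) {z : ℂ} (hz : z ∈ rootDisc (radius m))
    (r : ℕ) :
    ‖limitPartition m z - ∑ k ∈ Finset.range r, momentCoeff m realAction k * (z ^ 2 / 2) ^ k‖ ≤
      remConst m * (32 / rate m) ^ r * r.factorial * (‖z‖ ^ 2) ^ r := by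
  refine le_of_tendsto (((tendsto_limitPartition hm hz).sub (tendsto_finsetSum _ fun k _ =>
    (tendsto_momentCoeff hm k).mul_const _)).norm) (Eventually.of_forall fun N => ?_)
  have h := norm_finitePartition_sub_le hm (modes N) hz r
  have e := integral_taylorCoeff_eq hm (modes N)
  rw [Finset.sum_congr rfl fun n _ => congrArg (· * z ^ n) (congrFun e n),
    sum_range_two_mul_even] at h
  exact h

end TGFT

/-! ### Functions with a Gevrey expansion of order one -/

/-- The function `f` has on `U` the asymptotic expansion `a`, with remainders bounded by
`A Bʳ r! |z|ʳ`. -/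
structure HasGevreyExpansion (U : Set ℂ) (A B : ℝ) (a : PowerSeries ℂ) (f : ℂ → ℂ) : Prop where
  coeff_le : ∀ n, ‖a.coeff n‖ ≤ A * B ^ n * n.factorial
  remainder_le : ∀ r, ∀ z ∈ U, ‖f z - ∑ k ∈ Finset.range r, a.coeff k * z ^ k‖ ≤
    A * B ^ r * r.factorial * ‖z‖ ^ r

theorem factorial_mul_factorial_succ_le {i : ℕ} (hi : 1 ≤ i) (j : ℕ) :
    i.factorial * (j + 1).factorial ≤ (i + j).factorial := by
  induction j with
  | zero => simp
  | succ j ih =>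
    rw [Nat.factorial_succ (j + 1), ← add_assoc, Nat.factorial_succ (i + j)]
    calc i.factorial * ((j + 1 + 1) * (j + 1).factorial)
        = (j + 1 + 1) * (i.factorial * (j + 1).factorial) := by ring
      _ ≤ (i + j + 1) * (i + j).factorial := Nat.mul_le_mul (by omega) ih

/-- The two end terms are `n!` each. Each of the `n - 1` middle terms is at most `(n - 1)!`, so
together they add at most one more `n!`. -/
theorem sum_factorial_mul_factorial_le (n : ℕ) :
    ∑ i ∈ Finset.range (n + 1), i.factorial * (n - i).factorial ≤ 3 * n.factorial := by
  rcases n with _ | n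
  · simp
  rw [Finset.sum_range_succ, Finset.sum_range_succ']
  have h : ∑ k ∈ Finset.range n, (k + 1).factorial * (n + 1 - (k + 1)).factorial ≤
      n * n.factorial := by
    calc _ ≤ ∑ k ∈ Finset.range n, n.factorial := by
          refine Finset.sum_le_sum fun k hk => ?_
          have hk' := Finset.mem_range.1 hk
          obtain ⟨j, rfl⟩ : ∃ j, n = k + 1 + j := ⟨n - (k + 1), by omega⟩
          have := factorial_mul_factorial_succ_le (i := k + 1) (by omega) j
          rwa [show k + 1 + j + 1 - (k + 1) = j + 1 by omega]
      _ = n * n.factorial := by simp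
  have e : (n + 1).factorial = (n + 1) * n.factorial := Nat.factorial_succ n
  simp only [Nat.factorial_zero, one_mul, Nat.sub_self, mul_one, Nat.sub_zero]
  have : 0 ≤ n.factorial := Nat.zero_le _
  nlinarith

/-- Grouping the truncated Cauchy product by the index of `b` leaves truncations of `a` at the
orders `r - l`, the form in which the remainder bounds of `f` can be inserted. -/
theorem sum_range_coeff_mul (a b : PowerSeries ℂ) (z : ℂ) (r : ℕ) :
    ∑ n ∈ Finset.range r, (a * b).coeff n * z ^ n =
      ∑ l ∈ Finset.range r, b.coeff l * z ^ l *
        ∑ k ∈ Finset.range (r - l), a.coeff k * z ^ k := by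
  induction r with
  | zero => simp
  | succ r ih =>
    have h : ∑ l ∈ Finset.range (r + 1), b.coeff l * z ^ l *
        ∑ k ∈ Finset.range (r + 1 - l), a.coeff k * z ^ k =
        ∑ l ∈ Finset.range (r + 1), (b.coeff l * z ^ l *
          ∑ k ∈ Finset.range (r - l), a.coeff k * z ^ k +
          b.coeff l * a.coeff (r - l) * z ^ r) := by
      refine Finset.sum_congr rfl fun l hl => ?_
      have hl' := Finset.mem_range.1 hl
      have e : z ^ r = z ^ l * z ^ (r - l) := by rw [← pow_add]; congr 1; omega
      rw [show r + 1 - l = (r - l) + 1 by omega, Finset.sum_range_succ, e]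
      ring
    rw [h, Finset.sum_add_distrib, Finset.sum_range_succ _ r, ih, ← Finset.sum_mul,
      mul_comm a b, Finset.sum_range_succ _ r, PowerSeries.coeff_mul,
      Finset.Nat.sum_antidiagonal_eq_sum_range_succ_mk]
    simp

namespace HasGevreyExpansion

variable {U : Set ℂ} {A₁ A₂ B : ℝ} {a b : PowerSeries ℂ} {f g : ℂ → ℂ}

/-- The remainder of the product is `f` times the remainder of `g`, plus the terms `b_l zˡ` times
the remainder of `f` of order `r - l`; these give `1 + 3` in the constant. What matters is that `B`
is unchanged, so that powers of `f` cost a geometric factor in `A` only. -/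
theorem mul (hB : 0 ≤ B) (hf : HasGevreyExpansion U A₁ B a f)
    (hg : HasGevreyExpansion U A₂ B b g) (hA₁ : 0 ≤ A₁) (hA₂ : 0 ≤ A₂) :
    HasGevreyExpansion U (4 * A₁ * A₂) B (a * b) (fun z => f z * g z) := by
  have hfact : ∀ n : ℕ, ∑ i ∈ Finset.range (n + 1), ((i.factorial : ℝ) * (n - i).factorial) ≤
      3 * n.factorial := fun n => by exact_mod_cast sum_factorial_mul_factorial_le n
  constructor
  · intro n
    rw [PowerSeries.coeff_mul, Finset.Nat.sum_antidiagonal_eq_sum_range_succ_mk]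
    calc _ ≤ ∑ i ∈ Finset.range (n + 1), A₁ * A₂ * B ^ n * (i.factorial * (n - i).factorial) := by
          refine norm_sum_le_of_le _ fun i hi => ?_
          have hi' := Finset.mem_range.1 hi
          have e : B ^ n = B ^ i * B ^ (n - i) := by rw [← pow_add]; congr 1; omega
          rw [norm_mul]
          calc _ ≤ (A₁ * B ^ i * i.factorial) * (A₂ * B ^ (n - i) * (n - i).factorial) :=
                mul_le_mul (hf.coeff_le i) (hg.coeff_le (n - i)) (norm_nonneg _) (by positivity)
            _ = _ := by rw [e]; ring
      _ ≤ A₁ * A₂ * B ^ n * (3 * n.factorial) := by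
          rw [← Finset.mul_sum]
          gcongr
          exact hfact n
      _ ≤ _ := by
          have : 0 ≤ A₁ * A₂ * B ^ n * n.factorial := by positivity
          nlinarith
  · intro r z hz
    have e : f z * g z - ∑ n ∈ Finset.range r, (a * b).coeff n * z ^ n =
        f z * (g z - ∑ k ∈ Finset.range r, b.coeff k * z ^ k) +
        ∑ l ∈ Finset.range r, b.coeff l * z ^ l *
          (f z - ∑ k ∈ Finset.range (r - l), a.coeff k * z ^ k) := by
      rw [sum_range_coeff_mul]
      simp_rw [mul_sub, Finset.sum_sub_distrib, ← Finset.sum_mul]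
      ring
    have h0 : ‖f z‖ ≤ A₁ := by simpa using hf.remainder_le 0 z hz
    rw [e]
    calc _ ≤ A₁ * (A₂ * B ^ r * r.factorial * ‖z‖ ^ r) + ∑ l ∈ Finset.range (r + 1),
          A₁ * A₂ * B ^ r * ‖z‖ ^ r * (l.factorial * (r - l).factorial) := by
          refine (norm_add_le _ _).trans (add_le_add ?_ ?_)
          · rw [norm_mul]
            exact mul_le_mul h0 (hg.remainder_le r z hz) (norm_nonneg _) hA₁
          · refine (norm_sum_le_of_le _ fun l hl => ?_).trans
              (Finset.sum_le_sum_of_subset_of_nonneg (Finset.range_mono (Nat.le_succ r))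
                fun l _ _ => by positivity)
            have hl' := Finset.mem_range.1 hl
            have e1 : B ^ r = B ^ l * B ^ (r - l) := by rw [← pow_add]; congr 1; omega
            have e2 : ‖z‖ ^ r = ‖z‖ ^ l * ‖z‖ ^ (r - l) := by rw [← pow_add]; congr 1; omega
            rw [norm_mul, norm_mul, norm_pow]
            calc _ ≤ (A₂ * B ^ l * l.factorial * ‖z‖ ^ l) *
                  (A₁ * B ^ (r - l) * (r - l).factorial * ‖z‖ ^ (r - l)) := by
                  refine mul_le_mul ?_ (hf.remainder_le (r - l) z hz) (norm_nonneg _)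
                    (by positivity)
                  exact mul_le_mul_of_nonneg_right (hg.coeff_le l) (by positivity)
              _ = _ := by rw [e1, e2]; ring
      _ ≤ A₁ * (A₂ * B ^ r * r.factorial * ‖z‖ ^ r) +
          A₁ * A₂ * B ^ r * ‖z‖ ^ r * (3 * r.factorial) := by
          rw [← Finset.mul_sum]
          gcongr
          exact hfact r
      _ = _ := by ring

theorem powSucc {A : ℝ} (hA : 0 ≤ A) (hB : 0 ≤ B) (hf : HasGevreyExpansion U A B a f) (j : ℕ) :
    HasGevreyExpansion U (A * (4 * A) ^ j) B (a ^ (j + 1)) (fun z => f z ^ (j + 1)) := by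
  induction j with
  | zero => simpa using hf
  | succ j ih =>
    have := ih.mul hB hf (by positivity) hA
    convert this using 1
    · ring
    · exact pow_succ _ _
    · exact funext fun z => pow_succ _ _

/-- The logarithm of a function with a Gevrey expansion. -/
theorem norm_log_sub_le {A : ℝ} (hA : 0 ≤ A) (hA8 : A ≤ 1 / 8) (hB : 0 ≤ B)
    (hf : HasGevreyExpansion U A B a f) (ha : a.constantCoeff = 0) (r : ℕ) {z : ℂ} (hz : z ∈ U) :
    ‖Complex.log (1 + f z) - ∑ k ∈ Finset.range r, (∑ j ∈ Finset.Icc 1 k,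
        (-1) ^ (j + 1) / (j : ℂ) * (a ^ j).coeff k) * z ^ k‖ ≤
      4 * A * B ^ r * r.factorial * ‖z‖ ^ r := by
  have h0 : ‖f z‖ ≤ A := by simpa using hf.remainder_le 0 z hz
  have h1 := Complex.hasSum_taylorSeries_log (z := f z) (by linarith)
  -- For each `k` only `1 ≤ j ≤ k` contribute: `aʲ` has order at least `j`, and the term `j = 0`
  -- vanishes because division by zero gives `0`.
  have h2 : HasSum (fun j : ℕ => ∑ k ∈ Finset.range r,
      (-1) ^ (j + 1) / (j : ℂ) * (a ^ j).coeff k * z ^ k)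
      (∑ k ∈ Finset.range r, (∑ j ∈ Finset.Icc 1 k,
        (-1) ^ (j + 1) / (j : ℂ) * (a ^ j).coeff k) * z ^ k) := by
    refine hasSum_sum fun k _ => HasSum.mul_right _ ?_
    refine hasSum_sum_of_ne_finset_zero fun j hj => ?_
    rw [Finset.mem_Icc, not_and_or, not_le, not_le] at hj
    rcases hj with hj | hj
    · have : j = 0 := by omega
      simp [this]
    · rw [PowerSeries.coeff_of_lt_order, mul_zero]
      refine lt_of_lt_of_le (by exact_mod_cast hj) (PowerSeries.le_order_pow_of_constantCoeff_eq_zero j ha)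
  have h3 := h1.sub h2
  have hK : 0 ≤ B ^ r * r.factorial * ‖z‖ ^ r := by positivity
  have hg : HasSum (fun j : ℕ => 2 * A * (B ^ r * r.factorial * ‖z‖ ^ r) * (1 / 2 : ℝ) ^ j)
      (2 * A * (B ^ r * r.factorial * ‖z‖ ^ r) * 2) := hasSum_geometric_two.mul_left _
  rw [← h3.tsum_eq]
  refine (tsum_of_norm_bounded hg fun j => ?_).trans_eq (by ring)
  rcases j with _ | j
  · simp
    positivity
  have e : (-1) ^ (j + 1 + 1) * f z ^ (j + 1) / ((j + 1 : ℕ) : ℂ) - ∑ k ∈ Finset.range r,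
      (-1) ^ (j + 1 + 1) / ((j + 1 : ℕ) : ℂ) * (a ^ (j + 1)).coeff k * z ^ k =
      (-1) ^ (j + 1 + 1) / ((j + 1 : ℕ) : ℂ) *
        (f z ^ (j + 1) - ∑ k ∈ Finset.range r, (a ^ (j + 1)).coeff k * z ^ k) := by
    rw [mul_sub, Finset.mul_sum]
    simp_rw [mul_assoc]
    ring
  rw [e, norm_mul]
  have h4 : ‖(-1) ^ (j + 1 + 1) / ((j + 1 : ℕ) : ℂ)‖ ≤ 1 := by
    rw [norm_div, norm_pow, norm_neg, norm_one, one_pow, Complex.norm_natCast]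
    refine div_le_one_of_le₀ ?_ (by positivity)
    push_cast
    linarith [j.cast_nonneg (α := ℝ)]
  calc _ ≤ 1 * (A * (4 * A) ^ j * B ^ r * r.factorial * ‖z‖ ^ r) :=
        mul_le_mul h4 ((hf.powSucc hA hB j).remainder_le r z hz) (norm_nonneg _) zero_le_one
    _ = A * (B ^ r * r.factorial * ‖z‖ ^ r) * (4 * A) ^ j := by ring
    -- The condition `A ≤ 1/8` makes `4 A ≤ 1/2`, so the bounds of the powers form a convergent
    -- geometric series.
    _ ≤ A * (B ^ r * r.factorial * ‖z‖ ^ r) * (1 / 2) ^ j := by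
        gcongr
        linarith
    _ = _ := by ring

end HasGevreyExpansion

namespace TGFT

/-! ### The cardioid -/

theorem cos_half_arg_pos {κ : ℝ} {lam : ℂ} (h : lam ∈ cardioid κ) :
    0 < Real.cos (lam.arg / 2) := by
  have h0 : 0 ≤ Real.cos (lam.arg / 2) := by
    have h1 := Complex.neg_pi_lt_arg lam
    have h2 := Complex.arg_le_pi lam
    exact Real.cos_nonneg_of_mem_Icc ⟨by linarith, by linarith⟩
  refine lt_of_le_of_ne h0 fun h1 => ?_
  have h2 := h.2
  rw [← h1] at h2
  have := norm_nonneg lam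
  simp at h2
  linarith

theorem arg_ne_pi_of_mem_cardioid {κ : ℝ} {lam : ℂ} (h : lam ∈ cardioid κ) : lam.arg ≠ Real.pi := by
  intro h1
  have h2 := cos_half_arg_pos h
  rw [h1, Real.cos_pi_div_two] at h2
  exact lt_irrefl _ h2

theorem mem_slitPlane_of_mem_cardioid {κ : ℝ} {lam : ℂ} (h : lam ∈ cardioid κ) :
    lam ∈ Complex.slitPlane :=
  Complex.mem_slitPlane_iff_arg.2 ⟨arg_ne_pi_of_mem_cardioid h, h.1⟩

theorem isOpen_cardioid (κ : ℝ) : IsOpen (cardioid κ) := by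
  rw [isOpen_iff_mem_nhds]
  intro lam h
  have hc : ContinuousAt (fun z : ℂ => κ * Real.cos (z.arg / 2) ^ 2 - ‖z‖) lam := by
    have := Complex.continuousAt_arg (mem_slitPlane_of_mem_cardioid h)
    fun_prop
  filter_upwards [isOpen_ne.mem_nhds h.1, hc.eventually_const_lt (sub_pos.2 h.2)] with z h1 h2
  exact ⟨h1, sub_pos.1 h2⟩

theorem cardioid_mono {κ κ' : ℝ} (h : κ ≤ κ') : cardioid κ ⊆ cardioid κ' := fun _ hz =>
  ⟨hz.1, hz.2.trans_le (by gcongr)⟩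

theorem norm_lt_of_mem_cardioid {κ : ℝ} {lam : ℂ} (hκ : 0 ≤ κ) (h : lam ∈ cardioid κ) :
    ‖lam‖ < κ := by
  refine h.2.trans_le ?_
  nlinarith [Real.cos_sq_le_one (lam.arg / 2)]

theorem ofReal_mem_cardioid {κ x : ℝ} (h0 : 0 < x) (h1 : x < κ) : (x : ℂ) ∈ cardioid κ := by
  refine ⟨by exact_mod_cast h0.ne', ?_⟩
  rw [Complex.arg_ofReal_of_nonneg h0.le, Complex.norm_real, Real.norm_of_nonneg h0.le]
  simpa using h1

/-- The square root `√(2 lam)`. -/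
def root (lam : ℂ) : ℂ := (2 * lam) ^ (1 / 2 : ℂ)

theorem root_sq (lam : ℂ) : root lam ^ 2 = 2 * lam := by
  rw [root, ← Complex.cpow_nat_mul]
  norm_num

theorem norm_root_sq (lam : ℂ) : ‖root lam‖ ^ 2 = 2 * ‖lam‖ := by
  rw [← norm_pow, root_sq, norm_mul]
  norm_num

theorem root_re {lam : ℂ} (h : lam ≠ 0) :
    (root lam).re = ‖root lam‖ * Real.cos (lam.arg / 2) := by
  have h2 : 2 * lam ≠ 0 := mul_ne_zero two_ne_zero h
  have him : (Complex.log (2 * lam) * (1 / 2)).im = lam.arg / 2 := by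
    have : Complex.log (2 * lam) * (1 / 2) = Complex.log (2 * lam) / 2 := by ring
    rw [this, Complex.div_ofNat_im, Complex.log_im]
    have := Complex.arg_real_mul lam (show (0 : ℝ) < 2 by norm_num)
    push_cast at this
    rw [this]
  rw [root, Complex.cpow_def_of_ne_zero h2, Complex.exp_re, Complex.norm_exp, him]

/-- The cardioid condition reads `|z| < k cos (φ / 2)` for `z = √(2 lam)`, and `φ / 2` is the
argument of `z`; multiplied by `|z|` it becomes `|z|² < k Re z`. -/
theorem root_mem_rootDisc {k : ℝ} (hk : 0 < k) {lam : ℂ} (h : lam ∈ cardioid (k ^ 2 / 2)) :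
    root lam ∈ rootDisc k := by
  have hc := cos_half_arg_pos h
  have h1 := norm_root_sq lam
  have h2 := h.2
  set c := Real.cos (lam.arg / 2)
  have hn : 0 < ‖root lam‖ := by
    have h3 : 0 < ‖lam‖ := norm_pos_iff.2 h.1
    refine lt_of_le_of_ne (norm_nonneg _) fun h4 => ?_
    rw [← h4] at h1
    norm_num at h1
    exact h.1 h1
  rw [rootDisc, Set.mem_ofPred_eq, root_re h.1]
  have h4 : ‖root lam‖ < k * c := by
    refine (sq_lt_sq₀ hn.le (by positivity)).1 ?_
    rw [h1, mul_pow]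
    linarith
  nlinarith

theorem differentiableAt_root {lam : ℂ} (h : lam ∈ Complex.slitPlane) :
    DifferentiableAt ℂ root lam := by
  have : 2 * lam ∈ Complex.slitPlane := by
    rw [Complex.mem_slitPlane_iff] at h ⊢
    simpa using h
  unfold root
  exact DifferentiableAt.cpow (by fun_prop) (by fun_prop) this

/-! ### The partition function on the cardioid -/

/-- The size of the cardioid on which the partition function is controlled. -/
def cardioidSize (m : ℝ) : ℝ := radius m ^ 2 / 2

theorem cardioidSize_pos {m : ℝ} (hm : 0 < m) : 0 < cardioidSize m := by
  have := radius_pos hm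
  unfold cardioidSize
  positivity

/-- Only `exp (-log w) = w⁻¹` is used, valid for every nonzero factor, so the branch of the
logarithm in the loop vertex plays no role. -/
theorem cutoffPartitionFunction_eq {m : ℝ} (hm : 0 < m) (N : ℕ) {lam : ℂ}
    (h : lam ∈ cardioid (cardioidSize m)) :
    cutoffPartitionFunction m N lam = finitePartition m (modes N) (root lam) := by
  have hre := re_pos_of_mem_rootDisc (radius_pos hm) (root_mem_rootDisc (radius_pos hm) h)
  rw [cutoffPartitionFunction, finitePartition]
  congr 1
  funext τ
  have e := Finset.prod_subtype_of_mem (s := cutoffModes N) (p := fun p => ∑ i, p i = 0)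
    (fun p => Complex.exp (-Complex.log
      (1 - Complex.I * (2 * lam) ^ (1 / 2 : ℂ) * ((C₀ m p * Γ τ p : ℝ) : ℂ))))
    fun p hp => (Finset.mem_filter.1 hp).2
  rw [loopVertex, ← Finset.sum_neg_distrib, Complex.exp_sum, integrand, modes, ← e]
  refine Finset.prod_congr rfl fun p _ => ?_
  rw [Complex.exp_neg]
  congr 1
  exact Complex.exp_log (factor_ne_zero_of_re_pos hre _)

theorem partitionFunction_eq {m : ℝ} (hm : 0 < m) {lam : ℂ}
    (h : lam ∈ cardioid (cardioidSize m)) :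
    partitionFunction m lam = limitPartition m (root lam) := by
  rw [partitionFunction, limitPartition]
  simp_rw [fun N => cutoffPartitionFunction_eq hm N h]

theorem tendsto_partitionFunction {m : ℝ} (hm : 0 < m) {lam : ℂ}
    (h : lam ∈ cardioid (cardioidSize m)) :
    Tendsto (fun N : ℕ => cutoffPartitionFunction m N lam) atTop
      (𝓝 (partitionFunction m lam)) := by
  rw [partitionFunction_eq hm h]
  exact (tendsto_limitPartition hm (root_mem_rootDisc (radius_pos hm) h)).congr
    fun N => (cutoffPartitionFunction_eq hm N h).symm

theorem differentiableOn_partitionFunction {m : ℝ} (hm : 0 < m) :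
    DifferentiableOn ℂ (partitionFunction m) (cardioid (cardioidSize m)) := by
  have h : DifferentiableOn ℂ (fun lam => limitPartition m (root lam))
      (cardioid (cardioidSize m)) :=
    (differentiableOn_limitPartition hm).comp
      (fun lam h => (differentiableAt_root
        (mem_slitPlane_of_mem_cardioid h)).differentiableWithinAt)
      fun lam h => root_mem_rootDisc (radius_pos hm) h
  exact h.congr fun lam h => partitionFunction_eq hm h

theorem partitionFunction_eq_integral_realAction {m : ℝ} (hm : 0 < m) {lam : ℂ}
    (h : lam ∈ cardioid (cardioidSize m)) (h0 : 0 ≤ lam.re) :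
    partitionFunction m lam = ∫ T, Complex.exp (-(lam * (realAction T : ℂ))) ∂(fieldMeasure m) := by
  rw [partitionFunction_eq hm h, limitPartition_eq_laplace hm
    (root_mem_rootDisc (radius_pos hm) h) (by rw [root_sq]; simpa using h0), laplace, root_sq]
  simp

theorem partitionFunction_eq_integral {m : ℝ} (hm : 0 < m) {lam : ℂ}
    (h : lam ∈ cardioid (cardioidSize m)) (h0 : 0 ≤ lam.re) :
    partitionFunction m lam = ∫ T, Complex.exp (-(lam * interaction T)) ∂(fieldMeasure m) := by
  rw [partitionFunction_eq_integral_realAction hm h h0]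
  refine integral_congr_ae ?_
  filter_upwards [ae_interaction_eq hm] with T hT
  rw [hT]

theorem coeff_partitionSeries {m : ℝ} (hm : 0 < m) (k : ℕ) :
    (partitionSeries m).coeff k = momentCoeff m realAction k := by
  rw [partitionSeries, PowerSeries.coeff_mk, momentCoeff, ← integral_complex_ofReal]
  congr 1
  refine integral_congr_ae ?_
  filter_upwards [ae_interaction_eq hm] with T hT
  rw [hT]; push_cast; rfl

theorem remConst_pos (m : ℝ) : 0 < remConst m := by
  unfold remConst; positivity

theorem norm_partitionFunction_sub_le {m : ℝ} (hm : 0 < m) {lam : ℂ}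
    (h : lam ∈ cardioid (cardioidSize m)) (r : ℕ) :
    ‖partitionFunction m lam - ∑ k ∈ Finset.range r, (partitionSeries m).coeff k * lam ^ k‖ ≤
      remConst m * (64 / rate m) ^ r * r.factorial * ‖lam‖ ^ r := by
  have h1 := norm_limitPartition_sub_le hm (root_mem_rootDisc (radius_pos hm) h) r
  rw [norm_root_sq, root_sq, mul_div_cancel_left₀ _ (two_ne_zero' ℂ)] at h1
  rw [partitionFunction_eq hm h]
  simp_rw [coeff_partitionSeries hm]
  refine h1.trans_eq ?_
  rw [mul_pow, show (64 / rate m) = 32 / rate m * 2 by ring, mul_pow]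
  ring

/-- The term of order `n` is the difference of the remainders of orders `n` and `n + 1`, evaluated
at a small real point. -/
theorem norm_coeff_partitionSeries_le {m : ℝ} (hm : 0 < m) (n : ℕ) :
    ‖(partitionSeries m).coeff n‖ ≤ 2 * remConst m * (64 / rate m) ^ n * n.factorial := by
  have hκ := cardioidSize_pos hm
  have hr := rate_pos hm
  have hA := remConst_pos m
  set B := 64 / rate m with hB
  have hB0 : 0 < B := by positivity
  -- With `B (n + 1) x ≤ 1` the bound of the remainder of order `n + 1` does not exceed that of
  -- order `n`; this gives the factor `2`.
  obtain ⟨x, hx0, hx1⟩ := exists_between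
    (show 0 < min (cardioidSize m) (1 / (B * (n + 1))) from lt_min hκ (by positivity))
  have hmem := ofReal_mem_cardioid hx0 (hx1.trans_le (min_le_left _ _))
  have hx2 : B * (n + 1) * x ≤ 1 := by
    have := hx1.le.trans (min_le_right _ _)
    rwa [le_div_iff₀ (by positivity), mul_comm] at this
  have h1 := norm_partitionFunction_sub_le hm hmem n
  have h2 := norm_partitionFunction_sub_le hm hmem (n + 1)
  rw [Finset.sum_range_succ] at h2
  have hx : ‖(x : ℂ)‖ = x := by rw [Complex.norm_real, Real.norm_of_nonneg hx0.le]
  rw [hx, ← hB] at h1 h2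
  set R := partitionFunction m x - ∑ k ∈ Finset.range n, (partitionSeries m).coeff k * (x : ℂ) ^ k
  have h3 : (partitionSeries m).coeff n * (x : ℂ) ^ n = R - (partitionFunction m x -
      (∑ k ∈ Finset.range n, (partitionSeries m).coeff k * (x : ℂ) ^ k +
        (partitionSeries m).coeff n * (x : ℂ) ^ n)) := by ring
  have h4 : ‖(partitionSeries m).coeff n‖ * x ^ n ≤
      2 * remConst m * B ^ n * n.factorial * x ^ n := by
    calc _ = ‖(partitionSeries m).coeff n * (x : ℂ) ^ n‖ := by rw [norm_mul, norm_pow, hx]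
      _ ≤ remConst m * B ^ n * n.factorial * x ^ n +
          remConst m * B ^ (n + 1) * (n + 1).factorial * x ^ (n + 1) := by
          rw [h3]
          exact (norm_sub_le _ _).trans (add_le_add h1 h2)
      _ = remConst m * B ^ n * n.factorial * x ^ n * (1 + B * (n + 1) * x) := by
          rw [Nat.factorial_succ]; push_cast; ring
      _ ≤ remConst m * B ^ n * n.factorial * x ^ n * (1 + 1) := by gcongr
      _ = _ := by ring
  exact le_of_mul_le_mul_right h4 (by positivity)

theorem constantCoeff_partitionSeries (m : ℝ) : (partitionSeries m).coeff 0 = 1 := by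
  simp [partitionSeries]

/-- The growth rate of the remainders of the free energy. -/
def growth (m : ℝ) : ℝ := (16 * remConst m + 1) * (64 / rate m)

/-- The size of the cardioid on which the free energy is controlled. -/
def freeSize (m : ℝ) : ℝ := min (cardioidSize m) (1 / (8 * (remConst m * (64 / rate m))))

theorem growth_pos {m : ℝ} (hm : 0 < m) : 0 < growth m := by
  have := rate_pos hm
  have := remConst_pos m
  unfold growth
  positivity

theorem freeSize_pos {m : ℝ} (hm : 0 < m) : 0 < freeSize m := by
  have := rate_pos hm
  have := remConst_pos m
  exact lt_min (cardioidSize_pos hm) (by positivity)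

theorem hasGevreyExpansion_partitionFunction {m : ℝ} (hm : 0 < m) :
    HasGevreyExpansion (cardioid (freeSize m)) (1 / 8) (growth m) (partitionSeries m - 1)
      (fun lam => partitionFunction m lam - 1) := by
  have hr := rate_pos hm
  have hA := remConst_pos m
  have hG := growth_pos hm
  set A := remConst m with hAdef
  -- At positive orders one factor `16 A + 1` of `growth` is spent to reduce the constant from `2 A`
  -- to `1/8`, as `2 A ≤ (16 A + 1) / 8`.
  have hscale : ∀ n : ℕ, 2 * A * (64 / rate m) ^ (n + 1) ≤ 1 / 8 * growth m ^ (n + 1) := by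
    intro n
    rw [growth, ← hAdef, mul_pow, ← mul_assoc]
    have h1 : (1 : ℝ) ≤ (16 * A + 1) ^ n := one_le_pow₀ (by linarith)
    refine mul_le_mul_of_nonneg_right ?_ (by positivity)
    rw [pow_succ]
    nlinarith
  have hc : ∀ n : ℕ, (partitionSeries m - 1).coeff (n + 1) = (partitionSeries m).coeff (n + 1) :=
    fun n => by simp [PowerSeries.coeff_one]
  have hc0 : (partitionSeries m - 1).coeff 0 = 0 := by
    rw [map_sub, constantCoeff_partitionSeries]; simp
  constructor
  · rintro (_ | n)
    · rw [hc0]; simp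
    · rw [hc]
      exact (norm_coeff_partitionSeries_le hm (n + 1)).trans
        (mul_le_mul_of_nonneg_right (hscale n) (by positivity))
  · intro r lam h
    have h' := cardioid_mono (min_le_left _ _) h
    rcases r with _ | r
    -- At order `0` no power of `growth` is available; the bound `1/8` comes from the first-order
    -- remainder and the second entry of the minimum in `freeSize`.
    · have h1 := norm_partitionFunction_sub_le hm h' 1
      have h2 := norm_lt_of_mem_cardioid (freeSize_pos hm).le h
      have h3 : ‖lam‖ ≤ 1 / (8 * (A * (64 / rate m))) := h2.le.trans (min_le_right _ _)
      rw [le_div_iff₀ (by positivity)] at h3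
      rw [Finset.sum_range_one, constantCoeff_partitionSeries] at h1
      simp only [pow_zero, mul_one, pow_one, Nat.factorial_one, Nat.cast_one] at h1
      simp only [Finset.range_zero, Finset.sum_empty, sub_zero, pow_zero, mul_one,
        Nat.factorial_zero, Nat.cast_one]
      linarith
    · have e : partitionFunction m lam - 1 -
          ∑ k ∈ Finset.range (r + 1), (partitionSeries m - 1).coeff k * lam ^ k =
          partitionFunction m lam -
            ∑ k ∈ Finset.range (r + 1), (partitionSeries m).coeff k * lam ^ k := by
        rw [Finset.sum_range_succ', Finset.sum_range_succ', hc0, constantCoeff_partitionSeries]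
        simp_rw [hc]
        ring
      rw [e]
      refine (norm_partitionFunction_sub_le hm h' (r + 1)).trans ?_
      have h1 : A * (64 / rate m) ^ (r + 1) ≤ 1 / 8 * growth m ^ (r + 1) := by
        refine le_trans ?_ (hscale r)
        have : 0 ≤ A * (64 / rate m) ^ (r + 1) := by positivity
        linarith
      gcongr

theorem norm_partitionFunction_sub_one_le {m : ℝ} (hm : 0 < m) {lam : ℂ}
    (h : lam ∈ cardioid (freeSize m)) : ‖partitionFunction m lam - 1‖ ≤ 1 / 8 := by
  simpa using (hasGevreyExpansion_partitionFunction hm).remainder_le 0 lam h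

theorem partitionFunction_ne_zero {m : ℝ} (hm : 0 < m) {lam : ℂ}
    (h : lam ∈ cardioid (freeSize m)) : partitionFunction m lam ≠ 0 := by
  intro h0
  have := norm_partitionFunction_sub_one_le hm h
  rw [h0] at this
  norm_num at this

theorem analyticOnNhd_freeEnergy {m : ℝ} (hm : 0 < m) :
    AnalyticOnNhd ℂ (freeEnergy m) (cardioid (freeSize m)) := by
  refine DifferentiableOn.analyticOnNhd ?_ (isOpen_cardioid _)
  unfold freeEnergy
  refine DifferentiableOn.clog ((differentiableOn_partitionFunction hm).mono
    (cardioid_mono (min_le_left _ _))) fun lam h => ?_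
  have := Complex.mem_slitPlane_of_norm_lt_one
    ((norm_partitionFunction_sub_one_le hm h).trans_lt (by norm_num))
  simpa using this

theorem norm_remainder_le {m : ℝ} (hm : 0 < m) (r : ℕ) {lam : ℂ}
    (h : lam ∈ cardioid (freeSize m)) :
    ‖remainder m r lam‖ ≤ 1 / 2 * growth m ^ r * ‖lam‖ ^ r * r.factorial := by
  have h1 := (hasGevreyExpansion_partitionFunction hm).norm_log_sub_le (by norm_num) le_rfl
    (growth_pos hm).le (by
      rw [map_sub, ← PowerSeries.coeff_zero_eq_constantCoeff_apply,
        constantCoeff_partitionSeries]; simp) r h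
  rw [add_sub_cancel] at h1
  refine h1.trans_eq (by ring)

end TGFT

/-! ### Laplace transforms on the half line -/

theorem integral_pow_mul_exp_neg_Ioi {x : ℝ} (hx : 0 < x) (k : ℕ) :
    ∫ t in Set.Ioi (0 : ℝ), t ^ k * Real.exp (-(x * t)) = k.factorial / x ^ (k + 1) := by
  have h := Real.integral_rpow_mul_exp_neg_mul_Ioi (a := k + 1) (r := x) (by positivity) hx
  rw [Real.Gamma_nat_eq_factorial, add_sub_cancel_right] at h
  simp_rw [Real.rpow_natCast] at h
  rw [h]
  have e : ((k : ℝ) + 1) = ((k + 1 : ℕ) : ℝ) := by push_cast; ring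
  rw [e, Real.rpow_natCast, one_div, inv_pow]
  field_simp

theorem integrableOn_pow_mul_exp_neg_Ioi {x : ℝ} (hx : 0 < x) (k : ℕ) :
    IntegrableOn (fun t : ℝ => t ^ k * Real.exp (-(x * t))) (Set.Ioi 0) :=
  integrable_of_integral_ne_zero (by
    rw [integral_pow_mul_exp_neg_Ioi hx k]
    positivity)

theorem norm_pow_mul_cexp {z : ℂ} {t : ℝ} (ht : 0 ≤ t) (k : ℕ) :
    ‖(t : ℂ) ^ k * Complex.exp (-(t : ℂ) * z)‖ = t ^ k * Real.exp (-(z.re * t)) := by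
  rw [norm_mul, norm_pow, Complex.norm_real, Real.norm_of_nonneg ht, Complex.norm_exp]
  congr 2
  simp
  ring

theorem integrableOn_pow_mul_cexp_Ioi {z : ℂ} (hz : 0 < z.re) (k : ℕ) :
    IntegrableOn (fun t : ℝ => (t : ℂ) ^ k * Complex.exp (-(t : ℂ) * z)) (Set.Ioi 0) := by
  refine (integrableOn_pow_mul_exp_neg_Ioi hz k).mono'
    (Measurable.aestronglyMeasurable (by fun_prop)) ?_
  filter_upwards [ae_restrict_mem measurableSet_Ioi] with t ht
  exact (norm_pow_mul_cexp (le_of_lt ht) k).le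

theorem integral_pow_mul_cexp_Ioi {z : ℂ} (hz : 0 < z.re) (k : ℕ) :
    ∫ t in Set.Ioi (0 : ℝ), (t : ℂ) ^ k * Complex.exp (-(t : ℂ) * z) =
      k.factorial / z ^ (k + 1) := by
  have hz0 : z ≠ 0 := fun h => by simp [h] at hz
  have hd : ∀ (n : ℕ) (t : ℝ), HasDerivAt
      (fun t : ℝ => (t : ℂ) ^ n * Complex.exp (-(t : ℂ) * z))
      (n * (t : ℂ) ^ (n - 1) * Complex.exp (-(t : ℂ) * z) -
        z * ((t : ℂ) ^ n * Complex.exp (-(t : ℂ) * z))) t := by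
    intro n t
    have h1 : HasDerivAt (fun w : ℂ => w ^ n * Complex.exp (-w * z))
        (n * (t : ℂ) ^ (n - 1) * Complex.exp (-(t : ℂ) * z) +
          (t : ℂ) ^ n * (Complex.exp (-(t : ℂ) * z) * (-1 * z))) (t : ℂ) :=
      (hasDerivAt_pow n (t : ℂ)).mul
        (((hasDerivAt_id (t : ℂ)).neg.mul_const z).cexp)
    have h2 := h1.comp_ofReal
    convert h2 using 1
    ring
  have ht : ∀ n : ℕ, Tendsto (fun t : ℝ => (t : ℂ) ^ n * Complex.exp (-(t : ℂ) * z)) atTop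
      (𝓝 0) := by
    intro n
    rw [tendsto_zero_iff_norm_tendsto_zero]
    refine (tendsto_rpow_mul_exp_neg_mul_atTop_nhds_zero n z.re hz).congr' ?_
    filter_upwards [eventually_ge_atTop 0] with t ht
    rw [norm_pow_mul_cexp ht, Real.rpow_natCast, neg_mul]
  induction k with
  | zero =>
    have h := integral_Ioi_of_hasDerivAt_of_tendsto (a := 0) ((hd 0 0).continuousAt.continuousWithinAt)
      (fun t _ => hd 0 t) (by
        have := Integrable.const_mul (integrableOn_pow_mul_cexp_Ioi hz 0) (-z)
        unfold IntegrableOn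
        simpa using this) (ht 0)
    simp only [Nat.cast_zero, zero_mul, zero_sub, pow_zero, one_mul, Complex.ofReal_zero, neg_zero,
      Complex.exp_zero, integral_neg, integral_const_mul] at h
    simp only [pow_zero, one_mul, Nat.factorial_zero, Nat.cast_one, zero_add, pow_one]
    rw [eq_div_iff hz0, mul_comm]
    exact neg_injective h
  | succ n ih =>
    have hi1 : IntegrableOn (fun t : ℝ => ((n + 1 : ℕ) : ℂ) * ((t : ℂ) ^ n *
        Complex.exp (-(t : ℂ) * z))) (Set.Ioi 0) :=
      (integrableOn_pow_mul_cexp_Ioi hz n).const_mul _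
    have hi2 : IntegrableOn (fun t : ℝ => z * ((t : ℂ) ^ (n + 1) *
        Complex.exp (-(t : ℂ) * z))) (Set.Ioi 0) :=
      (integrableOn_pow_mul_cexp_Ioi hz (n + 1)).const_mul _
    have h := integral_Ioi_of_hasDerivAt_of_tendsto (a := 0)
      ((hd (n + 1) 0).continuousAt.continuousWithinAt)
      (f' := fun t : ℝ => ((n + 1 : ℕ) : ℂ) * ((t : ℂ) ^ n * Complex.exp (-(t : ℂ) * z)) -
        z * ((t : ℂ) ^ (n + 1) * Complex.exp (-(t : ℂ) * z)))
      (fun t _ => by simpa [mul_assoc] using hd (n + 1) t) (hi1.sub hi2) (ht (n + 1))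
    rw [integral_sub hi1 hi2, integral_const_mul, integral_const_mul, ih] at h
    simp only [Complex.ofReal_zero, ne_eq, Nat.add_eq_zero_iff, one_ne_zero, and_false,
      not_false_eq_true, zero_pow, zero_mul, sub_zero] at h
    have h' := (sub_eq_zero.1 h).symm
    rw [Nat.factorial_succ, eq_div_iff (pow_ne_zero _ hz0)]
    rw [mul_div_assoc', eq_div_iff (pow_ne_zero _ hz0)] at h'
    push_cast at h' ⊢
    rw [← h']
    ring

/-- The Laplace transform of a function on the positive half line. -/
def laplaceTransform (f : ℂ → ℂ) (z : ℂ) : ℂ :=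
  ∫ t in Set.Ioi (0 : ℝ), f t * Complex.exp (-(t : ℂ) * z)

/-! ### The Bessel series -/

/-- The entire function `∑ (-w)ᵏ / (k!)²`. -/
def besselSeries (w : ℂ) : ℂ := ∑' k : ℕ, (-w) ^ k / (k.factorial : ℂ) ^ 2

theorem norm_besselSeries_term_le (w : ℂ) (k : ℕ) :
    ‖(-w) ^ k / (k.factorial : ℂ) ^ 2‖ ≤ ‖w‖ ^ k / k.factorial := by
  rw [norm_div, norm_pow, norm_pow, norm_neg, Complex.norm_natCast]
  have h : (1 : ℝ) ≤ k.factorial := by exact_mod_cast Nat.one_le_iff_ne_zero.2 k.factorial_ne_zero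
  gcongr
  nlinarith

theorem hasSum_besselSeries (w : ℂ) :
    HasSum (fun k : ℕ => (-w) ^ k / (k.factorial : ℂ) ^ 2) (besselSeries w) :=
  (Summable.of_norm_bounded (Real.summable_pow_div_factorial ‖w‖)
    (norm_besselSeries_term_le w)).hasSum

theorem differentiable_besselSeries : Differentiable ℂ besselSeries := by
  intro w
  have h := Complex.differentiableOn_tsum_of_summable_norm
    (Real.summable_pow_div_factorial (‖w‖ + 1)) (U := Metric.ball 0 (‖w‖ + 1))
    (F := fun k z => (-z) ^ k / (k.factorial : ℂ) ^ 2) (fun k => by fun_prop) Metric.isOpen_ball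
    (fun k z hz => (norm_besselSeries_term_le z k).trans (by
      have := (mem_ball_zero_iff.1 hz).le
      gcongr))
  exact h.differentiableAt (Metric.isOpen_ball.mem_nhds (by simp))

theorem prod_odd_div_even (n : ℕ) :
    (∏ i ∈ Finset.range n, (2 * (i : ℝ) + 1) / (2 * i + 2)) * 4 ^ n * (n.factorial : ℝ) ^ 2 =
      ((2 * n).factorial : ℝ) := by
  induction n with
  | zero => simp
  | succ n ih =>
    rw [Finset.prod_range_succ, show 2 * (n + 1) = 2 * n + 1 + 1 by ring, Nat.factorial_succ,
      Nat.factorial_succ, Nat.factorial_succ]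
    push_cast
    rw [← ih]
    have : (2 * (n : ℝ) + 2) ≠ 0 := by positivity
    field_simp
    ring

/-- `besselSeries (ζ ^ 2)` is `J₀(2ζ)`, and this is Bessel's integral, obtained term by term from
the Wallis integrals. It exhibits growth in `|Im ζ|` only, which the absolute values of the power
series cannot show. -/
theorem besselSeries_sq (ζ : ℂ) :
    Real.pi * besselSeries (ζ ^ 2) = ∫ x in (0 : ℝ)..Real.pi, Complex.cos (2 * ζ * Real.sin x) := by
  have hterm : ∀ n : ℕ, ∫ x in (0 : ℝ)..Real.pi,
      (-1) ^ n * (2 * ζ * (Real.sin x : ℂ)) ^ (2 * n) / ((2 * n).factorial : ℂ) =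
      Real.pi * ((-(ζ ^ 2)) ^ n / (n.factorial : ℂ) ^ 2) := by
    intro n
    have e : ∀ x : ℝ, (-1) ^ n * (2 * ζ * (Real.sin x : ℂ)) ^ (2 * n) / ((2 * n).factorial : ℂ) =
        ((-1) ^ n * (2 * ζ) ^ (2 * n) / ((2 * n).factorial : ℂ)) *
          ((Real.sin x ^ (2 * n) : ℝ) : ℂ) := by
      intro x
      rw [mul_pow _ (Real.sin x : ℂ)]
      push_cast
      ring
    simp_rw [e]
    rw [intervalIntegral.integral_const_mul, intervalIntegral.integral_ofReal,
      integral_sin_pow_even]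
    have hn : (n.factorial : ℂ) ≠ 0 := by exact_mod_cast n.factorial_ne_zero
    have hP : ((∏ i ∈ Finset.range n, (2 * (i : ℝ) + 1) / (2 * i + 2) : ℝ) : ℂ) ≠ 0 := by
      rw [Complex.ofReal_ne_zero]
      exact Finset.prod_ne_zero_iff.2 fun i _ => by positivity
    have hf : (((2 * n).factorial : ℕ) : ℂ) = ((∏ i ∈ Finset.range n,
        (2 * (i : ℝ) + 1) / (2 * i + 2) : ℝ) : ℂ) * 4 ^ n * (n.factorial : ℂ) ^ 2 := by
      rw [← Complex.ofReal_natCast (2 * n).factorial, ← prod_odd_div_even]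
      push_cast
      rfl
    rw [Complex.ofReal_mul]
    set P := ((∏ i ∈ Finset.range n, (2 * (i : ℝ) + 1) / (2 * i + 2) : ℝ) : ℂ)
    rw [hf, neg_pow (ζ ^ 2), mul_pow 2 ζ, pow_mul 2 2 n, pow_mul ζ 2 n]
    norm_num
    field_simp
  have hsum : Summable fun n : ℕ => ‖2 * ζ‖ ^ (2 * n) / (2 * n).factorial :=
    (Real.hasSum_cosh ‖2 * ζ‖).summable
  have h := intervalIntegral.hasSum_integral_of_dominated_convergence (μ := volume)
    (a := 0) (b := Real.pi) (F := fun (n : ℕ) (x : ℝ) =>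
      (-1) ^ n * (2 * ζ * (Real.sin x : ℂ)) ^ (2 * n) / ((2 * n).factorial : ℂ))
    (f := fun x : ℝ => Complex.cos (2 * ζ * Real.sin x))
    (fun n _ => ‖2 * ζ‖ ^ (2 * n) / (2 * n).factorial)
    (fun n => (Measurable.aestronglyMeasurable (by fun_prop)))
    (fun n => ae_of_all _ fun x _ => by
      rw [norm_div, norm_mul, norm_pow, norm_pow, norm_neg, norm_one, one_pow, one_mul,
        Complex.norm_natCast, norm_mul _ (Real.sin x : ℂ), Complex.norm_real, Real.norm_eq_abs]
      gcongr
      exact mul_le_of_le_one_right (norm_nonneg _) (Real.abs_sin_le_one x))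
    (ae_of_all _ fun x _ => hsum) intervalIntegrable_const
    (ae_of_all _ fun x _ => Complex.hasSum_cos _)
  simp_rw [hterm] at h
  exact ((hasSum_besselSeries (ζ ^ 2)).mul_left _).unique h

theorem norm_cos_le (w : ℂ) : ‖Complex.cos w‖ ≤ Real.exp |w.im| := by
  rw [Complex.cos, norm_div]
  have h1 : ‖Complex.exp (w * Complex.I)‖ ≤ Real.exp |w.im| := by
    rw [Complex.norm_exp]
    refine Real.exp_le_exp.2 ?_
    simpa using neg_le_abs w.im
  have h2 : ‖Complex.exp (-w * Complex.I)‖ ≤ Real.exp |w.im| := by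
    rw [Complex.norm_exp]
    refine Real.exp_le_exp.2 ?_
    simpa using le_abs_self w.im
  have h3 := norm_add_le (Complex.exp (w * Complex.I)) (Complex.exp (-w * Complex.I))
  rw [Complex.norm_ofNat]
  linarith

theorem norm_besselSeries_sq_le (ζ : ℂ) : ‖besselSeries (ζ ^ 2)‖ ≤ Real.exp (2 * |ζ.im|) := by
  have h := intervalIntegral.norm_integral_le_of_norm_le_const (a := 0) (b := Real.pi)
    (C := Real.exp (2 * |ζ.im|)) (f := fun x : ℝ => Complex.cos (2 * ζ * Real.sin x)) fun x _ => by
      refine (norm_cos_le _).trans (Real.exp_le_exp.2 ?_)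
      rw [Complex.im_mul_ofReal, abs_mul]
      have e : (2 * ζ).im = 2 * ζ.im := by simp
      rw [e, abs_mul, abs_two]
      exact mul_le_of_le_one_right (by positivity) (Real.abs_sin_le_one x)
  rw [← besselSeries_sq, norm_mul, Complex.norm_real, Real.norm_of_nonneg Real.pi_pos.le, sub_zero,
    abs_of_pos Real.pi_pos, mul_comm] at h
  exact le_of_mul_le_mul_right h Real.pi_pos

/-- The region `|t| - Re t < 2 δ` inside a parabola around the positive half line. -/
def parabola (δ : ℝ) : Set ℂ := {t | ‖t‖ - t.re < 2 * δ}

theorem isOpen_parabola (δ : ℝ) : IsOpen (parabola δ) := isOpen_lt (by fun_prop) (by fun_prop)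

theorem ofReal_mem_parabola {δ x : ℝ} (hδ : 0 < δ) (hx : 0 ≤ x) : (x : ℂ) ∈ parabola δ := by
  rw [parabola, Set.mem_ofPred_eq, Complex.norm_real, Real.norm_of_nonneg hx, Complex.ofReal_re]
  linarith

theorem mul_mem_parabola {δ x : ℝ} (h0 : 0 ≤ x) (h1 : x ≤ 1) {t : ℂ}
    (ht : t ∈ parabola δ) : (x : ℂ) * t ∈ parabola δ := by
  rw [parabola, Set.mem_ofPred_eq] at ht ⊢
  rw [norm_mul, Complex.norm_real, Real.norm_of_nonneg h0, Complex.re_ofReal_mul, ← mul_sub]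
  have := sub_nonneg.2 (Complex.re_le_norm t)
  nlinarith

theorem norm_sub_re_le (t w : ℂ) : ‖w‖ - w.re ≤ ‖t‖ - t.re + 2 * ‖w - t‖ := by
  have h1 : ‖w‖ ≤ ‖t‖ + ‖w - t‖ := by
    have := norm_add_le t (w - t)
    rwa [add_sub_cancel] at this
  have h2 : t.re - w.re ≤ ‖w - t‖ := by
    have := Complex.re_le_norm (t - w)
    rwa [Complex.sub_re, norm_sub_rev] at this
  linarith

theorem thickening_subset_parabola (δ : ℝ) :
    Metric.thickening δ (Complex.ofReal '' Set.Ici 0) ⊆ parabola δ := by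
  intro t ht
  obtain ⟨_, ⟨x, hx, rfl⟩, hd⟩ := Metric.mem_thickening_iff.1 ht
  have h := norm_sub_re_le (x : ℂ) t
  have hx' : (0 : ℝ) ≤ x := hx
  rw [dist_eq_norm] at hd
  rw [Complex.norm_real, Real.norm_of_nonneg hx', Complex.ofReal_re] at h
  rw [parabola, Set.mem_ofPred_eq]
  linarith

/-- If `ζ² = t a`, then `(Im ζ)² = (|t| - Re t) a / 2 ≤ δ a`. The parabola is exactly the region on
which this is uniform in `t`. -/
theorem norm_besselSeries_mul_le {δ a : ℝ} (ha : 0 ≤ a) {t : ℂ}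
    (ht : ‖t‖ - t.re ≤ 2 * δ) :
    ‖besselSeries (t * a)‖ ≤ Real.exp (2 * √(δ * a)) := by
  obtain ⟨ζ, hζ⟩ := IsAlgClosed.exists_pow_nat_eq (t * a) two_pos
  rw [← hζ]
  refine (norm_besselSeries_sq_le ζ).trans (Real.exp_le_exp.2 ?_)
  gcongr
  refine Real.abs_le_sqrt ?_
  have h1 : ‖ζ‖ ^ 2 = ‖t‖ * a := by
    rw [← norm_pow, hζ, norm_mul, Complex.norm_real, Real.norm_of_nonneg ha]
  have h2 : ζ.re * ζ.re - ζ.im * ζ.im = t.re * a := by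
    rw [← Complex.mul_re, ← sq, hζ, Complex.re_mul_ofReal]
  rw [Complex.sq_norm, Complex.normSq_apply] at h1
  nlinarith

/-- Termwise, `∫ tᵏ e^(-t z) dt = k! / z ^ (k + 1)` replaces `(k!)²` by `k!`. Hence `t ↦ J₀(2 √(t
a))` is the Borel transform of `lam ↦ exp (-lam a)`, with `z = 1 / lam`. -/
theorem laplaceTransform_besselSeries {a : ℝ} (ha : 0 ≤ a) {z : ℂ} (hz : 0 < z.re) :
    z * ∫ t in Set.Ioi (0 : ℝ), besselSeries (t * a) * Complex.exp (-(t : ℂ) * z) =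
      Complex.exp (-(z⁻¹ * a)) := by
  have hz0 : z ≠ 0 := fun h => by simp [h] at hz
  set F : ℕ → ℝ → ℂ := fun k t => (-(a : ℂ)) ^ k / (k.factorial : ℂ) ^ 2 *
    ((t : ℂ) ^ k * Complex.exp (-(t : ℂ) * z)) with hF
  have hint : ∀ k, Integrable (F k) (volume.restrict (Set.Ioi 0)) := fun k =>
    (integrableOn_pow_mul_cexp_Ioi hz k).const_mul _
  have hnorm : ∀ k, ∫ t in Set.Ioi (0 : ℝ), ‖F k t‖ = (a / z.re) ^ k / k.factorial * z.re⁻¹ := by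
    intro k
    have e : Set.EqOn (fun t : ℝ => ‖F k t‖) (fun t => a ^ k / (k.factorial : ℝ) ^ 2 *
        (t ^ k * Real.exp (-(z.re * t)))) (Set.Ioi 0) := by
      intro t ht
      simp only [hF]
      rw [norm_mul, norm_pow_mul_cexp (le_of_lt ht), norm_div, norm_pow, norm_pow, norm_neg,
        Complex.norm_natCast, Complex.norm_real, Real.norm_of_nonneg ha]
    rw [setIntegral_congr_fun measurableSet_Ioi e, integral_const_mul,
      integral_pow_mul_exp_neg_Ioi hz]
    have : (k.factorial : ℝ) ≠ 0 := by positivity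
    rw [div_pow]
    field_simp
    ring
  have h := hasSum_integral_of_summable_integral_norm hint (by
    simp_rw [hnorm]
    exact (Real.summable_pow_div_factorial _).mul_right _)
  have e1 : ∀ t : ℝ, ∑' k, F k t = besselSeries (t * a) * Complex.exp (-(t : ℂ) * z) := by
    intro t
    rw [besselSeries, ← tsum_mul_right]
    refine tsum_congr fun k => ?_
    simp only [hF]
    rw [neg_pow (t * a : ℂ), neg_pow (a : ℂ), mul_pow]
    ring
  simp_rw [e1] at h
  have e2 : ∀ k, ∫ t in Set.Ioi (0 : ℝ), F k t = z⁻¹ * ((-(z⁻¹ * a)) ^ k / k.factorial) := by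
    intro k
    simp only [hF]
    rw [integral_const_mul, integral_pow_mul_cexp_Ioi hz, neg_pow (a : ℂ), neg_pow (z⁻¹ * a),
      mul_pow, inv_pow]
    have : (k.factorial : ℂ) ≠ 0 := by exact_mod_cast k.factorial_ne_zero
    field_simp
    ring
  simp_rw [e2] at h
  have h2 : HasSum (fun k : ℕ => (-(z⁻¹ * a)) ^ k / (k.factorial : ℂ))
      (Complex.exp (-(z⁻¹ * a))) := by
    rw [Complex.exp_eq_exp_ℂ]
    exact NormedSpace.expSeries_div_hasSum_exp _
  rw [h.unique (h2.mul_left z⁻¹), mul_inv_cancel_left₀ hz0]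

namespace TGFT

/-! ### The Borel transform of the partition function -/

/-- The width of the domain of the Borel transform. -/
def width (m : ℝ) : ℝ := 1 / (32 * fiberBound m)

theorem width_pos {m : ℝ} (hm : 0 < m) : 0 < width m := by
  have := fiberBound_pos hm
  unfold width; positivity

/-- The exponential is at most `2 cosh`, whose series in powers of the action has denominators
`(2k)!` that cancel the growth of the moments. The width makes `16 * width * fiberBound = 1/2`, so
the integrated series is dominated by `4 (1/2)ᵏ`, with sum `8`. -/
theorem integrable_exp_sqrt_and_integral_le {m : ℝ} (hm : 0 < m) :
    Integrable (fun T => Real.exp (2 * √(width m * realAction T))) (fieldMeasure m) ∧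
      ∫ T, Real.exp (2 * √(width m * realAction T)) ∂(fieldMeasure m) ≤ 8 := by
  have hw := width_pos hm
  have hD := fiberBound_pos hm
  have hwD : width m * fiberBound m = 1 / 32 := by unfold width; field_simp
  set F : ℕ → (Mode → ℂ) → ℝ := fun k T =>
    2 * (4 * width m) ^ k / (2 * k).factorial * realAction T ^ k with hF
  have hF0 : ∀ k T, 0 ≤ F k T := fun k T => by
    have := realAction_nonneg T
    simp only [hF]
    positivity
  have hint : ∀ k, Integrable (F k) (fieldMeasure m) := fun k =>
    (integrable_realAction_pow hm k).const_mul _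
  have hbound : ∀ k, ∫ T, F k T ∂(fieldMeasure m) ≤ 4 * (1 / 2) ^ k := by
    intro k
    simp only [hF]
    rw [integral_const_mul]
    calc _ ≤ 2 * (4 * width m) ^ k / (2 * k).factorial *
          (2 * (4 * fiberBound m) ^ k * (2 * k).factorial) := by
          gcongr; exact integral_realAction_pow_le hm k
      _ = 4 * (16 * (width m * fiberBound m)) ^ k := by
          have : ((2 * k).factorial : ℝ) ≠ 0 := by positivity
          have e : (16 * (width m * fiberBound m)) ^ k =
              (4 * width m) ^ k * (4 * fiberBound m) ^ k := by
            rw [← mul_pow]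
            ring
          rw [e]
          field_simp
          norm_num
      _ = _ := by rw [hwD]; norm_num
  have hsummable : Summable fun k => ∫ T, ‖F k T‖ ∂(fieldMeasure m) := by
    have e : ∀ k, ∫ T, ‖F k T‖ ∂(fieldMeasure m) = ∫ T, F k T ∂(fieldMeasure m) := fun k =>
      integral_congr_ae (ae_of_all _ fun T => Real.norm_of_nonneg (hF0 k T))
    simp_rw [e]
    exact Summable.of_nonneg_of_le (fun k => integral_nonneg (hF0 k)) hbound
      (summable_geometric_two.mul_left 4)
  have hcosh : ∀ T, HasSum (fun k => F k T) (2 * Real.cosh (2 * √(width m * realAction T))) := by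
    intro T
    have h := (Real.hasSum_cosh (2 * √(width m * realAction T))).mul_left 2
    have e : F = fun k T => 2 * ((2 * √(width m * realAction T)) ^ (2 * k) / (2 * k).factorial) := by
      funext k T
      simp only [hF]
      rw [pow_mul, mul_pow 2, Real.sq_sqrt (mul_nonneg hw.le (realAction_nonneg T)),
        show (2 : ℝ) ^ 2 * (width m * realAction T) = 4 * width m * realAction T by ring,
        mul_pow (4 * width m)]
      ring
    rw [e]
    exact h
  have hle : ∀ T, Real.exp (2 * √(width m * realAction T)) ≤ ∑' k, F k T := by
    intro T
    rw [(hcosh T).tsum_eq, Real.cosh_eq]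
    have := Real.exp_pos (-(2 * √(width m * realAction T)))
    linarith
  have hsum := hasSum_integral_of_summable_integral_norm hint hsummable
  have hint2 : Integrable (fun T => ∑' k, F k T) (fieldMeasure m) := by
    refine ⟨(by simp_rw [fun T => (hcosh T).tsum_eq]; fun_prop), ?_⟩
    rw [hasFiniteIntegral_iff_ofReal (ae_of_all _ fun T => tsum_nonneg fun k => hF0 k T)]
    have : ∀ T, ENNReal.ofReal (∑' k, F k T) = ∑' k, ENNReal.ofReal (F k T) := fun T =>
      ENNReal.ofReal_tsum_of_nonneg (fun k => hF0 k T) (hcosh T).summable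
    simp_rw [this]
    rw [lintegral_tsum fun k => by fun_prop]
    simp_rw [← fun k => ofReal_integral_eq_lintegral_ofReal (hint k) (ae_of_all _ (hF0 k))]
    rw [← ENNReal.ofReal_tsum_of_nonneg (fun k => integral_nonneg (hF0 k)) hsum.summable]
    exact ENNReal.ofReal_lt_top
  refine ⟨hint2.mono' (by fun_prop) (ae_of_all _ fun T => ?_), ?_⟩
  · rw [Real.norm_of_nonneg (Real.exp_pos _).le]
    exact hle T
  · calc _ ≤ ∫ T, ∑' k, F k T ∂(fieldMeasure m) :=
          integral_mono_of_nonneg (ae_of_all _ fun T => (Real.exp_pos _).le) hint2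
            (ae_of_all _ hle)
      _ ≤ 4 * 2 := hasSum_le hbound hsum (hasSum_geometric_two.mul_left 4)
      _ = 8 := by norm_num

/-- The Borel transform of the partition function. -/
def borelZ (m : ℝ) (t : ℂ) : ℂ := ∫ T, besselSeries (t * realAction T) ∂(fieldMeasure m)

theorem measurable_besselSeries : Measurable besselSeries :=
  differentiable_besselSeries.continuous.measurable

theorem norm_borelZ_le {m : ℝ} (hm : 0 < m) {t : ℂ} (ht : t ∈ parabola (width m)) :
    ‖borelZ m t‖ ≤ 8 := by
  obtain ⟨h1, h2⟩ := integrable_exp_sqrt_and_integral_le hm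
  exact (norm_integral_le_of_norm_le h1 (ae_of_all _ fun T =>
    norm_besselSeries_mul_le (realAction_nonneg T) (le_of_lt ht))).trans h2

theorem differentiableOn_borelZ {m : ℝ} (hm : 0 < m) :
    DifferentiableOn ℂ (borelZ m) (parabola (width m)) :=
  differentiableOn_integral_of_dominated (isOpen_parabola _)
    (f := fun T t => besselSeries (t * realAction T))
    (fun t _ => (measurable_besselSeries.comp (by fun_prop)).aestronglyMeasurable)
    (ae_of_all _ fun T => (differentiable_besselSeries.comp (by fun_prop)).differentiableOn)
    (integrable_exp_sqrt_and_integral_le hm).1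
    (ae_of_all _ fun T _ ht => norm_besselSeries_mul_le (realAction_nonneg T)
      (le_of_lt ht))

theorem borelZ_zero (m : ℝ) : borelZ m 0 = 1 := by
  have : besselSeries 0 = 1 := by
    rw [besselSeries, tsum_eq_single 0 fun k hk => by simp [hk]]
    simp
  simp [borelZ, this]

theorem norm_besselSeries_real_le {t a : ℝ} (ht : 0 ≤ t) (ha : 0 ≤ a) :
    ‖besselSeries (t * a)‖ ≤ 1 := by
  have := norm_besselSeries_mul_le (δ := 0) ha (t := t) (by
    rw [Complex.norm_real, Real.norm_of_nonneg ht, Complex.ofReal_re]; simp)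
  simpa using this

/-- The partition function is the Laplace transform of its Borel transform. -/
theorem laplaceTransform_borelZ (m : ℝ) {z : ℂ} (hz : 0 < z.re) :
    z * laplaceTransform (borelZ m) z =
      ∫ T, Complex.exp (-(z⁻¹ * (realAction T : ℂ))) ∂(fieldMeasure m) := by
  simp_rw [← fun T => laplaceTransform_besselSeries (realAction_nonneg T) hz]
  rw [integral_const_mul, laplaceTransform]
  congr 1
  simp_rw [borelZ, ← integral_mul_const]
  refine integral_integral_swap ?_
  have h1 := (integrableOn_pow_mul_exp_neg_Ioi hz 0).mul_prod
    (integrable_const (1 : ℝ) (μ := fieldMeasure m))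
  refine h1.mono' ?_ ?_
  · refine Measurable.aestronglyMeasurable ?_
    exact (measurable_besselSeries.comp (by fun_prop)).mul (by fun_prop)
  · rw [← Measure.restrict_univ (μ := fieldMeasure m), Measure.prod_restrict]
    filter_upwards [ae_restrict_mem (measurableSet_Ioi.prod MeasurableSet.univ)] with q hq
    have hq0 : (0 : ℝ) < q.1 := hq.1
    simp only [Function.uncurry_def]
    have h2 := norm_pow_mul_cexp (z := z) hq0.le 0
    rw [pow_zero, one_mul] at h2
    rw [norm_mul, h2, mul_one]
    exact mul_le_of_le_one_left (by positivity)
      (norm_besselSeries_real_le hq0.le (realAction_nonneg q.2))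

end TGFT

/-! ### Convolution along segments -/

theorem continuousOn_comp_ofReal {δ : ℝ} (hδ : 0 < δ) {f : ℂ → ℂ}
    (hf : DifferentiableOn ℂ f (parabola δ)) : ContinuousOn (fun t : ℝ => f t) (Set.Ici 0) :=
  hf.continuousOn.comp Complex.continuous_ofReal.continuousOn fun _ ht => ofReal_mem_parabola hδ ht

theorem integrableOn_mul_cexp_Ioi {f : ℝ → ℂ} (hf : ContinuousOn f (Set.Ici 0)) {A c : ℝ}
    (hb : ∀ t, 0 ≤ t → ‖f t‖ ≤ A * Real.exp (c * t)) {z : ℂ} (hz : c < z.re) :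
    IntegrableOn (fun t : ℝ => f t * Complex.exp (-(t : ℂ) * z)) (Set.Ioi 0) := by
  have h := (integrableOn_pow_mul_exp_neg_Ioi (sub_pos.2 hz) 0).const_mul A
  refine h.mono' (((hf.mono Set.Ioi_subset_Ici_self).mul
    (Continuous.continuousOn (by fun_prop))).aestronglyMeasurable measurableSet_Ioi) ?_
  filter_upwards [ae_restrict_mem measurableSet_Ioi] with t ht
  have ht0 : 0 ≤ t := le_of_lt ht
  have h2 := norm_pow_mul_cexp (z := z) ht0 0
  rw [pow_zero, one_mul, pow_zero, one_mul] at h2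
  rw [norm_mul, h2]
  refine (mul_le_mul_of_nonneg_right (hb t ht0) (Real.exp_pos _).le).trans_eq ?_
  rw [pow_zero, one_mul, mul_assoc, ← Real.exp_add]
  congr 2
  ring

/-- The convolution `∫ f(s) g(t - s) ds` along the segment from `0` to `t`. -/
def segConv (f g : ℂ → ℂ) (t : ℂ) : ℂ :=
  t * ∫ x in (0 : ℝ)..1, f (x * t) * g ((1 - x : ℝ) * t)

theorem segConv_ofReal (f g : ℂ → ℂ) (x : ℝ) :
    segConv f g x = ∫ s in (0 : ℝ)..x, f s * g ((x - s : ℝ)) := by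
  have h := intervalIntegral.smul_integral_comp_mul_left
    (f := fun s : ℝ => f s * g ((x - s : ℝ))) (a := 0) (b := 1) x
  rw [mul_zero, mul_one] at h
  rw [← h, segConv, Complex.real_smul]
  congr 1
  refine intervalIntegral.integral_congr fun y _ => ?_
  congr 2
  · push_cast; ring
  · push_cast; ring

/-- The parabola is star-shaped about `0`, so the segment stays in it. The monotone bounds `φ` and
`ψ` dominate the integrand on bounded parts of the parabola. -/
theorem differentiableOn_segConv {δ : ℝ} {f g : ℂ → ℂ} {φ ψ : ℝ → ℝ}
    (hf : DifferentiableOn ℂ f (parabola δ)) (hg : DifferentiableOn ℂ g (parabola δ))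
    (hφ : MonotoneOn φ (Set.Ici 0)) (hψ : MonotoneOn ψ (Set.Ici 0))
    (hfb : ∀ t ∈ parabola δ, ‖f t‖ ≤ φ ‖t‖) (hgb : ∀ t ∈ parabola δ, ‖g t‖ ≤ ψ ‖t‖) :
    DifferentiableOn ℂ (segConv f g) (parabola δ) := by
  intro t₀ ht₀
  set U := parabola δ ∩ Metric.ball 0 (‖t₀‖ + 1) with hU
  have hUo : IsOpen U := (isOpen_parabola δ).inter Metric.isOpen_ball
  have hR : 0 ≤ ‖t₀‖ + 1 := by positivity
  have hmem : ∀ x ∈ Set.Icc (0 : ℝ) 1, ∀ t ∈ U, (x : ℂ) * t ∈ parabola δ ∧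
      ((1 - x : ℝ) : ℂ) * t ∈ parabola δ := fun x hx t ht =>
    ⟨mul_mem_parabola hx.1 hx.2 ht.1,
      mul_mem_parabola (sub_nonneg.2 hx.2) (by linarith [hx.1]) ht.1⟩
  have hle : ∀ x ∈ Set.Icc (0 : ℝ) 1, ∀ t ∈ U, ‖(x : ℂ) * t‖ ≤ ‖t₀‖ + 1 := fun x hx t ht => by
    rw [norm_mul, Complex.norm_real, Real.norm_of_nonneg hx.1]
    exact (mul_le_of_le_one_left (norm_nonneg _) hx.2).trans (mem_ball_zero_iff.1 ht.2).le
  have hae : ∀ᵐ x : ℝ ∂(volume.restrict (Set.Ioc 0 1)), x ∈ Set.Icc (0 : ℝ) 1 := by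
    filter_upwards [ae_restrict_mem measurableSet_Ioc] with x hx using Set.Ioc_subset_Icc_self hx
  have hd : DifferentiableOn ℂ (fun t => ∫ x in Set.Ioc (0 : ℝ) 1,
      f (x * t) * g ((1 - x : ℝ) * t)) U := by
    refine differentiableOn_integral_of_dominated hUo
      (f := fun (x : ℝ) t => f (x * t) * g ((1 - x : ℝ) * t))
      (g := fun _ => φ (‖t₀‖ + 1) * ψ (‖t₀‖ + 1)) (fun t ht => ?_) ?_ (integrable_const _) ?_
    · refine ContinuousOn.aestronglyMeasurable ?_ measurableSet_Ioc
      refine (hf.continuousOn.comp (Continuous.continuousOn (by fun_prop)) fun x hx =>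
        (hmem x (Set.Ioc_subset_Icc_self hx) t ht).1).mul
        (hg.continuousOn.comp (Continuous.continuousOn (by fun_prop)) fun x hx =>
          (hmem x (Set.Ioc_subset_Icc_self hx) t ht).2)
    · filter_upwards [hae] with x hx
      exact (hf.comp (by fun_prop) fun t ht => (hmem x hx t ht).1).mul
        (hg.comp (by fun_prop) fun t ht => (hmem x hx t ht).2)
    · filter_upwards [hae] with x hx t ht
      have h1 := (hfb _ (hmem x hx t ht).1).trans (hφ (norm_nonneg _) hR (hle x hx t ht))
      have h2 := (hgb _ (hmem x hx t ht).2).trans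
        (hψ (norm_nonneg _) hR (hle (1 - x) ⟨sub_nonneg.2 hx.2, by linarith [hx.1]⟩ t ht))
      rw [norm_mul]
      exact mul_le_mul h1 h2 (norm_nonneg _) ((norm_nonneg _).trans h1)
  have hd2 : DifferentiableOn ℂ (segConv f g) U := by
    refine (differentiableOn_id.mul hd).congr fun t _ => ?_
    rw [segConv, intervalIntegral.integral_of_le zero_le_one]
    rfl
  exact (hd2.differentiableAt (hUo.mem_nhds ⟨ht₀, by simp⟩)).differentiableWithinAt

/-- Integrating `xⁿ` over the segment gives the factor `1 / (n + 1)`. Iterated, it produces the `1 /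
n!` that makes the convolution logarithm converge for all `t`. -/
theorem norm_segConv_le {δ A M : ℝ} {f g : ℂ → ℂ} {n : ℕ}
    (hfb : ∀ t ∈ parabola δ, ‖f t‖ ≤ M * ‖t‖ ^ n) (hgb : ∀ t ∈ parabola δ, ‖g t‖ ≤ A)
    (hM : 0 ≤ M) {t : ℂ} (ht : t ∈ parabola δ) :
    ‖segConv f g t‖ ≤ M * A / (n + 1) * ‖t‖ ^ (n + 1) := by
  have h := intervalIntegral.norm_integral_le_of_norm_le (μ := volume) (a := 0) (b := 1)
    (f := fun x : ℝ => f (x * t) * g ((1 - x : ℝ) * t))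
    (g := fun x : ℝ => M * ‖t‖ ^ n * A * x ^ n) zero_le_one (ae_of_all _ fun x hx => by
      have h1 := hfb _ (mul_mem_parabola hx.1.le hx.2 ht)
      have h2 := hgb _ (mul_mem_parabola (sub_nonneg.2 hx.2) (by linarith [hx.1]) ht)
      rw [norm_mul (x : ℂ), Complex.norm_real, Real.norm_of_nonneg hx.1.le] at h1
      rw [norm_mul]
      refine (mul_le_mul h1 h2 (norm_nonneg _) (by have := hx.1.le; positivity)).trans_eq ?_
      ring) (Continuous.intervalIntegrable (by fun_prop) _ _)
  rw [intervalIntegral.integral_const_mul, integral_pow] at h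
  rw [segConv, norm_mul]
  refine (mul_le_mul_of_nonneg_left h (norm_nonneg t)).trans_eq ?_
  rw [one_pow, zero_pow n.succ_ne_zero]
  ring

theorem laplaceTransform_segConv {f g : ℂ → ℂ} {z : ℂ}
    (hf : IntegrableOn (fun t : ℝ => f t * Complex.exp (-(t : ℂ) * z)) (Set.Ioi 0))
    (hg : IntegrableOn (fun t : ℝ => g t * Complex.exp (-(t : ℂ) * z)) (Set.Ioi 0)) :
    laplaceTransform (segConv f g) z = laplaceTransform f z * laplaceTransform g z := by
  have h := integral_posConvolution (μ := volume) (ν := volume) hf hg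
    (ContinuousLinearMap.mul ℝ ℂ)
  simp only [ContinuousLinearMap.mul_apply'] at h
  rw [laplaceTransform, laplaceTransform, laplaceTransform, ← h]
  refine integral_congr_ae (ae_of_all _ fun x => ?_)
  simp only
  rw [segConv_ofReal, ← intervalIntegral.integral_mul_const]
  refine intervalIntegral.integral_congr fun s _ => ?_
  rw [mul_mul_mul_comm, ← Complex.exp_add]
  congr 2
  push_cast
  ring

/-! ### The convolution logarithm -/

/-- The iterated convolutions of a function with itself. -/
def convPow (b : ℂ → ℂ) : ℕ → ℂ → ℂ
  | 0 => b
  | n + 1 => segConv (convPow b n) b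

/-- The logarithm of `1 + b` for the convolution product. -/
def convLog (b : ℂ → ℂ) (t : ℂ) : ℂ := ∑' n : ℕ, (-1) ^ n / ((n : ℂ) + 1) * convPow b n t

section ConvLog

variable {δ K : ℝ} {b : ℂ → ℂ}

theorem norm_convPow_le (hK : 0 ≤ K) (hb : ∀ t ∈ parabola δ, ‖b t‖ ≤ K) (n : ℕ) {t : ℂ}
    (ht : t ∈ parabola δ) : ‖convPow b n t‖ ≤ K ^ (n + 1) / n.factorial * ‖t‖ ^ n := by
  induction n generalizing t with
  | zero => simpa [convPow] using hb t ht
  | succ n ih =>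
    refine (norm_segConv_le (fun t ht => ih ht) hb (by positivity) ht).trans_eq ?_
    rw [Nat.factorial_succ]
    push_cast
    field_simp
    ring

theorem pow_div_factorial_mul_pow (x : ℝ) (n : ℕ) :
    K ^ (n + 1) / n.factorial * x ^ n = K * ((K * x) ^ n / n.factorial) := by
  rw [mul_pow]; ring

theorem differentiableOn_convPow (hK : 0 ≤ K) (hb : ∀ t ∈ parabola δ, ‖b t‖ ≤ K)
    (hd : DifferentiableOn ℂ b (parabola δ)) (n : ℕ) :
    DifferentiableOn ℂ (convPow b n) (parabola δ) := by
  induction n with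
  | zero => exact hd
  | succ n ih =>
    exact differentiableOn_segConv (φ := fun x => K ^ (n + 1) / n.factorial * x ^ n)
      (ψ := fun _ => K) ih hd
      (fun x hx y _ hxy => mul_le_mul_of_nonneg_left (pow_le_pow_left₀ hx hxy n) (by positivity))
      monotoneOn_const (fun t ht => norm_convPow_le hK hb n ht) hb

theorem norm_convLog_term_le (hK : 0 ≤ K) (hb : ∀ t ∈ parabola δ, ‖b t‖ ≤ K) (n : ℕ) {t : ℂ}
    (ht : t ∈ parabola δ) : ‖(-1) ^ n / ((n : ℂ) + 1) * convPow b n t‖ ≤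
      K * ((K * ‖t‖) ^ n / n.factorial) := by
  rw [← pow_div_factorial_mul_pow, norm_mul, norm_div, norm_pow, norm_neg, norm_one, one_pow]
  refine (mul_le_of_le_one_left (norm_nonneg _) ?_).trans (norm_convPow_le hK hb n ht)
  have e : ((n : ℂ) + 1) = ((n + 1 : ℕ) : ℂ) := by push_cast; rfl
  rw [e, Complex.norm_natCast]
  exact div_le_one_of_le₀ (by exact_mod_cast Nat.succ_le_succ n.zero_le) (by positivity)

theorem hasSum_mul_exp (x : ℝ) :
    HasSum (fun n : ℕ => K * ((K * x) ^ n / n.factorial)) (K * Real.exp (K * x)) := by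
  rw [Real.exp_eq_exp_ℝ]
  exact (NormedSpace.expSeries_div_hasSum_exp (K * x)).mul_left K

theorem norm_convLog_le (hK : 0 ≤ K) (hb : ∀ t ∈ parabola δ, ‖b t‖ ≤ K) {t : ℂ}
    (ht : t ∈ parabola δ) : ‖convLog b t‖ ≤ K * Real.exp (K * ‖t‖) :=
  tsum_of_norm_bounded (hasSum_mul_exp ‖t‖) fun n => norm_convLog_term_le hK hb n ht

theorem differentiableOn_convLog (hK : 0 ≤ K) (hb : ∀ t ∈ parabola δ, ‖b t‖ ≤ K)
    (hd : DifferentiableOn ℂ b (parabola δ)) :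
    DifferentiableOn ℂ (convLog b) (parabola δ) := by
  intro t₀ ht₀
  have hUo : IsOpen (parabola δ ∩ Metric.ball 0 (‖t₀‖ + 1)) :=
    (isOpen_parabola δ).inter Metric.isOpen_ball
  have h : DifferentiableOn ℂ (convLog b) (parabola δ ∩ Metric.ball 0 (‖t₀‖ + 1)) :=
    Complex.differentiableOn_tsum_of_summable_norm (hasSum_mul_exp (‖t₀‖ + 1)).summable
      (fun n => ((differentiableOn_convPow hK hb hd n).const_mul _).mono Set.inter_subset_left) hUo
      (fun n t ht => (norm_convLog_term_le hK hb n ht.1).trans (by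
        have := (mem_ball_zero_iff.1 ht.2).le
        gcongr))
  exact (h.differentiableAt (hUo.mem_nhds ⟨ht₀, by simp⟩)).differentiableWithinAt

theorem integrableOn_convPow_mul_cexp (hδ : 0 < δ) (hK : 0 ≤ K)
    (hb : ∀ t ∈ parabola δ, ‖b t‖ ≤ K) (hd : DifferentiableOn ℂ b (parabola δ)) (n : ℕ) {z : ℂ}
    (hz : K < z.re) :
    IntegrableOn (fun t : ℝ => convPow b n t * Complex.exp (-(t : ℂ) * z)) (Set.Ioi 0) := by
  refine integrableOn_mul_cexp_Ioi (A := K) (c := K)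
    (continuousOn_comp_ofReal hδ (differentiableOn_convPow hK hb hd n)) (fun t ht => ?_) hz
  have h := norm_convPow_le hK hb n (ofReal_mem_parabola hδ ht)
  rw [Complex.norm_real, Real.norm_of_nonneg ht, pow_div_factorial_mul_pow] at h
  exact h.trans (mul_le_mul_of_nonneg_left
    (Real.pow_div_factorial_le_exp _ (mul_nonneg hK ht) n) hK)

theorem laplaceTransform_convPow (hδ : 0 < δ) (hK : 0 ≤ K) (hb : ∀ t ∈ parabola δ, ‖b t‖ ≤ K)
    (hd : DifferentiableOn ℂ b (parabola δ)) (n : ℕ) {z : ℂ} (hz : K < z.re) :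
    laplaceTransform (convPow b n) z = laplaceTransform b z ^ (n + 1) := by
  induction n with
  | zero => simp [convPow]
  | succ n ih =>
    have h := laplaceTransform_segConv (integrableOn_convPow_mul_cexp hδ hK hb hd n hz)
      (integrableOn_convPow_mul_cexp hδ hK hb hd 0 hz)
    rw [pow_succ, ← ih]
    exact h

theorem integral_norm_convPow_le (hδ : 0 < δ) (hK : 0 ≤ K) (hb : ∀ t ∈ parabola δ, ‖b t‖ ≤ K)
    (hd : DifferentiableOn ℂ b (parabola δ)) (n : ℕ) {z : ℂ} (hz : K < z.re) :
    ∫ t in Set.Ioi (0 : ℝ), ‖convPow b n t * Complex.exp (-(t : ℂ) * z)‖ ≤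
      (K / z.re) ^ (n + 1) := by
  have hz0 : 0 < z.re := hK.trans_lt hz
  calc _ ≤ ∫ t in Set.Ioi (0 : ℝ), K ^ (n + 1) / n.factorial *
          (t ^ n * Real.exp (-(z.re * t))) := by
        refine setIntegral_mono_on (integrableOn_convPow_mul_cexp hδ hK hb hd n hz).norm
          ((integrableOn_pow_mul_exp_neg_Ioi hz0 n).const_mul _) measurableSet_Ioi fun t ht => ?_
        have ht0 : 0 ≤ t := le_of_lt ht
        have h := norm_convPow_le hK hb n (ofReal_mem_parabola hδ ht0)
        have h2 := norm_pow_mul_cexp (z := z) ht0 0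
        rw [pow_zero, one_mul, pow_zero, one_mul] at h2
        rw [Complex.norm_real, Real.norm_of_nonneg ht0] at h
        rw [norm_mul, h2, ← mul_assoc]
        gcongr
    _ = _ := by
        rw [integral_const_mul, integral_pow_mul_exp_neg_Ioi hz0, div_pow]
        field_simp

/-- Laplace transforms turn convolution powers into powers, so the series becomes that of `log (1 +
L b)`. The condition `K < Re z` ensures `|L b| ≤ K / Re z < 1` and absolute convergence of the
exchanged sum and integral. -/
theorem laplaceTransform_convLog (hδ : 0 < δ) (hK : 0 < K) (hb : ∀ t ∈ parabola δ, ‖b t‖ ≤ K)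
    (hd : DifferentiableOn ℂ b (parabola δ)) {z : ℂ} (hz : K < z.re) :
    laplaceTransform (convLog b) z = Complex.log (1 + laplaceTransform b z) := by
  have hz0 : 0 < z.re := hK.trans hz
  have hq : K / z.re < 1 := (div_lt_one hz0).2 hz
  have hq0 : 0 ≤ K / z.re := by positivity
  have hlt : ‖laplaceTransform b z‖ < 1 := by
    refine lt_of_le_of_lt ?_ hq
    have h := (norm_integral_le_integral_norm _).trans (integral_norm_convPow_le hδ hK.le hb hd 0 hz)
    rw [zero_add, pow_one] at h
    exact h
  set F : ℕ → ℝ → ℂ := fun n t =>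
    (-1) ^ n / ((n : ℂ) + 1) * (convPow b n t * Complex.exp (-(t : ℂ) * z)) with hF
  have hint : ∀ n, Integrable (F n) (volume.restrict (Set.Ioi 0)) := fun n =>
    (integrableOn_convPow_mul_cexp hδ hK.le hb hd n hz).const_mul _
  have hcoef : ∀ n : ℕ, ‖(-1) ^ n / ((n : ℂ) + 1)‖ ≤ 1 := fun n => by
    have e : ((n : ℂ) + 1) = ((n + 1 : ℕ) : ℂ) := by push_cast; rfl
    rw [norm_div, norm_pow, norm_neg, norm_one, one_pow, e, Complex.norm_natCast]
    exact div_le_one_of_le₀ (by exact_mod_cast Nat.succ_le_succ n.zero_le) (by positivity)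
  have hsum : Summable fun n => ∫ t in Set.Ioi (0 : ℝ), ‖F n t‖ := by
    refine Summable.of_nonneg_of_le (fun n => integral_nonneg fun t => norm_nonneg _) (fun n => ?_)
      ((summable_nat_add_iff 1).2 (summable_geometric_of_lt_one hq0 hq))
    refine le_trans ?_ (integral_norm_convPow_le hδ hK.le hb hd n hz)
    simp only [hF]
    simp_rw [norm_mul ((-1) ^ n / ((n : ℂ) + 1))]
    rw [integral_const_mul]
    exact mul_le_of_le_one_left (integral_nonneg fun t => norm_nonneg _) (hcoef n)
  have h := hasSum_integral_of_summable_integral_norm hint hsum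
  have e1 : ∀ n, ∫ t in Set.Ioi (0 : ℝ), F n t =
      (-1) ^ (n + 1 + 1) * laplaceTransform b z ^ (n + 1) / ((n + 1 : ℕ) : ℂ) := by
    intro n
    simp only [hF]
    rw [integral_const_mul]
    change _ * laplaceTransform (convPow b n) z = _
    rw [laplaceTransform_convPow hδ hK.le hb hd n hz]
    push_cast
    ring
  have e2 : ∀ t : ℝ, ∑' n, F n t = convLog b t * Complex.exp (-(t : ℂ) * z) := by
    intro t
    rw [convLog, ← tsum_mul_right]
    exact tsum_congr fun n => (mul_assoc _ _ _).symm
  simp_rw [e1, e2] at h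
  have h2 := Complex.hasSum_taylorSeries_log hlt
  rw [← hasSum_nat_add_iff' 1] at h2
  simp only [Finset.range_one, Finset.sum_singleton, Nat.cast_zero, div_zero, sub_zero] at h2
  exact h.unique h2

/-- The logarithm of a function represented by the Laplace transform of a bounded function on a
parabola is a Laplace transform as well. -/
theorem exists_laplaceTransform_log (hδ : 0 < δ) (hK : 0 < K) (hb : ∀ t ∈ parabola δ, ‖b t‖ ≤ K)
    (hd : DifferentiableOn ℂ b (parabola δ)) :
    ∃ B : ℂ → ℂ, DifferentiableOn ℂ B (parabola δ) ∧
      (∀ t ∈ parabola δ, ‖B t‖ ≤ Real.exp (2 * K * ‖t‖)) ∧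
      ∀ z : ℂ, 2 * K < z.re →
        IntegrableOn (fun t : ℝ => B t * Complex.exp (-(t : ℂ) * z)) (Set.Ioi 0) ∧
        z * laplaceTransform B z = Complex.log (1 + laplaceTransform b z) := by
  have hl := differentiableOn_convLog hK.le hb hd
  have hbl : ∀ t ∈ parabola δ, ‖convLog b t‖ ≤ K * Real.exp (K * ‖t‖) := fun t ht =>
    norm_convLog_le hK.le hb ht
  have hmono : MonotoneOn (fun x => K * Real.exp (K * x)) (Set.Ici 0) := fun x _ y _ hxy => by
    simp only; gcongr
  -- Convolution with `1` divides the Laplace transform by `z`, which compensates the prefactor `z`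
  -- of the claim. The extra factor `|t|` in the bound is absorbed by doubling the exponential rate.
  have hB : DifferentiableOn ℂ (segConv (convLog b) fun _ => 1) (parabola δ) :=
    differentiableOn_segConv (ψ := fun _ => 1) hl (by fun_prop) hmono monotoneOn_const hbl
      (fun t _ => by simp)
  have hBb : ∀ t ∈ parabola δ, ‖segConv (convLog b) (fun _ => 1) t‖ ≤
      Real.exp (2 * K * ‖t‖) := by
    intro t ht
    have h : ‖segConv (convLog b) (fun _ => 1) t‖ ≤ ‖t‖ * (K * Real.exp (K * ‖t‖)) := by
      rw [segConv, norm_mul]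
      refine mul_le_mul_of_nonneg_left ?_ (norm_nonneg t)
      have h := intervalIntegral.norm_integral_le_of_norm_le_const (a := 0) (b := 1)
        (C := K * Real.exp (K * ‖t‖)) (f := fun x : ℝ => convLog b (x * t) * 1) fun x hx => by
          rw [Set.uIoc_of_le zero_le_one] at hx
          rw [mul_one]
          refine (hbl _ (mul_mem_parabola hx.1.le hx.2 ht)).trans
            (hmono (norm_nonneg _) (norm_nonneg _) ?_)
          rw [norm_mul, Complex.norm_real, Real.norm_of_nonneg hx.1.le]
          exact mul_le_of_le_one_left (norm_nonneg _) hx.2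
      rwa [sub_zero, abs_one, mul_one] at h
    refine h.trans ?_
    have h2 : K * ‖t‖ ≤ Real.exp (K * ‖t‖) := by linarith [Real.add_one_le_exp (K * ‖t‖)]
    calc ‖t‖ * (K * Real.exp (K * ‖t‖)) = K * ‖t‖ * Real.exp (K * ‖t‖) := by ring
      _ ≤ Real.exp (K * ‖t‖) * Real.exp (K * ‖t‖) := by gcongr
      _ = _ := by rw [← Real.exp_add]; ring_nf
  refine ⟨_, hB, hBb, fun z hz => ?_⟩
  have hz0 : 0 < z.re := by linarith
  have hne : z ≠ 0 := fun h => by simp [h] at hz0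
  refine ⟨integrableOn_mul_cexp_Ioi (A := 1) (c := 2 * K) (continuousOn_comp_ofReal hδ hB)
    (fun t ht => ?_) hz, ?_⟩
  · have h := hBb _ (ofReal_mem_parabola hδ ht)
    rwa [Complex.norm_real, Real.norm_of_nonneg ht, ← one_mul (Real.exp _)] at h
  · have h1 : IntegrableOn (fun t : ℝ => convLog b t * Complex.exp (-(t : ℂ) * z)) (Set.Ioi 0) :=
      integrableOn_mul_cexp_Ioi (A := K) (c := K) (continuousOn_comp_ofReal hδ hl) (fun t ht => by
        have h := hbl _ (ofReal_mem_parabola hδ ht)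
        rwa [Complex.norm_real, Real.norm_of_nonneg ht] at h) (by linarith)
    have h2 := integrableOn_pow_mul_cexp_Ioi hz0 0
    have h3 := integral_pow_mul_cexp_Ioi hz0 0
    simp only [pow_zero, zero_add, pow_one, Nat.factorial_zero, Nat.cast_one] at h2 h3
    rw [laplaceTransform_segConv h1 h2, laplaceTransform_convLog hδ hK hb hd (by linarith)]
    change laplaceTransform (fun _ => 1) z = _ at h3
    rw [h3]
    field_simp

end ConvLog

/-! ### Asymptotic expansions of Laplace transforms -/

theorem taylor_isBigO {B : ℂ → ℂ} (hB : AnalyticAt ℂ B 0) (r : ℕ) :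
    (fun y : ℂ => B y - ∑ k ∈ Finset.range r, iteratedDeriv k B 0 / k.factorial * y ^ k)
      =O[𝓝 0] fun y => ‖y‖ ^ r := by
  have h := hB.hasFPowerSeriesAt.isBigO_sub_partialSum_pow r
  simpa [FormalMultilinearSeries.partialSum, mul_comm] using h

/-- The local estimate becomes global at the price of an exponential: for `t ≥ ε` one has `tᵏ ≤
(1/ε) ^ (r - k) tʳ`, so `B` and the polynomial are bounded separately. -/
theorem norm_sub_polynomial_le {B : ℂ → ℂ} {β : ℕ → ℂ} {c : ℝ} (hc : 0 ≤ c)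
    (hBb : ∀ t : ℝ, 0 ≤ t → ‖B t‖ ≤ Real.exp (c * t)) {r : ℕ}
    (hO : (fun y : ℂ => B y - ∑ k ∈ Finset.range r, β k * y ^ k) =O[𝓝 0] fun y => ‖y‖ ^ r) :
    ∃ M, ∀ t : ℝ, 0 ≤ t →
      ‖B t - ∑ k ∈ Finset.range r, β k * (t : ℂ) ^ k‖ ≤ M * (t ^ r * Real.exp (c * t)) := by
  obtain ⟨M, hM, hb⟩ := hO.exists_pos
  obtain ⟨ε, hε, hball⟩ := Metric.eventually_nhds_iff.1 hb.bound
  refine ⟨max M ((1 / ε) ^ r + ∑ k ∈ Finset.range r, ‖β k‖ * (1 / ε) ^ (r - k)), fun t ht => ?_⟩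
  have hexp : 1 ≤ Real.exp (c * t) := Real.one_le_exp (by positivity)
  rcases lt_or_ge t ε with h | h
  · have h1 := hball (y := (t : ℂ)) (by
      rwa [dist_zero_right, Complex.norm_real, Real.norm_of_nonneg ht])
    rw [norm_pow, norm_norm, Complex.norm_real, Real.norm_of_nonneg ht] at h1
    refine h1.trans ?_
    have h2 : t ^ r ≤ t ^ r * Real.exp (c * t) := le_mul_of_one_le_right (by positivity) hexp
    exact mul_le_mul (le_max_left _ _) h2 (by positivity) (hM.le.trans (le_max_left _ _))
  · have hq : 1 ≤ 1 / ε * t := by rw [one_div_mul_eq_div]; exact (one_le_div hε).2 h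
    calc _ ≤ ‖B t‖ + ∑ k ∈ Finset.range r, ‖β k * (t : ℂ) ^ k‖ :=
          (norm_sub_le _ _).trans (add_le_add_right (norm_sum_le _ _) _)
      _ ≤ (1 / ε) ^ r * (t ^ r * Real.exp (c * t)) + ∑ k ∈ Finset.range r,
          ‖β k‖ * (1 / ε) ^ (r - k) * (t ^ r * Real.exp (c * t)) := by
          gcongr with k hk
          · refine (hBb t ht).trans ?_
            rw [← mul_assoc, ← mul_pow]
            exact le_mul_of_one_le_left (Real.exp_pos _).le (one_le_pow₀ hq)
          · rw [norm_mul, norm_pow, Complex.norm_real, Real.norm_of_nonneg ht, mul_assoc]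
            refine mul_le_mul_of_nonneg_left ?_ (norm_nonneg _)
            have e : t ^ r = t ^ (r - k) * t ^ k := by
              rw [← pow_add, Nat.sub_add_cancel (Finset.mem_range.1 hk).le]
            have h3 : 1 ≤ (1 / ε * t) ^ (r - k) * Real.exp (c * t) :=
              one_le_mul_of_one_le_of_one_le (one_le_pow₀ hq) hexp
            calc t ^ k ≤ (1 / ε * t) ^ (r - k) * Real.exp (c * t) * t ^ k :=
                  le_mul_of_one_le_left (by positivity) h3
              _ = _ := by rw [e, mul_pow]; ring
      _ = ((1 / ε) ^ r + ∑ k ∈ Finset.range r, ‖β k‖ * (1 / ε) ^ (r - k)) *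
          (t ^ r * Real.exp (c * t)) := by rw [add_mul, Finset.sum_mul]
      _ ≤ _ := by gcongr; exact le_max_right _ _

/-- Watson's lemma. -/
theorem laplaceTransform_asymptotics {B : ℂ → ℂ} {β : ℕ → ℂ} {c : ℝ} (hc : 0 ≤ c)
    (hB : ContinuousOn (fun t : ℝ => B t) (Set.Ici 0))
    (hBb : ∀ t : ℝ, 0 ≤ t → ‖B t‖ ≤ Real.exp (c * t)) {r : ℕ}
    (hO : (fun y : ℂ => B y - ∑ k ∈ Finset.range r, β k * y ^ k) =O[𝓝 0] fun y => ‖y‖ ^ r) :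
    ∃ C, ∀ s : ℝ, 0 < s → 2 * c * s < 1 →
      ‖(s : ℂ)⁻¹ * laplaceTransform B (s : ℂ)⁻¹ -
        ∑ k ∈ Finset.range r, k.factorial * β k * (s : ℂ) ^ k‖ ≤ C * s ^ r := by
  obtain ⟨M, hM⟩ := norm_sub_polynomial_le hc hBb hO
  have hM0 : 0 ≤ M := by
    have h := (norm_nonneg _).trans (hM 1 zero_le_one)
    have h2 := Real.exp_pos (c * 1)
    rw [one_pow, one_mul] at h
    exact nonneg_of_mul_nonneg_left h h2
  refine ⟨M * 2 ^ (r + 1) * r.factorial, fun s hs hcs => ?_⟩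
  have hsne : (s : ℂ) ≠ 0 := Complex.ofReal_ne_zero.2 hs.ne'
  have hre : ((s : ℂ)⁻¹).re = s⁻¹ := by rw [← Complex.ofReal_inv, Complex.ofReal_re]
  have hs' : 0 < ((s : ℂ)⁻¹).re := by rw [hre]; positivity
  -- The condition `2 c s < 1` keeps the effective decay rate `1/s - c` above `1 / (2s)`; this is
  -- the origin of `2 ^ (r + 1)`.
  have hcs' : (2 * s)⁻¹ < s⁻¹ - c := by
    rw [lt_sub_iff_add_lt, mul_inv, ← lt_sub_iff_add_lt', show s⁻¹ - 2⁻¹ * s⁻¹ = 1 / (2 * s) by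
      field_simp; norm_num, lt_div_iff₀ (by positivity)]
    linarith
  have h2s : 0 < (2 * s)⁻¹ := by positivity
  have hd : 0 < s⁻¹ - c := h2s.trans hcs'
  have hi := integrableOn_mul_cexp_Ioi (A := 1) (c := c) hB (by simpa using hBb)
    (z := (s : ℂ)⁻¹) (by rw [hre]; linarith)
  have hik : ∀ k ∈ Finset.range r, Integrable (fun t : ℝ => β k * ((t : ℂ) ^ k *
      Complex.exp (-(t : ℂ) * (s : ℂ)⁻¹))) (volume.restrict (Set.Ioi 0)) := fun k _ =>
    (integrableOn_pow_mul_cexp_Ioi hs' k).const_mul _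
  have e : laplaceTransform B (s : ℂ)⁻¹ -
      s * ∑ k ∈ Finset.range r, k.factorial * β k * (s : ℂ) ^ k =
      ∫ t in Set.Ioi (0 : ℝ), (B t - ∑ k ∈ Finset.range r, β k * (t : ℂ) ^ k) *
        Complex.exp (-(t : ℂ) * (s : ℂ)⁻¹) := by
    simp_rw [sub_mul, Finset.sum_mul, mul_assoc]
    rw [integral_sub hi (integrable_finsetSum _ hik), integral_finsetSum _ hik, laplaceTransform,
      Finset.mul_sum]
    congr 1
    refine Finset.sum_congr rfl fun k _ => ?_
    rw [integral_const_mul, integral_pow_mul_cexp_Ioi hs', inv_pow, div_inv_eq_mul]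
    ring
  have hbound : ‖laplaceTransform B (s : ℂ)⁻¹ -
      s * ∑ k ∈ Finset.range r, k.factorial * β k * (s : ℂ) ^ k‖ ≤
      M * (r.factorial / (s⁻¹ - c) ^ (r + 1)) := by
    rw [e, ← integral_pow_mul_exp_neg_Ioi hd, ← integral_const_mul]
    refine norm_integral_le_of_norm_le ((integrableOn_pow_mul_exp_neg_Ioi hd r).const_mul M) ?_
    filter_upwards [ae_restrict_mem measurableSet_Ioi] with t ht
    have ht0 : 0 ≤ t := le_of_lt ht
    have h2 := norm_pow_mul_cexp (z := (s : ℂ)⁻¹) ht0 0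
    rw [pow_zero, one_mul, pow_zero, one_mul, hre] at h2
    rw [norm_mul, h2]
    refine (mul_le_mul_of_nonneg_right (hM t ht0) (Real.exp_pos _).le).trans_eq ?_
    rw [mul_assoc, mul_assoc, ← Real.exp_add]
    congr 3
    ring
  have e2 : (s : ℂ)⁻¹ * laplaceTransform B (s : ℂ)⁻¹ -
      ∑ k ∈ Finset.range r, k.factorial * β k * (s : ℂ) ^ k = (s : ℂ)⁻¹ *
      (laplaceTransform B (s : ℂ)⁻¹ -
        s * ∑ k ∈ Finset.range r, k.factorial * β k * (s : ℂ) ^ k) := by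
    rw [mul_sub, inv_mul_cancel_left₀ hsne]
  rw [e2, norm_mul, norm_inv, Complex.norm_real, Real.norm_of_nonneg hs.le]
  calc _ ≤ s⁻¹ * (M * (r.factorial / (2 * s)⁻¹ ^ (r + 1))) := by
        refine mul_le_mul_of_nonneg_left (hbound.trans ?_) (by positivity)
        gcongr
    _ = _ := by
        rw [inv_pow, div_inv_eq_mul, mul_pow, pow_succ s]
        field_simp

namespace TGFT

/-! ### Borel summability of the free energy -/

/-- Moving a point by `d` changes `|t| - Re t` by at most `2 d`, so circles of radius `width / 2`
centred in the half-width parabola stay in the full one, and Cauchy's estimate gives `8 / (width /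
2)`. -/
theorem norm_deriv_borelZ_le {m : ℝ} (hm : 0 < m) {t : ℂ} (ht : t ∈ parabola (width m / 2)) :
    ‖deriv (borelZ m) t‖ ≤ 16 / width m := by
  have hw := width_pos hm
  have hsub : Metric.closedBall t (width m / 2) ⊆ parabola (width m) := fun w hw' => by
    have h := norm_sub_re_le t w
    rw [Metric.mem_closedBall, dist_eq_norm] at hw'
    rw [parabola, Set.mem_ofPred_eq] at ht ⊢
    linarith
  have h := Complex.norm_deriv_le_of_forall_mem_sphere_norm_le (half_pos hw)
    (((differentiableOn_borelZ hm).mono hsub).diffContOnCl_ball subset_rfl)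
    fun z hz => norm_borelZ_le hm (hsub (Metric.sphere_subset_closedBall hz))
  refine h.trans_eq ?_
  field_simp
  norm_num

theorem parabola_mono {δ ε : ℝ} (h : δ ≤ ε) : parabola δ ⊆ parabola ε := fun t ht => by
  rw [parabola, Set.mem_ofPred_eq] at ht ⊢
  linarith

theorem differentiableOn_deriv_borelZ {m : ℝ} (hm : 0 < m) :
    DifferentiableOn ℂ (deriv (borelZ m)) (parabola (width m / 2)) :=
  ((differentiableOn_borelZ hm).deriv (isOpen_parabola _)).mono
    (parabola_mono (by linarith [width_pos hm]))

/-- Integration by parts with `borelZ m 0 = 1` writes the partition function as `1` plus the Laplace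
transform of a bounded function, the form to which the convolution logarithm applies. -/
theorem laplaceTransform_deriv_borelZ {m : ℝ} (hm : 0 < m) {z : ℂ} (hz : 0 < z.re) :
    1 + laplaceTransform (deriv (borelZ m)) z =
      ∫ T, Complex.exp (-(z⁻¹ * (realAction T : ℂ))) ∂(fieldMeasure m) := by
  have hw := width_pos hm
  have hd : ∀ t : ℝ, 0 ≤ t → HasDerivAt (fun t : ℝ => borelZ m t * Complex.exp (-(t : ℂ) * z))
      (deriv (borelZ m) t * Complex.exp (-(t : ℂ) * z) -
        z * (borelZ m t * Complex.exp (-(t : ℂ) * z))) t := by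
    intro t ht
    have h0 := ((differentiableOn_borelZ hm).differentiableAt
      ((isOpen_parabola _).mem_nhds (ofReal_mem_parabola hw ht))).hasDerivAt
    have h1 : HasDerivAt (fun w : ℂ => borelZ m w * Complex.exp (-w * z))
        (deriv (borelZ m) t * Complex.exp (-(t : ℂ) * z) +
          borelZ m t * (Complex.exp (-(t : ℂ) * z) * (-1 * z))) (t : ℂ) :=
      h0.mul (((hasDerivAt_id (t : ℂ)).neg.mul_const z).cexp)
    convert h1.comp_ofReal using 1
    ring
  have hb : ∀ t : ℝ, 0 ≤ t → ‖borelZ m t‖ ≤ 8 := fun t ht =>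
    norm_borelZ_le hm (ofReal_mem_parabola hw ht)
  have ht : Tendsto (fun t : ℝ => borelZ m t * Complex.exp (-(t : ℂ) * z)) atTop (𝓝 0) := by
    have h := (tendsto_rpow_mul_exp_neg_mul_atTop_nhds_zero 0 z.re hz).const_mul 8
    rw [mul_zero] at h
    refine squeeze_zero_norm' ?_ h
    filter_upwards [eventually_ge_atTop 0] with t ht
    have h2 := norm_pow_mul_cexp (z := z) ht 0
    rw [pow_zero, one_mul, pow_zero, one_mul] at h2
    rw [norm_mul, h2, Real.rpow_zero, one_mul, neg_mul]
    exact mul_le_mul_of_nonneg_right (hb t ht) (Real.exp_pos _).le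
  have hi1 : IntegrableOn (fun t : ℝ => deriv (borelZ m) t * Complex.exp (-(t : ℂ) * z))
      (Set.Ioi 0) :=
    integrableOn_mul_cexp_Ioi (A := 16 / width m) (c := 0)
      (continuousOn_comp_ofReal (half_pos hw) (differentiableOn_deriv_borelZ hm))
      (fun t ht => by
        simpa using norm_deriv_borelZ_le hm (ofReal_mem_parabola (half_pos hw) ht)) hz
  have hi2 : IntegrableOn (fun t : ℝ => borelZ m t * Complex.exp (-(t : ℂ) * z)) (Set.Ioi 0) :=
    integrableOn_mul_cexp_Ioi (A := 8) (c := 0)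
      (continuousOn_comp_ofReal hw (differentiableOn_borelZ hm))
      (fun t ht => by simpa using hb t ht) hz
  have hi3 := Integrable.const_mul hi2 z
  have h := integral_Ioi_of_hasDerivAt_of_tendsto (a := 0)
    ((hd 0 le_rfl).continuousAt.continuousWithinAt) (fun t ht => hd t (le_of_lt ht))
    (hi1.sub hi3) ht
  rw [integral_sub hi1 hi3, integral_const_mul, Complex.ofReal_zero, borelZ_zero, neg_zero,
    zero_mul, Complex.exp_zero, one_mul, zero_sub] at h
  rw [← laplaceTransform_borelZ m hz]
  simp only [laplaceTransform]
  linear_combination h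

/-- The disc `Re (1 / lam) > 1 / R` is `|lam| < R cos φ`, and `cos φ = 2 cos² (φ/2) - 1 ≤ cos²
(φ/2)`. -/
theorem mem_cardioid_of_inv_re {κ R : ℝ} (hR : 0 < R) (hRκ : R ≤ κ) {lam : ℂ}
    (h : 1 / R < (lam⁻¹).re) : lam ∈ cardioid κ ∧ 0 < lam.re := by
  have hne : lam ≠ 0 := fun h0 => by
    rw [h0, inv_zero, Complex.zero_re] at h
    exact absurd h (not_lt.2 (by positivity))
  have hn : 0 < ‖lam‖ := norm_pos_iff.2 hne
  have hcos : ‖lam‖ * Real.cos lam.arg = lam.re := Complex.norm_mul_cos_arg lam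
  have h1 : 1 / R < Real.cos lam.arg / ‖lam‖ := by
    refine h.trans_eq ?_
    rw [Complex.inv_re, ← hcos, Complex.normSq_eq_norm_sq]
    field_simp
  rw [div_lt_div_iff₀ hR hn, one_mul] at h1
  have hc : 0 < Real.cos lam.arg := pos_of_mul_pos_left (hn.trans h1) hR.le
  refine ⟨⟨hne, ?_⟩, by rw [← hcos]; positivity⟩
  have h2 : Real.cos lam.arg = 2 * Real.cos (lam.arg / 2) ^ 2 - 1 := by
    rw [← Real.cos_two_mul]; congr 1; ring
  have h3 := Real.cos_le_one lam.arg
  have h4 : Real.cos lam.arg ≤ Real.cos (lam.arg / 2) ^ 2 := by linarith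
  calc ‖lam‖ < Real.cos lam.arg * R := h1
    _ ≤ Real.cos (lam.arg / 2) ^ 2 * κ := by gcongr
    _ = _ := mul_comm _ _

theorem ball_subset_parabola (δ : ℝ) : Metric.ball 0 δ ⊆ parabola δ := fun t ht => by
  rw [mem_ball_zero_iff] at ht
  have := norm_sub_re_le 0 t
  rw [norm_zero, Complex.zero_re, sub_zero, sub_zero] at this
  rw [parabola, Set.mem_ofPred_eq]
  linarith

theorem isBorelSummable_freeEnergy {m : ℝ} (hm : 0 < m) :
    IsBorelSummable (freeEnergyCoeff m) (freeEnergy m) := by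
  have hw := width_pos hm
  have hκ := freeSize_pos hm
  have hδ := half_pos hw
  have hK : 0 < 16 / width m := by positivity
  obtain ⟨B, hB, hBb, hBL⟩ := exists_laplaceTransform_log hδ hK
    (fun t ht => norm_deriv_borelZ_le hm ht) (differentiableOn_deriv_borelZ hm)
  set c := 2 * (16 / width m) with hc
  have hc0 : 0 < c := by positivity
  -- The first entry puts the disc inside the cardioid; the second makes the Laplace integral, whose
  -- integrand grows at rate `c`, converge there.
  have hR : 0 < min (freeSize m) (1 / c) := lt_min hκ (by positivity)
  set R := min (freeSize m) (1 / c) with hRdef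
  have hcR : c ≤ 1 / R := by
    rw [le_div_iff₀ hR, ← le_div_iff₀' hc0]
    exact min_le_right _ _
  have hF : ∀ lam : ℂ, 1 / R < (lam⁻¹).re →
      IntegrableOn (fun t : ℝ => B t * Complex.exp (-(t : ℂ) * lam⁻¹)) (Set.Ioi 0) ∧
      freeEnergy m lam = lam⁻¹ * laplaceTransform B lam⁻¹ := by
    intro lam hlam
    obtain ⟨hmem, hre⟩ := mem_cardioid_of_inv_re hR (min_le_left _ _) hlam
    obtain ⟨h1, h2⟩ := hBL lam⁻¹ (hcR.trans_lt hlam)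
    refine ⟨h1, ?_⟩
    rw [h2, laplaceTransform_deriv_borelZ hm ((by positivity : (0 : ℝ) < 1 / R).trans hlam),
      inv_inv, freeEnergy, partitionFunction_eq_integral_realAction hm
        (cardioid_mono (min_le_left _ _) hmem) hre.le]
  have hBreal : ∀ t : ℝ, 0 ≤ t → ‖B t‖ ≤ Real.exp (c * t) := fun t ht => by
    have h := hBb _ (ofReal_mem_parabola hδ ht)
    rwa [Complex.norm_real, Real.norm_of_nonneg ht] at h
  have hA : AnalyticAt ℂ B 0 := hB.analyticAt
    ((isOpen_parabola _).mem_nhds (ball_subset_parabola _ (Metric.mem_ball_self hδ)))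
  have hcoef : freeEnergyCoeff m = fun k =>
      k.factorial * (iteratedDeriv k B 0 / k.factorial) := by
    -- The free energy at real `s → 0+` has two expansions: the perturbative one, by the remainder
    -- bounds on the cardioid, and the one given by Watson's lemma for `B`. Hence `B` has the Taylor
    -- coefficients of the formal Borel transform.
    refine eq_of_asymptotic_expansions (f := fun s : ℝ => freeEnergy m s)
      (ε := R / 2) (half_pos hR) (φ := fun n => n + 1) (fun n => Nat.lt_succ_self n)
      (fun r => ?_) (fun r => ?_)
    · refine ⟨1 / 2 * growth m ^ (r + 1) * (r + 1).factorial, fun s hs hsR => ?_⟩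
      have h := norm_remainder_le hm (r + 1) (ofReal_mem_cardioid hs
        (hsR.trans ((half_lt_self hR).trans_le (min_le_left _ _))))
      rw [Complex.norm_real, Real.norm_of_nonneg hs.le] at h
      exact h.trans_eq (by ring)
    · obtain ⟨C, hC⟩ := laplaceTransform_asymptotics hc0.le (continuousOn_comp_ofReal hδ hB) hBreal
        (taylor_isBigO hA (r + 1))
      refine ⟨C, fun s hs hsR => ?_⟩
      have hRs : 1 / R < ((s : ℂ)⁻¹).re := by
        rw [← Complex.ofReal_inv, Complex.ofReal_re, ← one_div]
        exact one_div_lt_one_div_of_lt hs (hsR.trans (half_lt_self hR))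
      rw [(hF s hRs).2]
      refine hC s hs ?_
      have h1 : c * R ≤ 1 := by rwa [le_div_iff₀ hR] at hcR
      have h2 : c * s < c * (R / 2) := mul_lt_mul_of_pos_left hsR hc0
      linarith
  refine ⟨R, width m / 2, 1, B, hR, hδ, ?_, fun t ht => ?_, fun t ht => ?_, fun lam hlam => ?_⟩
  · exact (hB.analyticOnNhd (isOpen_parabola _)).mono (thickening_subset_parabola _)
  · have h := Complex.hasSum_taylorSeries_on_ball
      (hB.mono (ball_subset_parabola _)) (z := t) (mem_ball_zero_iff.2 ht)
    refine (funext fun n => ?_ : (fun n : ℕ => (n.factorial : ℂ)⁻¹ • (t - 0) ^ n •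
      iteratedDeriv n B 0) = fun n => freeEnergyCoeff m n / n.factorial * t ^ n) ▸ h
    have : (n.factorial : ℂ) ≠ 0 := by exact_mod_cast n.factorial_ne_zero
    rw [hcoef, sub_zero, smul_eq_mul, smul_eq_mul]
    field_simp
  · rw [one_mul]
    refine (hBb t (thickening_subset_parabola _ ht)).trans (Real.exp_le_exp.2 ?_)
    rw [div_eq_mul_one_div, mul_comm]
    gcongr
  · simp_rw [div_eq_mul_inv]
    exact hF lam hlam

end TGFT

end

/-! ### The main theorem -/

theorem mainTheorem2 (m : ℝ) (hm : 0 < m) :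
    -- the perturbative coefficients are given by convergent integrals
    (∀ k : ℕ, Integrable (fun T => TGFT.interaction T ^ k) (TGFT.fieldMeasure m)) ∧
    ∃ κ A B : ℝ, 0 < κ ∧ 0 < A ∧ 0 < B ∧
      -- the partition function is well defined on the cardioid and has no zero there
      (∀ lam ∈ TGFT.cardioid κ,
        Tendsto (fun N : ℕ => TGFT.cutoffPartitionFunction m N lam) atTop
          (𝓝 (TGFT.partitionFunction m lam)) ∧
        TGFT.partitionFunction m lam ≠ 0) ∧
      -- it is the functional integral of the field theory wherever the latter makes sense
      (∀ lam ∈ TGFT.cardioid κ, 0 ≤ lam.re →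
        TGFT.partitionFunction m lam =
          ∫ T, Complex.exp (-(lam * TGFT.interaction T)) ∂(TGFT.fieldMeasure m)) ∧
      -- analyticity of the free energy
      AnalyticOnNhd ℂ (TGFT.freeEnergy m) (TGFT.cardioid κ) ∧
      -- the remainder bound, uniform in the cardioid and in the order
      (∀ r : ℕ, ∀ lam ∈ TGFT.cardioid κ,
        ‖TGFT.remainder m r lam‖ ≤ A * B ^ r * ‖lam‖ ^ r * (r.factorial : ℝ)) ∧
      -- Borel summability of the perturbative series of the free energy
      IsBorelSummable (TGFT.freeEnergyCoeff m) (TGFT.freeEnergy m) := by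
  refine ⟨TGFT.integrable_interaction_pow hm, TGFT.freeSize m, 1 / 2, TGFT.growth m,
    TGFT.freeSize_pos hm, by norm_num, TGFT.growth_pos hm, fun lam h => ?_, fun lam h h0 => ?_,
    TGFT.analyticOnNhd_freeEnergy hm, fun r lam h => TGFT.norm_remainder_le hm r h,
    TGFT.isBorelSummable_freeEnergy hm⟩
  · exact ⟨TGFT.tendsto_partitionFunction hm (TGFT.cardioid_mono (min_le_left _ _) h),
      TGFT.partitionFunction_ne_zero hm h⟩
  · exact TGFT.partitionFunction_eq_integral hm (TGFT.cardioid_mono (min_le_left _ _) h) h0
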